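/- **Setting.** Let $\mathbb T=\mathbb R/\mathbb Z\cong(-1/2,1/2]$, $\mathbb R_*=\mathbb R\setminus\{0\}$, $\mathbb T_*=\mathbb T\setminus\{0\}$, and let $\gamma_0,\gamma_1>0$. Let $(\alpha_x)_{x\in\mathbb Z}$ be real with $|\alpha_x|\le Ce^{-|x|/C}$ for some $C>0$, and such that $\hat\alpha(k)=\sum_x\alpha_xe^{-2\pi ixk}$ is real, $\hat\alpha(k)>0$ for $k\ne0$, and $\hat\alpha''(0)>0$ in case $\hat\alpha(0)=0$. Assume that $\omega:=\sqrt{\hat\alpha}$ is strictly increasing on $[0,1/2]$, with $\omega'>0$ on $(0,1/2)$ and $\omega''(1/2)<0$. Put $\bar\omega'=\omega'/(2\pi)$, $$\tilde J(\lambda)=\int_0^\infty e^{-\lambda t}\int_{\mathbb T}\cos(\omega(k)t)\,dk\,dt,\quad \tilde g(\lambda)=\frac1{1+\gamma_1\tilde J(\lambda)}\quad(\operatorname{Re}\lambda>0),\quad \nu(k)=\lim_{\epsilon\to0+}\tilde g(\epsilon-i\omega(k)),$$ $$\wp(k)=\frac{\gamma_1\nu(k)}{2|\bar\omega'(k)|},\qquad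 p_+(k)=|1-\wp(k)|^2,\qquad p_-(k)=|\wp(k)|^2,$$ with the limiting value $\wp(1/2)=1$ at $k=1/2$, where $\bar\omega'$ vanishes. Let $r(k,k')=4\sin(\pi k)\sin(\pi(k-k'))\sin(\pi(2k-k'))$, $R(k,k')=\frac12\{r^2(k,k-k')+r^2(k,k+k')\}$, $R(k)=\int_{\mathbb T}R(k,k')dk'$, $LF(k)=2\int_{\mathbb T}R(k,k')[F(k')-F(k)]dk'$ and $\mathcal RF(k)=\int_{\mathbb T}R(k,k')F(k')dk'$; $L$ and $\mathcal R$ act on functions of $(y,k)$ through the variable $k$. Functions take values in $\mathbb K=\mathbb R$ or $\mathbb K=\mathbb C$. Let $\mathcal C_0$ be the space of bounded continuous functions $F$ on $\mathbb R_*\times\mathbb T_*$ that extend continuously to $[0,\infty)\times\mathbb T_*$ and to $(-\infty,0]\times\mathbb T_*$ and satisfy the interface conditions $$F(0^+,k)=p_-(k)F(0^+,-k)+p_+(k)F(0^-,k)\ \ (0<k\le\tfrac12),\qquad F(0^-,k)=p_-(k)F(0^-,-k)+p_+(k)F(0^+,k)\ \ (-\tfrac12<k<0).$$ A classical solution started from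 $W_0\in\mathcal C_0$ is a function $W(t,y,k)$, $t\ge0$, with $W(0)=W_0$, that is bounded and continuous on $(0,\infty)\times\mathbb R_*\times\mathbb T_*$ and such that: (1) its restrictions to $\{t>0,\,y>0\}$ and $\{t>0,\,y<0\}$ (with $k\in\mathbb T_*$) extend continuously to $[0,\infty)\times[0,\infty)\times\mathbb T_*$ and $[0,\infty)\times(-\infty,0]\times\mathbb T_*$, respectively; (2) for $t>0$, $y\ne0$, $k\ne0$ the function $s\mapsto W(t+s,y+\bar\omega'(k)s,k)$ is $C^1$ near $s=0$, and its derivative $D_tW(t,y,k)$ at $s=0$ is bounded in $(t,y,k)$ and satisfies $D_tW=\gamma_0L_kW$; (3) $W(t)$ satisfies the interface conditions for every $t\ge0$, and $W(t,y,k)\to W_0(y,k)$ as $t\to0+$ for all $y\neq 0$, $k\ne0$. Finally let $$\mathfrak W^{\rm un}_tF(y,k)=e^{-2\gamma_0R(k)t}\begin{cases}F(y-\bar\omega'(k)t,k),& y\notin[0,\bar\omega'(k)t],\\ p_+(k)F(y-\bar\omega'(k)t,k)+p_-(k)F(-y+\bar\omega'(k)t,-k),& y\in[0,\bar\omega'(k)t],\end{cases}$$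 where $[0,a]$ means $[a,0]$ if $a<0$. **Proposition.** For every $W_0\in\mathcal C_0$ there is exactly one classical solution $W$ started from $W_0$ (as a function on $[0,\infty)\times\mathbb R_*\times\mathbb T_*$); put $\mathfrak W_t(W_0):=W(t)$. Let $\mathcal C_0'=\mathcal C_0\cap L^2(\mathbb R\times\mathbb T)$. Then: 1. $\mathfrak W_t(\mathcal C_0')\subset\mathcal C_0'$ for all $t\ge0$. 2. For each $t\ge 0$ the map $\mathfrak W_t$ on $\mathcal C_0'$ extends to exactly one bounded operator on $L^2(\mathbb R\times\mathbb T)$, again denoted $\mathfrak W_t$, and $(\mathfrak W_t)_{t\ge0}$ is a $C_0$-continuous semigroup of contractions on $L^2(\mathbb R\times\mathbb T)$. 3. $\mathfrak W^{\rm un}_t$ ($t\ge0$) and $\mathcal R$ define bounded operators on $L^2(\mathbb R\times\mathbb T)$, and $(\mathfrak W_t)_{t\ge0}$ is the unique solution in $L^2(\mathbb R\times\mathbb T)$ of $$\mathfrak W_t=\mathfrak W^{\rm un}_t+2\gamma_0\int_0^t\mathfrak W^{\rm un}_{t-s}\mathcal R\,\mathfrak W_s\,ds,\qquad t\ge0,$$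 in the following sense: for every $f\in L^2(\mathbb R\times\mathbb T)$ the function $u(t)=\mathfrak W_tf$ is the only $u:[0,\infty)\to L^2(\mathbb R\times\mathbb T)$, Bochner integrable on bounded intervals, with $u(t)=\mathfrak W^{\rm un}_tf+2\gamma_0\int_0^t\mathfrak W^{\rm un}_{t-s}\mathcal Ru(s)\,ds$ for all $t\ge0$. -/

import Mathlib

open MeasureTheory Set Filter Topology

namespace KineticInterface

noncomputable section

/-! ### The torus and the dispersion relation -/

/-- The representative in `(-1/2, 1/2]` of a point of the unit torus `𝕋 = ℝ/ℤ`. -/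
def rep (k : UnitAddCircle) : ℝ := (AddCircle.equivIoc (1 : ℝ) (-1 / 2) k : ℝ)

/-- The Fourier series `α̂(k) = ∑ₓ αₓ exp(-2πixk)`, as a `1`-periodic function on `ℝ`. -/
def alphaHat (α : ℤ → ℝ) (k : ℝ) : ℂ :=
  ∑' x : ℤ, (α x : ℂ) * Complex.exp (-(2 * Real.pi * Complex.I * (x : ℂ) * (k : ℂ)))

/-- The dispersion relation `ω = √α̂`, as a `1`-periodic function on `ℝ`. -/
def omega (α : ℤ → ℝ) (k : ℝ) : ℝ := Real.sqrt (alphaHat α k).re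

/-- The standing assumptions on the coupling constants `(αₓ)` of the chain. -/
structure IsAdmissible (α : ℤ → ℝ) : Prop where
  decay : ∃ C : ℝ, 0 < C ∧ ∀ x : ℤ, |α x| ≤ C * Real.exp (-|(x : ℝ)| / C)
  real_valued : ∀ k : ℝ, (alphaHat α k).im = 0
  pos : ∀ k : ℝ, (∀ n : ℤ, k ≠ n) → 0 < (alphaHat α k).re
  acoustic : (alphaHat α 0).re = 0 → 0 < deriv (deriv fun k : ℝ => (alphaHat α k).re) 0
  unimodal : StrictMonoOn (omega α) (Icc 0 (1 / 2))
  /-- There are no critical points of `ω` besides (possibly) `0` and `1/2`. -/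
  no_critical : ∀ k ∈ Ioo (0 : ℝ) (1 / 2), 0 < deriv (omega α) k
  /-- The maximum of `ω` at `1/2` is non-degenerate. -/
  nondegenerate_max : deriv (deriv (omega α)) (1 / 2) < 0

/-- The group velocity `ω̄'(k) = ω'(k)/(2π)`. -/
def vel (α : ℤ → ℝ) (k : UnitAddCircle) : ℝ := deriv (omega α) (rep k) / (2 * Real.pi)

/-! ### The interface coefficients -/

/-- `J(t) = ∫_𝕋 cos(ω(k) t) dk`. -/
def J (α : ℤ → ℝ) (t : ℝ) : ℝ := ∫ k : UnitAddCircle, Real.cos (omega α (rep k) * t)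

/-- The Laplace transform of `J`. -/
def JTilde (α : ℤ → ℝ) (z : ℂ) : ℂ :=
  ∫ t in Ioi (0 : ℝ), Complex.exp (-(z * (t : ℂ))) * (J α t : ℂ)

/-- `g̃(λ) = (1 + γ₁ J̃(λ))⁻¹`. -/
def gTilde (α : ℤ → ℝ) (γ₁ : ℝ) (z : ℂ) : ℂ := (1 + (γ₁ : ℂ) * JTilde α z)⁻¹

/-- `ν(k) = lim_{ε → 0+} g̃(ε - iω(k))`. -/
def nu (α : ℤ → ℝ) (γ₁ : ℝ) (k : UnitAddCircle) : ℂ :=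
  limUnder (𝓝[>] (0 : ℝ))
    fun ε : ℝ => gTilde α γ₁ ((ε : ℂ) - Complex.I * (omega α (rep k) : ℂ))

open Classical in
/-- `℘(k) = γ₁ ν(k) / (2|ω̄'(k)|)`. On `𝕋 ∖ {0}` the velocity vanishes only at `k = 1/2`, where
the quotient is of the form `0/0`; there `℘` gets its limiting value `1`. -/
def wp (α : ℤ → ℝ) (γ₁ : ℝ) (k : UnitAddCircle) : ℂ :=
  if vel α k = 0 then 1 else (γ₁ : ℂ) * nu α γ₁ k / (2 * |vel α k| : ℝ)

/-- The transmission probability `p₊ = |1 - ℘|²`. -/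
def pPlus (α : ℤ → ℝ) (γ₁ : ℝ) (k : UnitAddCircle) : ℝ := ‖1 - wp α γ₁ k‖ ^ 2

/-- The reflection probability `p₋ = |℘|²`. -/
def pMinus (α : ℤ → ℝ) (γ₁ : ℝ) (k : UnitAddCircle) : ℝ := ‖wp α γ₁ k‖ ^ 2

/-! ### The scattering kernel -/

/-- `r(k,k') = 4 sin(πk) sin(π(k-k')) sin(π(2k-k'))`, which is `1`-periodic in both variables. -/
def r (k k' : ℝ) : ℝ :=
  4 * Real.sin (Real.pi * k) * Real.sin (Real.pi * (k - k')) * Real.sin (Real.pi * (2 * k - k'))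

/-- The scattering kernel `R(k,k') = (r²(k,k-k') + r²(k,k+k'))/2`. -/
def scatKernel (k k' : UnitAddCircle) : ℝ :=
  (r (rep k) (rep k - rep k') ^ 2 + r (rep k) (rep k + rep k') ^ 2) / 2

/-- The total scattering kernel `R(k) = ∫_𝕋 R(k,k') dk'`. -/
def totalKernel (k : UnitAddCircle) : ℝ := ∫ k' : UnitAddCircle, scatKernel k k'

variable {𝕜 : Type*} [RCLike 𝕜]

/-- `LF(k) = 2 ∫_𝕋 R(k,k') (F(k') - F(k)) dk'`. -/
def collision (F : UnitAddCircle → 𝕜) (k : UnitAddCircle) : 𝕜 :=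
  (2 : ℝ) • ∫ k' : UnitAddCircle, scatKernel k k' • (F k' - F k)

/-- `ℛF(y,k) = ∫_𝕋 R(k,k') F(y,k') dk'`. -/
def scatter (F : ℝ × UnitAddCircle → 𝕜) (x : ℝ × UnitAddCircle) : 𝕜 :=
  ∫ k' : UnitAddCircle, scatKernel x.2 k' • F (x.1, k')

open Classical in
/-- The explicit unperturbed evolution `𝔚ᵘⁿ_t F`; the interval between `0` and `ω̄'(k)t` is taken
irrespective of the sign of `ω̄'(k)`. -/
def unperturbed (α : ℤ → ℝ) (γ₀ γ₁ t : ℝ) (F : ℝ × UnitAddCircle → 𝕜)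
    (x : ℝ × UnitAddCircle) : 𝕜 :=
  Real.exp (-(2 * γ₀ * totalKernel x.2 * t)) •
    (if x.1 ∈ uIcc 0 (vel α x.2 * t) then
      pPlus α γ₁ x.2 • F (x.1 - vel α x.2 * t, x.2) +
        pMinus α γ₁ x.2 • F (-x.1 + vel α x.2 * t, -x.2)
    else F (x.1 - vel α x.2 * t, x.2))

/-! ### The space `𝒞₀` and classical solutions

Functions on `ℝ_* × 𝕋_*` are represented by functions on `ℝ × 𝕋`; their values on
`{y = 0} ∪ {k = 0}`, a null set, play no role. -/

/-- The interface conditions (with `T = 0`) between the traces `Fp = F(0⁺,·)` and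
`Fm = F(0⁻,·)`. -/
def Interface (α : ℤ → ℝ) (γ₁ : ℝ) (Fp Fm : UnitAddCircle → 𝕜) : Prop :=
  (∀ k : UnitAddCircle, 0 < rep k →
    Fp k = pMinus α γ₁ k • Fp (-k) + pPlus α γ₁ k • Fm k) ∧
  (∀ k : UnitAddCircle, rep k < 0 →
    Fm k = pMinus α γ₁ k • Fm (-k) + pPlus α γ₁ k • Fp k)

/-- The space `𝒞₀`: bounded continuous functions on `ℝ_* × 𝕋_*` that extend continuously to
`[0,∞) × 𝕋_*` and to `(-∞,0] × 𝕋_*`, and satisfy the interface conditions with `T = 0`. -/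
def IsC0 (α : ℤ → ℝ) (γ₁ : ℝ) (F : ℝ × UnitAddCircle → 𝕜) : Prop :=
  ContinuousOn F ({0}ᶜ ×ˢ {0}ᶜ) ∧
  (∃ C : ℝ, ∀ y : ℝ, ∀ k : UnitAddCircle, y ≠ 0 → k ≠ 0 → ‖F (y, k)‖ ≤ C) ∧
  ∃ Gp Gm : ℝ × UnitAddCircle → 𝕜,
    ContinuousOn Gp (Ici 0 ×ˢ {0}ᶜ) ∧ EqOn Gp F (Ioi 0 ×ˢ {0}ᶜ) ∧
    ContinuousOn Gm (Iic 0 ×ˢ {0}ᶜ) ∧ EqOn Gm F (Iio 0 ×ˢ {0}ᶜ) ∧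
    Interface α γ₁ (fun k => Gp (0, k)) (fun k => Gm (0, k))

/-- `W`, a function of `t` and `(y,k)`, is a classical solution of
`∂ₜW + ω̄'(k) ∂_yW = γ₀ L_k W` with initial datum `W₀` and the interface conditions with `T = 0`. -/
structure IsClassicalSolution (α : ℤ → ℝ) (γ₀ γ₁ : ℝ) (W₀ : ℝ × UnitAddCircle → 𝕜)
    (W : ℝ → ℝ × UnitAddCircle → 𝕜) : Prop where
  continuousOn : ContinuousOn (fun q : ℝ × (ℝ × UnitAddCircle) => W q.1 q.2)
    (Ioi 0 ×ˢ ({0}ᶜ ×ˢ {0}ᶜ))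
  bounded : ∃ C : ℝ, ∀ t : ℝ, 0 < t → ∀ y : ℝ, ∀ k : UnitAddCircle, y ≠ 0 → k ≠ 0 →
    ‖W t (y, k)‖ ≤ C
  /-- The restrictions of `W` to `y > 0` and to `y < 0` extend continuously to `t = 0` and to
  `y = 0`, and the traces satisfy the interface conditions at all times. -/
  extension : ∃ Gp Gm : ℝ × (ℝ × UnitAddCircle) → 𝕜,
    ContinuousOn Gp (Ici 0 ×ˢ (Ici 0 ×ˢ {0}ᶜ)) ∧
    EqOn Gp (fun q => W q.1 q.2) (Ioi 0 ×ˢ (Ioi 0 ×ˢ {0}ᶜ)) ∧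
    ContinuousOn Gm (Ici 0 ×ˢ (Iic 0 ×ˢ {0}ᶜ)) ∧
    EqOn Gm (fun q => W q.1 q.2) (Ioi 0 ×ˢ (Iio 0 ×ˢ {0}ᶜ)) ∧
    ∀ t : ℝ, 0 ≤ t → Interface α γ₁ (fun k => Gp (t, (0, k))) (fun k => Gm (t, (0, k)))
  /-- `W` is `C¹` along the characteristics. -/
  contDiffAt : ∀ t : ℝ, 0 < t → ∀ y : ℝ, ∀ k : UnitAddCircle, y ≠ 0 → k ≠ 0 →
    ContDiffAt ℝ 1 (fun s : ℝ => W (t + s) (y + vel α k * s, k)) 0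
  bounded_deriv : ∃ C : ℝ, ∀ t : ℝ, 0 < t → ∀ y : ℝ, ∀ k : UnitAddCircle, y ≠ 0 → k ≠ 0 →
    ‖deriv (fun s : ℝ => W (t + s) (y + vel α k * s, k)) 0‖ ≤ C
  equation : ∀ t : ℝ, 0 < t → ∀ y : ℝ, ∀ k : UnitAddCircle, y ≠ 0 → k ≠ 0 →
    deriv (fun s : ℝ => W (t + s) (y + vel α k * s, k)) 0 =
      γ₀ • collision (fun k' => W t (y, k')) k
  initial : ∀ y : ℝ, ∀ k : UnitAddCircle, y ≠ 0 → k ≠ 0 → W 0 (y, k) = W₀ (y, k)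
  tendsto_initial : ∀ y : ℝ, ∀ k : UnitAddCircle, y ≠ 0 → k ≠ 0 →
    Tendsto (fun t => W t (y, k)) (𝓝[>] 0) (𝓝 (W₀ (y, k)))

/-! ### Operators on `L²(ℝ × 𝕋)` -/

/-- The Hilbert space `L²(ℝ × 𝕋)` of `𝕜`-valued functions. -/
abbrev L2 (𝕜 : Type*) [RCLike 𝕜] : Type _ :=
  Lp 𝕜 2 (volume : Measure (ℝ × UnitAddCircle))

/-- The bounded operator `A` on `L²` is given, on arbitrary representatives, by the formula `Φ`. -/
def IsGivenBy (A : L2 𝕜 →L[𝕜] L2 𝕜)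
    (Φ : (ℝ × UnitAddCircle → 𝕜) → ℝ × UnitAddCircle → 𝕜) : Prop :=
  ∀ (F : ℝ × UnitAddCircle → 𝕜) (hF : MemLp F 2 volume), A (hF.toLp F) =ᵐ[volume] Φ F

/-- `(S t)_{t ≥ 0}` is a `C₀`-continuous semigroup of contractions. -/
structure IsC0ContractionSemigroup {X : Type*} [NormedAddCommGroup X] [NormedSpace 𝕜 X]
    (S : ℝ → X →L[𝕜] X) : Prop where
  zero : S 0 = ContinuousLinearMap.id 𝕜 X
  add : ∀ s t : ℝ, 0 ≤ s → 0 ≤ t → S (s + t) = (S s).comp (S t)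
  contraction : ∀ t : ℝ, 0 ≤ t → ∀ f : X, ‖S t f‖ ≤ ‖f‖
  continuousOn : ∀ f : X, ContinuousOn (fun t => S t f) (Ici 0)

/-- The operator `A` on `L²` extends the time-`t` kinetic map `𝔚_t : W₀ ↦ W(t)`, `W` being the
classical solution started from `W₀`, defined for `W₀ ∈ 𝒞₀ ∩ L²`. -/
def ExtendsFlow (α : ℤ → ℝ) (γ₀ γ₁ t : ℝ) (A : L2 𝕜 →L[𝕜] L2 𝕜) : Prop :=
  ∀ (W₀ : ℝ × UnitAddCircle → 𝕜) (h₀ : MemLp W₀ 2 volume), IsC0 α γ₁ W₀ →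
    ∀ W : ℝ → ℝ × UnitAddCircle → 𝕜, IsClassicalSolution α γ₀ γ₁ W₀ W →
      A (h₀.toLp W₀) =ᵐ[volume] W t

/-- `u` is an `L²`-valued solution, locally integrable in time, of
`u(t) = Uₜ f + 2γ₀ ∫₀ᵗ U_{t-s} 𝓡 u(s) ds`, `t ≥ 0`. -/
def IsDuhamelSolution (γ₀ : ℝ) (U : ℝ → L2 𝕜 →L[𝕜] L2 𝕜) (Rop : L2 𝕜 →L[𝕜] L2 𝕜)
    (f : L2 𝕜) (u : ℝ → L2 𝕜) : Prop :=
  ∀ t : ℝ, 0 ≤ t →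
    IntervalIntegrable u volume 0 t ∧
    IntervalIntegrable (fun s => U (t - s) (Rop (u s))) volume 0 t ∧
    u t = U t f + (2 * γ₀) • ∫ s in (0 : ℝ)..t, U (t - s) (Rop (u s))

end

end KineticInterface

open KineticInterface

namespace KineticInterface
noncomputable section

/-! ### Periodic functions on the torus -/

/-! The evolution is constructed twice, pointwise by Picard iteration of the mild equation and in
`L²` by a Dyson series, and the two constructions are identified iterate by iterate.

Coefficients. Exponential decay of `α` makes `α̂` a function `p` of `cos 2πk` that is `C²` near
`[-1, 1]`, and the assumptions on `ω` amount to `p' < 0` on `[-1, 1)` (`exists_profile`,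
`IsAdmissible.exists_isProfile`). Hence the velocity is odd, continuous off `k = 0`, and vanishes on
`𝕋_*` only at `1/2`. The Laplace transform is the resolvent integral `∫ z / (z² + ω²) dk`. At `z = ε
- iω(k)` its singular part is that of the linearised denominator, which is explicit
(`integral_resolvent_cosT`), and the remainder converges by domination. The outcome
`IsProfile.wp_eq` reads `℘ = γ₁ / (γ₁ + 2|v| - iX)` with `v` the group velocity `vel` and `X` real.
So `℘` is even and continuous on `𝕋_*`, also at `1/2`, and `p₊ + p₋ ≤ 1`.

Classical solutions. The reflection `(y, k) ↦ (-y, -k)` folds the line onto `y ≥ 0`: the pair `(W(y,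
k), W(-y, -k))` is transported with one velocity `v(k)`, and the interface becomes a boundary
condition whose operator `bdry` is a sup-norm contraction. The gain is at most the loss rate times
the sup norm, so the mild map preserves balls; a weight `exp (64γ₀t)` makes it a contraction. The
iterates are continuous because a characteristic meets the boundary at a null set of times, or else
stays on it at `k = 1/2`, where the boundary operator is the identity. For uniqueness the difference
of two solutions is followed backwards along a characteristic, with at most one reflection; this
improves any uniform bound on `(0, t]` by a fixed factor below `1` (`IsHomogeneous.norm_le`).

Square-integrable theory. The free evolution is a measure-preserving shear followed by a mixing of
`F(z)` and `F(-z)` with weights of sum at most `1`, hence a contraction; scattering is bounded. The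
Dyson series then gives `S`. Its partial sums are the Picard iterates (`IsProfile.sum_dyson_ae_eq`),
so `S` extends the classical flow, and the semigroup law and uniqueness of the extension follow from
uniqueness of classical solutions and density of test functions. Contractivity comes from the
symmetry of the kernel: an Euler step `U_h(1 + 2γ₀hℛ)` multiplies the squared norm by at most `1 +
O(h²)`, so the norm has nonpositive upper right derivative (`IsContractive.norm_le_of_euler`).
Uniqueness in the Duhamel equation is a Gronwall argument. -/

lemma coe_rep (k : UnitAddCircle) : ((rep k : ℝ) : UnitAddCircle) = k :=
  (AddCircle.equivIoc (1 : ℝ) (-1 / 2)).symm_apply_apply k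

lemma rep_mem (k : UnitAddCircle) : rep k ∈ Ioc (-1 / 2 : ℝ) (1 / 2) := by
  have h := (AddCircle.equivIoc (1 : ℝ) (-1 / 2) k).2
  refine ⟨h.1, h.2.trans_eq (by norm_num)⟩

lemma rep_coe_of_mem {x : ℝ} (hx : x ∈ Ioc (-1 / 2 : ℝ) (1 / 2)) :
    rep (x : UnitAddCircle) = x := by
  have h := (AddCircle.coe_eq_coe_iff_of_mem_Ioc (p := (1 : ℝ)) (a := -1 / 2)
    (x := rep (x : UnitAddCircle)) (y := x)
    ⟨(rep_mem _).1, (rep_mem _).2.trans_eq (by norm_num)⟩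
    ⟨hx.1, hx.2.trans_eq (by norm_num)⟩).1 (coe_rep _)
  exact h

lemma rep_coe (x : ℝ) : ∃ n : ℤ, rep (x : UnitAddCircle) = x + n := by
  have h : ((rep (x : UnitAddCircle) : ℝ) : UnitAddCircle) = (x : UnitAddCircle) := coe_rep _
  have h' : ((rep (x : UnitAddCircle) - x : ℝ) : UnitAddCircle) = 0 := by
    rw [AddCircle.coe_sub, h, sub_self]
  obtain ⟨n, hn⟩ := (AddCircle.coe_eq_zero_iff (1 : ℝ)).1 h'
  exact ⟨n, by simp only [zsmul_eq_mul, mul_one] at hn; linarith⟩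

lemma comp_rep_coe {X : Type*} {f : ℝ → X} (hf : Function.Periodic f 1) (x : ℝ) :
    f (rep (x : UnitAddCircle)) = f x := by
  obtain ⟨n, hn⟩ := rep_coe x
  rw [hn]
  simpa using hf.int_mul n x

lemma comp_rep_neg {X : Type*} {f : ℝ → X} (hf : Function.Periodic f 1) (k : UnitAddCircle) :
    f (rep (-k)) = f (-rep k) := by
  conv_lhs => rw [← coe_rep k, ← AddCircle.coe_neg]
  exact comp_rep_coe hf _

/-- Neighbourhoods in the torus are images of neighbourhoods in `ℝ`, and periodicity hides the jump
of `rep` at `1/2`. Continuity at the representative therefore suffices. -/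
lemma continuousAt_comp_rep {X : Type*} [TopologicalSpace X] {f : ℝ → X}
    (hf : Function.Periodic f 1) {k : UnitAddCircle} (h : ContinuousAt f (rep k)) :
    ContinuousAt (fun k => f (rep k)) k := by
  have h2 : ContinuousAt (fun k : UnitAddCircle => f (rep k)) ((rep k : ℝ) : UnitAddCircle) := by
    rw [ContinuousAt]
    have : 𝓝 ((rep k : ℝ) : UnitAddCircle) = map (fun x : ℝ => (x : UnitAddCircle)) (𝓝 (rep k)) :=
      (QuotientAddGroup.nhds_eq _ _)
    rw [this, tendsto_map'_iff, comp_rep_coe hf]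
    simpa [Function.comp_def, comp_rep_coe hf] using h.tendsto
  rwa [coe_rep] at h2

lemma rep_zero : rep 0 = 0 := by
  have := rep_coe_of_mem (x := 0) (by constructor <;> norm_num)
  simpa using this

lemma rep_eq_zero_iff {k : UnitAddCircle} : rep k = 0 ↔ k = 0 := by
  constructor
  · intro h
    rw [← coe_rep k, h]
    simp
  · rintro rfl
    exact rep_zero

/-- The point `1/2` of the torus. -/
def half : UnitAddCircle := ((1 / 2 : ℝ) : UnitAddCircle)

lemma rep_half : rep half = 1 / 2 := rep_coe_of_mem (by constructor <;> norm_num)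

lemma half_ne_zero : half ≠ 0 := by
  intro h
  have := rep_half
  rw [h, rep_zero] at this
  norm_num at this

lemma eq_half_of_rep {k : UnitAddCircle} (h : rep k = 1 / 2) : k = half := by
  rw [← coe_rep k, h, half]

lemma neg_half : -half = half := by
  have h : ((1 / 2 + 1 / 2 : ℝ) : UnitAddCircle) = 0 :=
    (AddCircle.coe_eq_zero_iff (1 : ℝ)).2 ⟨1, by norm_num⟩
  rw [AddCircle.coe_add] at h
  exact neg_eq_of_add_eq_zero_left h

lemma rep_neg_of_ne_half {k : UnitAddCircle} (h : k ≠ half) : rep (-k) = -rep k := by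
  have h1 := rep_mem k
  have h2 : rep k ≠ 1 / 2 := fun h' => h (eq_half_of_rep h')
  have h3 := lt_of_le_of_ne h1.2 h2
  have := rep_coe_of_mem (x := -rep k) (by constructor <;> linarith [h1.1])
  rwa [AddCircle.coe_neg, coe_rep] at this

/-- `cos (2πk)` as a function on the torus. -/
def cosT (k : UnitAddCircle) : ℝ := Real.cos (2 * Real.pi * rep k)

lemma periodic_cos : Function.Periodic (fun x : ℝ => Real.cos (2 * Real.pi * x)) 1 := fun x => by
  simp only [mul_add, mul_one]
  exact Real.cos_periodic _

lemma continuous_cosT : Continuous cosT :=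
  continuous_iff_continuousAt.2 fun _ =>
    continuousAt_comp_rep periodic_cos (by fun_prop)

lemma cosT_neg (k : UnitAddCircle) : cosT (-k) = cosT k := by
  rw [cosT, comp_rep_neg periodic_cos, cosT, mul_neg, Real.cos_neg]

lemma cosT_mem (k : UnitAddCircle) : cosT k ∈ Icc (-1 : ℝ) 1 :=
  ⟨Real.neg_one_le_cos _, Real.cos_le_one _⟩

lemma cosT_lt_one {k : UnitAddCircle} (hk : k ≠ 0) : cosT k < 1 := by
  refine lt_of_le_of_ne (cosT_mem k).2 fun h => hk ?_
  have h1 := rep_mem k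
  have hp := Real.pi_pos
  rw [cosT, Real.cos_eq_one_iff_of_lt_of_lt (by nlinarith [h1.1]) (by nlinarith [h1.2])] at h
  have : rep k = 0 := by
    rcases mul_eq_zero.1 h with h | h
    · linarith
    · exact h
  exact rep_eq_zero_iff.1 this

lemma abs_rep_injOn {k k' : UnitAddCircle} (h : cosT k = cosT k') : k' = k ∨ k' = -k := by
  have h1 := rep_mem k
  have h2 := rep_mem k'
  have hp := Real.pi_pos
  have key : |rep k| = |rep k'| := by
    have := Real.injOn_cos (x₁ := 2 * Real.pi * |rep k|) (x₂ := 2 * Real.pi * |rep k'|)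
      ⟨by positivity, by
        have : |rep k| ≤ 1 / 2 := abs_le.2 ⟨by linarith [h1.1], h1.2⟩
        nlinarith⟩
      ⟨by positivity, by
        have : |rep k'| ≤ 1 / 2 := abs_le.2 ⟨by linarith [h2.1], h2.2⟩
        nlinarith⟩ (by
        have e : ∀ x : ℝ, Real.cos (2 * Real.pi * |x|) = Real.cos (2 * Real.pi * x) := fun x => by
          rw [← Real.cos_abs (2 * Real.pi * x), abs_mul, abs_of_pos (by positivity : 0 < 2 * Real.pi)]
        rw [e, e]; exact h)
    exact mul_left_cancel₀ (by positivity) this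
  rcases abs_eq_abs.1 key with h | h
  · left; rw [← coe_rep k, ← coe_rep k', h]
  · right
    rw [← coe_rep k, ← coe_rep k', ← AddCircle.coe_neg, h, neg_neg]

/-- This form displays what the definition conceals: symmetry, on which the `L²` balance of gain and
loss rests, and evenness in each variable, which makes the equation invariant under `(y, k) ↦ (-y,
-k)`. -/
lemma scatKernel_eq (k k' : UnitAddCircle) :
    scatKernel k k' = 2 * (1 - cosT k) * (1 - cosT k') * (1 - cosT k * cosT k') := by
  have e : ∀ x : ℝ, Real.cos (2 * Real.pi * x) = 1 - 2 * Real.sin (Real.pi * x) ^ 2 := fun x => by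
    rw [mul_assoc, Real.cos_two_mul, Real.cos_sq']; ring
  rw [scatKernel, r, r, cosT, cosT, e, e]
  set a := Real.pi * rep k with ha
  set b := Real.pi * rep k' with hb
  have e1 : Real.pi * (rep k - (rep k - rep k')) = b := by ring
  have e2 : Real.pi * (2 * rep k - (rep k - rep k')) = a + b := by ring
  have e3 : Real.pi * (rep k - (rep k + rep k')) = -b := by ring
  have e4 : Real.pi * (2 * rep k - (rep k + rep k')) = a - b := by ring
  rw [e1, e2, e3, e4, Real.sin_neg, Real.sin_add, Real.sin_sub]
  have ha2 := Real.sin_sq_add_cos_sq a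
  have hb2 := Real.sin_sq_add_cos_sq b
  have ca : Real.cos a ^ 2 = 1 - Real.sin a ^ 2 := by linarith
  have cb : Real.cos b ^ 2 = 1 - Real.sin b ^ 2 := by linarith
  ring_nf
  rw [ca, cb]
  ring

lemma scatKernel_comm (k k' : UnitAddCircle) : scatKernel k k' = scatKernel k' k := by
  rw [scatKernel_eq, scatKernel_eq]; ring

lemma scatKernel_neg_left (k k' : UnitAddCircle) : scatKernel (-k) k' = scatKernel k k' := by
  rw [scatKernel_eq, scatKernel_eq, cosT_neg]

lemma scatKernel_neg_right (k k' : UnitAddCircle) : scatKernel k (-k') = scatKernel k k' := by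
  rw [scatKernel_eq, scatKernel_eq, cosT_neg]

lemma scatKernel_nonneg (k k' : UnitAddCircle) : 0 ≤ scatKernel k k' := by
  rw [scatKernel]; positivity

lemma continuous_scatKernel :
    Continuous fun q : UnitAddCircle × UnitAddCircle => scatKernel q.1 q.2 := by
  simp only [scatKernel_eq]
  have := continuous_cosT
  fun_prop

lemma continuous_scatKernel_right (k : UnitAddCircle) : Continuous (scatKernel k) := by
  have h : scatKernel k =
      fun k' => 2 * (1 - cosT k) * (1 - cosT k') * (1 - cosT k * cosT k') := by
    ext k'; exact scatKernel_eq k k'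
  rw [h]
  have := continuous_cosT
  fun_prop

/-- A crude bound `2 · 4 · 2`; it is the source of the constant `32γ₀` bounding the scattering rate.
-/
lemma scatKernel_le (k k' : UnitAddCircle) : scatKernel k k' ≤ 16 := by
  rw [scatKernel_eq]
  have h1 := cosT_mem k
  have h2 := cosT_mem k'
  have a1 : (1 - cosT k) * (1 - cosT k') ≤ 4 := by nlinarith [h1.1, h1.2, h2.1, h2.2]
  have a0 : 0 ≤ (1 - cosT k) * (1 - cosT k') := mul_nonneg (by linarith [h1.2]) (by linarith [h2.2])
  have b1 : |cosT k * cosT k'| ≤ 1 := by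
    rw [abs_mul]
    exact mul_le_one₀ (abs_le.2 h1) (abs_nonneg _) (abs_le.2 h2)
  have b2 := abs_le.1 b1
  nlinarith

lemma totalKernel_nonneg (k : UnitAddCircle) : 0 ≤ totalKernel k :=
  integral_nonneg fun _ => scatKernel_nonneg _ _

lemma totalKernel_neg (k : UnitAddCircle) : totalKernel (-k) = totalKernel k := by
  simp [totalKernel, scatKernel_neg_left]

instance : IsProbabilityMeasure (volume : Measure UnitAddCircle) :=
  ⟨UnitAddCircle.measure_univ⟩

lemma integrable_scatKernel (k : UnitAddCircle) : Integrable (fun k' => scatKernel k k') := by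
  exact (continuous_scatKernel_right k).integrable_of_hasCompactSupport (HasCompactSupport.of_compactSpace _)

lemma totalKernel_le (k : UnitAddCircle) : totalKernel k ≤ 16 := by
  have := integral_mono (μ := volume) (integrable_scatKernel k) (integrable_const (16 : ℝ))
    (fun k' => scatKernel_le k k')
  simpa [totalKernel] using this

lemma continuous_totalKernel : Continuous totalKernel := by
  refine continuous_of_dominated (bound := fun _ => (16 : ℝ)) (fun k => ?_) (fun k => ?_)
    (integrable_const _) ?_
  · exact (integrable_scatKernel k).aestronglyMeasurable
  · exact Eventually.of_forall fun k' => by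
      rw [Real.norm_of_nonneg (scatKernel_nonneg _ _)]; exact scatKernel_le _ _
  · exact Eventually.of_forall fun k' =>
      (continuous_scatKernel_right k').congr fun k => scatKernel_comm k' k

end
end KineticInterface

namespace KineticInterface
noncomputable section

/-! ### The dispersion relation as a function of `cos (2πk)` -/

lemma norm_cos_int_mul_le (n : ℤ) {w : ℂ} {η : ℝ} (hw : |w.im| ≤ η) :
    ‖Complex.cos (n * w)‖ ≤ Real.exp (|(n : ℝ)| * η) := by
  have hb : ∀ s : ℝ, |s| = 1 → ‖Complex.exp ((s : ℂ) * (n * w) * Complex.I)‖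
      ≤ Real.exp (|(n : ℝ)| * η) := fun s hs => by
    rw [Complex.norm_exp]
    refine Real.exp_le_exp.2 ?_
    have e : ((s : ℂ) * (n * w) * Complex.I).re = -(s * (n * w.im)) := by
      simp [Complex.mul_re, Complex.mul_im]
    rw [e]
    refine (le_abs_self _).trans ?_
    rw [abs_neg, abs_mul, hs, one_mul, abs_mul]
    exact mul_le_mul_of_nonneg_left hw (abs_nonneg _)
  have h1 := hb 1 (by simp)
  have h2 := hb (-1) (by simp)
  rw [Complex.cos, norm_div, Complex.norm_ofNat, div_le_iff₀ (by norm_num)]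
  refine (norm_add_le _ _).trans ?_
  simp only [Complex.ofReal_one, one_mul, Complex.ofReal_neg, neg_mul] at h1 h2
  rw [neg_mul]
  linarith

lemma summable_exp_neg_abs {c : ℝ} (hc : 0 < c) :
    Summable fun x : ℤ => Real.exp (-c * |(x : ℝ)|) := by
  refine Summable.of_nat_of_neg ?_ ?_
  all_goals
    have := Real.summable_exp_nat_mul_iff.2 (neg_lt_zero.2 hc)
    refine this.congr fun n => ?_
    simp [mul_comm]

lemma norm_cexp_phase (x : ℤ) (k : ℝ) :
    ‖Complex.exp (-(2 * Real.pi * Complex.I * (x : ℂ) * (k : ℂ)))‖ = 1 := by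
  rw [Complex.norm_exp]
  simp [Complex.mul_re, Complex.mul_im]

lemma alphaHat_re {α : ℤ → ℝ} (hs : Summable fun x => |α x|) (k : ℝ) :
    (alphaHat α k).re = ∑' x : ℤ, α x * Real.cos (x * (2 * Real.pi * k)) := by
  rw [alphaHat, Complex.re_tsum]
  · refine tsum_congr fun x => ?_
    rw [Complex.re_ofReal_mul, Complex.exp_re]
    congr 1
    have e1 : (-(2 * (Real.pi : ℂ) * Complex.I * (x : ℂ) * (k : ℂ))).re = 0 := by
      simp [Complex.mul_re, Complex.mul_im]
    have e2 : (-(2 * (Real.pi : ℂ) * Complex.I * (x : ℂ) * (k : ℂ))).im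
        = -(x * (2 * Real.pi * k)) := by
      simp [Complex.mul_re, Complex.mul_im]; ring
    rw [e1, e2, Real.exp_zero, one_mul, Real.cos_neg]
  · refine Summable.of_norm (hs.congr fun x => ?_)
    rw [norm_mul, norm_cexp_phase, mul_one, Complex.norm_real, Real.norm_eq_abs]

/-- Since `α` is real, `Re α̂` is a cosine series, that is, `∑ αₙ Tₙ` evaluated at `cos 2πk` with
Chebyshev polynomials `Tₙ`. Exponential decay makes this series converge to a holomorphic function
on the cosine image of a strip, an open set containing `[-1, 1]`. -/
lemma exists_profile {α : ℤ → ℝ} {C : ℝ} (hC : 0 < C)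
    (hα : ∀ x : ℤ, |α x| ≤ C * Real.exp (-|(x : ℝ)| / C)) :
    ∃ (p : ℝ → ℝ) (O : Set ℝ), IsOpen O ∧ Icc (-1) 1 ⊆ O ∧ ContDiffOn ℝ 2 p O ∧
      ∀ k : ℝ, (alphaHat α k).re = p (Real.cos (2 * Real.pi * k)) := by
  -- Half the decay rate of `α`: the growth `exp (η|x|)` of `cos (xw)` in the strip uses up one
  -- half, and the other half keeps the series summable.
  set η : ℝ := 1 / (2 * C) with hη
  have hη0 : 0 < η := by positivity
  set S : Set ℂ := {w | |w.im| < η} with hS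
  have hSo : IsOpen S := isOpen_lt (by fun_prop) continuous_const
  have hUo : IsOpen (Complex.cos '' S) := by
    have hg : AnalyticOnNhd ℂ Complex.cos univ :=
      fun z _ => Complex.differentiable_cos.analyticAt z
    rcases hg.is_constant_or_isOpenMap with ⟨w, hw⟩ | h
    · exfalso
      have h1 := hw 0
      have h2 := hw Real.pi
      rw [Complex.cos_zero] at h1
      rw [Complex.cos_pi, ← h1] at h2
      norm_num at h2
    · exact h S hSo
  have hsum : Summable fun x : ℤ => C * Real.exp (-η * |(x : ℝ)|) :=
    (summable_exp_neg_abs hη0).mul_left C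
  set F : ℤ → ℂ → ℂ := fun x z => (α x : ℂ) * (Polynomial.Chebyshev.T ℂ x).eval z with hF
  have hFd : DifferentiableOn ℂ (fun z => ∑' x : ℤ, F x z) (Complex.cos '' S) := by
    refine Complex.differentiableOn_tsum_of_summable_norm hsum (fun x => ?_) hUo ?_
    · exact ((Polynomial.differentiable _).const_mul _).differentiableOn
    · rintro x _ ⟨w, hw, rfl⟩
      simp only [hF]
      rw [Polynomial.Chebyshev.T_complex_cos, norm_mul, Complex.norm_real, Real.norm_eq_abs]
      have h1 := norm_cos_int_mul_le x (le_of_lt hw)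
      calc |α x| * ‖Complex.cos (x * w)‖
          ≤ (C * Real.exp (-|(x : ℝ)| / C)) * Real.exp (|(x : ℝ)| * η) :=
            mul_le_mul (hα x) h1 (norm_nonneg _) (by positivity)
        _ = C * Real.exp (-η * |(x : ℝ)|) := by
            rw [mul_assoc, ← Real.exp_add]
            congr 2
            rw [hη]; field_simp; ring
  have hsα : Summable fun x => |α x| := by
    refine Summable.of_nonneg_of_le (fun _ => abs_nonneg _) (fun x => (hα x).trans ?_) hsum
    refine mul_le_mul_of_nonneg_left (Real.exp_le_exp.2 ?_) hC.le
    rw [hη, neg_div, neg_mul, neg_le_neg_iff, div_mul_eq_mul_div, one_mul]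
    exact div_le_div_of_nonneg_left (abs_nonneg _) hC (by linarith)
  refine ⟨fun x => (∑' n : ℤ, F n (x : ℂ)).re, (fun x : ℝ => (x : ℂ)) ⁻¹' (Complex.cos '' S),
    hUo.preimage Complex.continuous_ofReal, ?_, ?_, ?_⟩
  · intro x hx
    refine ⟨(Real.arccos x : ℂ), by simpa [hS] using hη0, ?_⟩
    rw [← Complex.ofReal_cos, Real.cos_arccos hx.1 hx.2]
  · have h1 : ContDiffOn ℝ 2 (fun z => ∑' x : ℤ, F x z) (Complex.cos '' S) :=
      (hFd.contDiffOn hUo).restrict_scalars ℝ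
    exact Complex.reCLM.contDiff.comp_contDiffOn
      (h1.comp Complex.ofRealCLM.contDiff.contDiffOn (fun x hx => hx))
  · intro k
    rw [alphaHat_re hsα]
    simp only [hF]
    rw [Complex.re_tsum]
    · refine tsum_congr fun x => ?_
      rw [Complex.ofReal_cos, Polynomial.Chebyshev.T_complex_cos, Complex.re_ofReal_mul]
      congr 1
      have : (x : ℂ) * ((2 * Real.pi * k : ℝ) : ℂ) = ((x * (2 * Real.pi * k) : ℝ) : ℂ) := by
        push_cast; ring
      rw [this, Complex.cos_ofReal_re]
    · refine Summable.of_norm (Summable.of_nonneg_of_le (fun _ => norm_nonneg _) (fun x => ?_) hsα)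
      rw [Complex.ofReal_cos, Polynomial.Chebyshev.T_complex_cos, norm_mul, Complex.norm_real,
        Real.norm_eq_abs]
      have h1 := norm_cos_int_mul_le (η := 0) x (w := ((2 * Real.pi * k : ℝ) : ℂ))
        (by rw [Complex.ofReal_im, abs_zero])
      rw [mul_zero, Real.exp_zero] at h1
      exact mul_le_of_le_one_right (abs_nonneg _) h1

end
end KineticInterface

namespace KineticInterface
noncomputable section

/-- `p` expresses `α̂ = ω²` as a function of `cos (2πk)`; it is decreasing. -/
structure IsProfile (α : ℤ → ℝ) (p : ℝ → ℝ) : Prop where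
  contDiffAt : ∀ c ∈ Icc (-1 : ℝ) 1, ContDiffAt ℝ 2 p c
  eq : ∀ k : ℝ, (alphaHat α k).re = p (Real.cos (2 * Real.pi * k))
  pos : ∀ c ∈ Ico (-1 : ℝ) 1, 0 < p c
  deriv_neg : ∀ c ∈ Ico (-1 : ℝ) 1, deriv p c < 0

lemma hasDerivAt_cos_two_pi (x : ℝ) : HasDerivAt (fun x : ℝ => Real.cos (2 * Real.pi * x))
    (-(2 * Real.pi * Real.sin (2 * Real.pi * x))) x := by
  have h := ((hasDerivAt_id x).const_mul (2 * Real.pi)).cos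
  refine h.congr_deriv ?_
  simp; ring

lemma contDiffAt_deriv_of_two {p : ℝ → ℝ} {c : ℝ} (h : ContDiffAt ℝ 2 p c) :
    ContDiffAt ℝ 1 (deriv p) c := by
  have h1 : ContDiffAt ℝ 1 (fderiv ℝ p) c := h.fderiv_right (by norm_num)
  exact h1.clm_apply contDiffAt_const

lemma hasDerivAt_omega_of {α : ℤ → ℝ} {p : ℝ → ℝ}
    (heq : ∀ k : ℝ, (alphaHat α k).re = p (Real.cos (2 * Real.pi * k))) {x : ℝ}
    (hd : DifferentiableAt ℝ p (Real.cos (2 * Real.pi * x)))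
    (hpos : 0 < p (Real.cos (2 * Real.pi * x))) :
    HasDerivAt (omega α)
      (-(Real.pi * Real.sin (2 * Real.pi * x) * deriv p (Real.cos (2 * Real.pi * x)) / omega α x))
      x := by
  have hω : omega α = fun x => Real.sqrt (p (Real.cos (2 * Real.pi * x))) := by
    ext x; rw [omega, heq]
  rw [hω]
  have h1 := (hd.hasDerivAt.comp x (hasDerivAt_cos_two_pi x)).sqrt hpos.ne'
  refine h1.congr_deriv ?_
  have hs : √(p (Real.cos (2 * Real.pi * x))) ≠ 0 := (Real.sqrt_pos.2 hpos).ne'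
  simp only [Function.comp_apply]
  field_simp

/-- For `c` in `(-1, 1)` the sign of `p'` is read off from `ω' > 0`. At `c = -1`, i.e. `k = 1/2`,
the first derivative of `ω` carries a factor `sin 2πk = 0` and the second derivative has to be used.
-/
lemma IsAdmissible.exists_isProfile {α : ℤ → ℝ} (hα : IsAdmissible α) : ∃ p, IsProfile α p := by
  obtain ⟨C, hC, hdec⟩ := hα.decay
  obtain ⟨p, O, hO, hsub, hp, heq⟩ := exists_profile hC hdec
  have hcd : ∀ c ∈ Icc (-1 : ℝ) 1, ContDiffAt ℝ 2 p c := fun c hc =>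
    hp.contDiffAt (hO.mem_nhds (hsub hc))
  have hdiff : ∀ c ∈ Icc (-1 : ℝ) 1, DifferentiableAt ℝ p c := fun c hc =>
    (hcd c hc).differentiableAt (by norm_num)
  have hpi := Real.pi_pos
  have hposx : ∀ x : ℝ, Real.cos (2 * Real.pi * x) < 1 → 0 < p (Real.cos (2 * Real.pi * x)) := by
    intro x hx
    rw [← heq]
    refine hα.pos x fun n hn => ?_
    rw [hn, mul_comm, Real.cos_int_mul_two_pi] at hx
    exact lt_irrefl _ hx
  have hsurj : ∀ c ∈ Icc (-1 : ℝ) 1, ∃ x ∈ Icc (0 : ℝ) (1 / 2), Real.cos (2 * Real.pi * x) = c := by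
    intro c hc
    refine ⟨Real.arccos c / (2 * Real.pi), ⟨by have := Real.arccos_nonneg c; positivity, ?_⟩, ?_⟩
    · rw [div_le_div_iff₀ (by positivity) (by norm_num)]
      have := Real.arccos_le_pi c
      linarith
    · rw [mul_div_cancel₀ _ (by positivity : 2 * Real.pi ≠ 0), Real.cos_arccos hc.1 hc.2]
  have hpos : ∀ c ∈ Ico (-1 : ℝ) 1, 0 < p c := by
    intro c hc
    obtain ⟨x, -, rfl⟩ := hsurj c ⟨hc.1, hc.2.le⟩
    exact hposx x hc.2
  have hωpos : ∀ x : ℝ, Real.cos (2 * Real.pi * x) < 1 → 0 < omega α x := fun x hx => by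
    rw [omega, heq]; exact Real.sqrt_pos.2 (hposx x hx)
  refine ⟨p, hcd, heq, hpos, fun c hc => ?_⟩
  obtain ⟨x, hx, rfl⟩ := hsurj c ⟨hc.1, hc.2.le⟩
  have hcos : Real.cos (2 * Real.pi * x) ∈ Icc (-1 : ℝ) 1 := ⟨hc.1, hc.2.le⟩
  have hder := hasDerivAt_omega_of heq (hdiff _ hcos) (hposx x hc.2)
  have hx0 : 0 < x := by
    refine lt_of_le_of_ne hx.1 fun h => ?_
    rw [← h] at hc
    simp at hc
  rcases hx.2.lt_or_eq with hlt | rfl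
  · have h1 := hα.no_critical x ⟨hx0, hlt⟩
    rw [hder.deriv] at h1
    have hsin : 0 < Real.sin (2 * Real.pi * x) :=
      Real.sin_pos_of_pos_of_lt_pi (by positivity) (by nlinarith)
    by_contra hcon
    push Not at hcon
    have : 0 ≤ Real.pi * Real.sin (2 * Real.pi * x) * deriv p (Real.cos (2 * Real.pi * x)) /
      omega α x := div_nonneg (by positivity) (hωpos x hc.2).le
    linarith
  · -- the second derivative of `ω` at `1/2`
    have e1 : 2 * Real.pi * (1 / 2) = Real.pi := by ring
    set G : ℝ → ℝ := fun x => -(Real.pi * deriv p (Real.cos (2 * Real.pi * x)) / omega α x) with hG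
    have hev : deriv (omega α) =ᶠ[𝓝 (1 / 2)] fun x => Real.sin (2 * Real.pi * x) * G x := by
      have hc' : ContinuousAt (fun x : ℝ => Real.cos (2 * Real.pi * x)) (1 / 2) := by fun_prop
      filter_upwards [hc'.eventually (gt_mem_nhds hc.2)] with y hy
      rw [(hasDerivAt_omega_of heq (hdiff _ ⟨Real.neg_one_le_cos _, hy.le⟩) (hposx y hy)).deriv, hG]
      ring
    have hp' : ContinuousAt (deriv p) (-1) := by
      have h2 := (hcd (-1) ⟨le_rfl, by norm_num⟩)
      have h3 : ContDiffAt ℝ 1 (deriv p) (-1) := contDiffAt_deriv_of_two h2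
      exact h3.continuousAt
    have hcosm : Real.cos (2 * Real.pi * (1 / 2)) = -1 := by rw [e1, Real.cos_pi]
    have hGc : ContinuousAt G (1 / 2) := by
      have h1 : ContinuousAt (fun x : ℝ => deriv p (Real.cos (2 * Real.pi * x))) (1 / 2) :=
        ContinuousAt.comp (f := fun x : ℝ => Real.cos (2 * Real.pi * x)) (g := deriv p)
          (by rw [hcosm]; exact hp') (by fun_prop)
      exact ((h1.const_mul _).div hder.continuousAt (hωpos _ hc.2).ne').neg
    have hsd : HasDerivAt (fun x : ℝ => Real.sin (2 * Real.pi * x)) (-(2 * Real.pi)) (1 / 2) := by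
      have h := ((hasDerivAt_id (1 / 2 : ℝ)).const_mul (2 * Real.pi)).sin
      refine h.congr_deriv ?_
      simp only [id, hcosm]; ring
    -- The factor `G` need only be continuous here: the sine vanishes at `1/2`, so the difference
    -- quotient of the product is that of the sine times `G`.
    have hprod : HasDerivAt (fun x => Real.sin (2 * Real.pi * x) * G x)
        (-(2 * Real.pi) * G (1 / 2)) (1 / 2) := by
      rw [hasDerivAt_iff_tendsto_slope] at hsd ⊢
      have hs0 : Real.sin (2 * Real.pi * (1 / 2)) = 0 := by rw [e1, Real.sin_pi]
      refine (hsd.mul (hGc.tendsto.mono_left nhdsWithin_le_nhds)).congr fun y => ?_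
      simp only [slope_def_field, hs0]; ring
    have h2 := hα.nondegenerate_max
    rw [hev.deriv_eq, hprod.deriv, hG] at h2
    by_contra hcon
    push Not at hcon
    have : 0 ≤ Real.pi * deriv p (Real.cos (2 * Real.pi * (1 / 2))) / omega α (1 / 2) :=
      div_nonneg (by positivity) (hωpos _ hc.2).le
    simp only [] at h2
    nlinarith

lemma periodic_omega {α : ℤ → ℝ} {p : ℝ → ℝ} (hp : IsProfile α p) :
    Function.Periodic (omega α) 1 := fun x => by
  rw [omega, omega, hp.eq, hp.eq]
  exact congrArg (fun c => √(p c)) (periodic_cos x)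

lemma omega_neg {α : ℤ → ℝ} {p : ℝ → ℝ} (hp : IsProfile α p) (x : ℝ) :
    omega α (-x) = omega α x := by
  rw [omega, omega, hp.eq, hp.eq, mul_neg, Real.cos_neg]

/-! ### The group velocity and uniform bounds for the profile -/

namespace IsProfile

variable {α : ℤ → ℝ} {p : ℝ → ℝ}

lemma differentiableAt (hp : IsProfile α p) {c : ℝ} (hc : c ∈ Icc (-1 : ℝ) 1) :
    DifferentiableAt ℝ p c :=
  (hp.contDiffAt c hc).differentiableAt (by norm_num)

lemma continuousAt (hp : IsProfile α p) {c : ℝ} (hc : c ∈ Icc (-1 : ℝ) 1) :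
    ContinuousAt p c := (hp.differentiableAt hc).continuousAt

lemma contDiffAt_deriv (hp : IsProfile α p) {c : ℝ} (hc : c ∈ Icc (-1 : ℝ) 1) :
    ContDiffAt ℝ 1 (deriv p) c :=
  contDiffAt_deriv_of_two (hp.contDiffAt c hc)

lemma continuousAt_deriv (hp : IsProfile α p) {c : ℝ} (hc : c ∈ Icc (-1 : ℝ) 1) :
    ContinuousAt (deriv p) c := (hp.contDiffAt_deriv hc).continuousAt

lemma cosT_mem_Ico {k : UnitAddCircle} (hk : k ≠ 0) : cosT k ∈ Ico (-1 : ℝ) 1 :=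
  ⟨(cosT_mem k).1, cosT_lt_one hk⟩

lemma omega_sq (hp : IsProfile α p) {k : UnitAddCircle} :
    omega α (rep k) = √(p (cosT k)) := by rw [omega, hp.eq, cosT]

lemma omega_pos (hp : IsProfile α p) {k : UnitAddCircle} (hk : k ≠ 0) : 0 < omega α (rep k) := by
  rw [hp.omega_sq]
  exact Real.sqrt_pos.2 (hp.pos _ (cosT_mem_Ico hk))

/-- The sign of the velocity is that of the sine, and continuity persists through `k = 1/2`. Only `k
= 0` is lost, where `ω` may vanish. -/
lemma vel_eq (hp : IsProfile α p) {k : UnitAddCircle} (hk : k ≠ 0) :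
    vel α k = -(Real.sin (2 * Real.pi * rep k) * deriv p (cosT k)) / (2 * omega α (rep k)) := by
  have h := hasDerivAt_omega_of hp.eq (hp.differentiableAt (cosT_mem k))
    (hp.pos _ (cosT_mem_Ico hk))
  rw [vel, h.deriv]
  have h1 := (hp.omega_pos hk).ne'
  have h2 := Real.pi_pos.ne'
  rw [cosT]
  field_simp

lemma periodic_deriv_omega (hp : IsProfile α p) : Function.Periodic (deriv (omega α)) 1 := by
  intro x
  have h : (fun y => omega α (y + 1)) = omega α := funext (periodic_omega hp)
  rw [← deriv_comp_add_const, h]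

lemma vel_neg (hp : IsProfile α p) (k : UnitAddCircle) : vel α (-k) = -vel α k := by
  have h : (fun y => omega α (-y)) = omega α := funext (omega_neg hp)
  have h2 : deriv (omega α) (-rep k) = -deriv (omega α) (rep k) := by
    conv_rhs => rw [← h, deriv_comp_neg, neg_neg]
  rw [vel, vel, comp_rep_neg hp.periodic_deriv_omega, h2, neg_div]

lemma sin_periodic_rep : Function.Periodic (fun x : ℝ => Real.sin (2 * Real.pi * x)) 1 := fun x => by
  simp only [mul_add, mul_one]
  exact Real.sin_periodic _

lemma continuous_sin_rep : Continuous fun k : UnitAddCircle => Real.sin (2 * Real.pi * rep k) :=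
  continuous_iff_continuousAt.2 fun _ => continuousAt_comp_rep sin_periodic_rep (by fun_prop)

lemma continuousAt_omega (hp : IsProfile α p) (k : UnitAddCircle) :
    ContinuousAt (fun k => omega α (rep k)) k := by
  simp only [hp.omega_sq]
  have h : ContinuousAt (fun k => p (cosT k)) k :=
    ContinuousAt.comp (f := cosT) (g := p) (hp.continuousAt (cosT_mem k))
      continuous_cosT.continuousAt
  exact h.sqrt

lemma continuousAt_deriv_cosT (hp : IsProfile α p) (k : UnitAddCircle) :
    ContinuousAt (fun k => deriv p (cosT k)) k :=
  ContinuousAt.comp (f := cosT) (g := deriv p) (hp.continuousAt_deriv (cosT_mem k))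
      continuous_cosT.continuousAt

lemma continuousAt_vel (hp : IsProfile α p) {k : UnitAddCircle} (hk : k ≠ 0) :
    ContinuousAt (vel α) k := by
  have h : (fun k => -(Real.sin (2 * Real.pi * rep k) * deriv p (cosT k)) / (2 * omega α (rep k)))
      =ᶠ[𝓝 k] vel α := by
    filter_upwards [isOpen_ne.mem_nhds hk] with k' hk'
    exact (hp.vel_eq hk').symm
  refine ContinuousAt.congr ?_ h
  exact ((continuous_sin_rep.continuousAt.mul (hp.continuousAt_deriv_cosT k)).neg).div
    ((hp.continuousAt_omega k).const_mul 2) (by have := hp.omega_pos hk; positivity)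

lemma vel_half (hp : IsProfile α p) : vel α half = 0 := by
  have h := hp.vel_neg half
  rw [neg_half] at h
  linarith

lemma vel_pos (hp : IsProfile α p) {k : UnitAddCircle} (h0 : 0 < rep k) (hk : k ≠ half) :
    0 < vel α k := by
  have hk0 : k ≠ 0 := fun h => by rw [h, rep_zero] at h0; exact lt_irrefl _ h0
  have h2 : rep k < 1 / 2 := lt_of_le_of_ne (rep_mem k).2 fun h => hk (eq_half_of_rep h)
  have hpi := Real.pi_pos
  have hs : 0 < Real.sin (2 * Real.pi * rep k) :=
    Real.sin_pos_of_pos_of_lt_pi (by positivity) (by nlinarith)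
  have hd := hp.deriv_neg _ (cosT_mem_Ico hk0)
  have hω := hp.omega_pos hk0
  rw [hp.vel_eq hk0]
  exact div_pos (by nlinarith) (by positivity)

lemma vel_neg_of_rep_neg (hp : IsProfile α p) {k : UnitAddCircle} (h0 : rep k < 0) :
    vel α k < 0 := by
  have hk : k ≠ half := fun h => by rw [h, rep_half] at h0; norm_num at h0
  have hr := rep_neg_of_ne_half hk
  have := hp.vel_pos (k := -k) (by linarith) (fun h => hk (by
    rw [← neg_neg k, h, neg_half]))
  rw [hp.vel_neg] at this
  linarith

lemma eq_half_of_vel_eq_zero (hp : IsProfile α p) {k : UnitAddCircle} (hk : k ≠ 0)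
    (hv : vel α k = 0) : k = half := by
  rcases lt_trichotomy (rep k) 0 with h | h | h
  · exact absurd hv (hp.vel_neg_of_rep_neg h).ne
  · exact absurd (rep_eq_zero_iff.1 h) hk
  · by_contra hh
    exact absurd hv (hp.vel_pos h hh).ne'

lemma vel_zero (hp : IsProfile α p) : vel α 0 = 0 := by
  have h := hp.vel_neg 0
  rw [neg_zero] at h
  linarith

/-- First and second order bounds for `p`, uniform away from `c = 1`. -/
lemma exists_bounds (hp : IsProfile α p) {c₁ : ℝ} (hc₁ : c₁ < 1) : ∃ m M : ℝ, 0 < m ∧ 0 ≤ M ∧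
    ∀ d ∈ Icc (-1 : ℝ) c₁, m ≤ |deriv p d| ∧ ∀ c ∈ Icc (-1 : ℝ) 1,
      m * |c - d| ≤ |p c - p d| ∧ |p c - p d - deriv p d * (c - d)| ≤ M * |c - d| ^ 2 := by
  obtain ⟨M, hM⟩ : ∃ M : NNReal, LipschitzOnWith M (deriv p) (Icc (-1) 1) := by
    have h : ContDiffOn ℝ 1 (deriv p) (Icc (-1) 1) := fun c hc =>
      (hp.contDiffAt_deriv hc).contDiffWithinAt
    exact h.exists_lipschitzOnWith (by norm_num) (convex_Icc _ _) isCompact_Icc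
  -- An intermediate point strictly between `c₁` and `1`: on `[-1, c₂]` compactness bounds `p'` away
  -- from `0`. The maximum with `-1` keeps the interval nonempty whatever `c₁` is.
  set c₂ := (1 + max c₁ (-1)) / 2 with hc₂
  have hmax : max c₁ (-1) < 1 := max_lt hc₁ (by norm_num)
  have hc₂1 : c₂ < 1 := by rw [hc₂]; linarith
  have hc₂2 : c₁ < c₂ := by have := le_max_left c₁ (-1); rw [hc₂]; linarith
  have hc₂3 : -1 ≤ c₂ := by have := le_max_right c₁ (-1); rw [hc₂]; linarith
  have hcont : ContinuousOn (deriv p) (Icc (-1) c₂) := fun c hc =>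
    (hp.continuousAt_deriv ⟨hc.1, hc.2.trans hc₂1.le⟩).continuousWithinAt
  obtain ⟨x₀, hx₀, hmaxi⟩ := isCompact_Icc.exists_isMaxOn (nonempty_Icc.2 hc₂3) hcont
  have hneg : deriv p x₀ < 0 := hp.deriv_neg x₀ ⟨hx₀.1, hx₀.2.trans_lt hc₂1⟩
  set m₀ := -deriv p x₀ with hm₀
  have hm₀p : 0 < m₀ := by rw [hm₀]; linarith
  have hle : ∀ c ∈ Icc (-1) c₂, deriv p c ≤ -m₀ := fun c hc => by
    rw [hm₀, neg_neg]; exact hmaxi hc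
  have hmono : AntitoneOn (fun x => p x + m₀ * x) (Icc (-1) c₂) := by
    refine antitoneOn_of_deriv_nonpos (convex_Icc _ _) ?_ ?_ ?_
    · intro c hc
      exact ((hp.continuousAt ⟨hc.1, hc.2.trans hc₂1.le⟩).add
        (by fun_prop)).continuousWithinAt
    · intro c hc
      rw [interior_Icc] at hc
      exact ((hp.differentiableAt ⟨hc.1.le, (hc.2.trans hc₂1).le⟩).add
        (by fun_prop)).differentiableWithinAt
    · intro c hc
      rw [interior_Icc] at hc
      have hd := (hp.differentiableAt ⟨hc.1.le, (hc.2.trans hc₂1).le⟩).hasDerivAt.add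
        ((hasDerivAt_id c).const_mul m₀)
      have hd' : deriv (fun x => p x + m₀ * x) c = deriv p c + m₀ * 1 := hd.deriv
      rw [hd']
      linarith [hle c ⟨hc.1.le, hc.2.le⟩]
  have hanti : AntitoneOn p (Icc (-1) 1) := by
    refine antitoneOn_of_deriv_nonpos (convex_Icc _ _) ?_ ?_ ?_
    · intro c hc
      exact (hp.continuousAt hc).continuousWithinAt
    · intro c hc
      rw [interior_Icc] at hc
      exact (hp.differentiableAt ⟨hc.1.le, hc.2.le⟩).differentiableWithinAt
    · intro c hc
      rw [interior_Icc] at hc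
      exact (hp.deriv_neg c ⟨hc.1.le, hc.2⟩).le
  have hθ : 0 < min 1 ((c₂ - c₁) / 2) := lt_min one_pos (by linarith)
  refine ⟨m₀ * min 1 ((c₂ - c₁) / 2), M, by positivity, M.2, fun d hd => ⟨?_, fun c hc => ⟨?_, ?_⟩⟩⟩
  · have h1 := hle d ⟨hd.1, hd.2.trans hc₂2.le⟩
    rw [abs_of_neg (by linarith)]
    have : m₀ * min 1 ((c₂ - c₁) / 2) ≤ m₀ * 1 := mul_le_mul_of_nonneg_left (min_le_left _ _) hm₀p.le
    linarith
  · have hd2 : d ∈ Icc (-1) c₂ := ⟨hd.1, hd.2.trans hc₂2.le⟩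
    rcases le_or_gt c c₂ with h | h
    · have key : m₀ * |c - d| ≤ |p c - p d| := by
        rcases le_total c d with h' | h'
        · have := hmono ⟨hc.1, h⟩ hd2 h'
          simp only at this
          rw [abs_of_nonpos (by linarith : c - d ≤ 0)]
          refine le_trans ?_ (le_abs_self _)
          nlinarith
        · have := hmono hd2 ⟨hc.1, h⟩ h'
          simp only at this
          rw [abs_of_nonneg (by linarith : 0 ≤ c - d)]
          refine le_trans ?_ (neg_le_abs _)
          nlinarith
      refine le_trans ?_ key
      refine mul_le_mul_of_nonneg_right ?_ (abs_nonneg _)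
      nlinarith [min_le_left (1 : ℝ) ((c₂ - c₁) / 2)]
    -- Beyond `c₂` nothing bounds `|p'|` from below, so monotonicity alone gives `p c ≤ p c₂`. As `c
    -- - d ≤ 2` and `c₂ - d ≥ c₂ - c₁`, the slope deteriorates only by the factor `(c₂ - c₁)/2`.
    · have h1 := hmono hd2 ⟨hc₂3, le_rfl⟩ hd2.2
      have h2 := hanti ⟨hc₂3, hc₂1.le⟩ hc h.le
      simp only at h1
      rw [abs_of_nonneg (by linarith [hd2.2] : 0 ≤ c - d)]
      refine le_trans ?_ (neg_le_abs _)
      have h3 : min 1 ((c₂ - c₁) / 2) * (c - d) ≤ (c₂ - c₁) / 2 * 2 :=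
        mul_le_mul (min_le_right _ _) (by linarith [hc.2, hd.1]) (by linarith [hd2.2]) (by linarith)
      have h4 : m₀ * (min 1 ((c₂ - c₁) / 2) * (c - d)) ≤ m₀ * (c₂ - d) :=
        mul_le_mul_of_nonneg_left (by linarith [hd.2]) hm₀p.le
      nlinarith
  · have hd1 : d ∈ Icc (-1 : ℝ) 1 := ⟨hd.1, hd.2.trans hc₁.le⟩
    have hsub : uIcc d c ⊆ Icc (-1) 1 := uIcc_subset_Icc hd1 hc
    have h := Convex.norm_image_sub_le_of_norm_hasDerivWithin_le
      (f := fun x => p x - deriv p d * x) (f' := fun x => deriv p x - deriv p d * 1)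
      (C := M * |c - d|) (s := uIcc d c) (x := d) (y := c) (fun x hx => ?_) (fun x hx => ?_)
      (convex_uIcc _ _) left_mem_uIcc right_mem_uIcc
    · rw [Real.norm_eq_abs, Real.norm_eq_abs] at h
      calc |p c - p d - deriv p d * (c - d)|
          = |p c - deriv p d * c - (p d - deriv p d * d)| := by congr 1; ring
        _ ≤ _ := h
        _ = _ := by ring
    · exact ((hp.differentiableAt (hsub hx)).hasDerivAt.sub
        ((hasDerivAt_id x).const_mul _)).hasDerivWithinAt
    · have h1 := hM.norm_sub_le (hsub hx) hd1
      rw [mul_one]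
      refine h1.trans (mul_le_mul_of_nonneg_left ?_ M.2)
      exact abs_sub_left_of_mem_uIcc hx

end IsProfile
end
end KineticInterface

namespace KineticInterface
noncomputable section

/-! ### The resolvent integral -/

lemma integral_exp_mul_cos {z : ℂ} (hz : 0 < z.re) (w : ℝ) :
    ∫ t in Ioi (0 : ℝ), Complex.exp (-(z * (t : ℂ))) * (Real.cos (w * t) : ℂ)
      = z / (z ^ 2 + (w : ℂ) ^ 2) := by
  have h1 : (-z + Complex.I * w).re < 0 := by simpa using hz
  have h2 : (-z - Complex.I * w).re < 0 := by simpa using hz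
  have e : ∀ t : ℝ, Complex.exp (-(z * (t : ℂ))) * (Real.cos (w * t) : ℂ) =
      (1 / 2 : ℂ) * Complex.exp ((-z + Complex.I * w) * t) +
        (1 / 2 : ℂ) * Complex.exp ((-z - Complex.I * w) * t) := by
    intro t
    rw [Complex.ofReal_cos, Complex.cos]
    have e1 : (-z + Complex.I * w) * t = -(z * t) + (w * t : ℝ) * Complex.I := by push_cast; ring
    have e2 : (-z - Complex.I * w) * t = -(z * t) + -(w * t : ℝ) * Complex.I := by push_cast; ring
    rw [e1, e2, Complex.exp_add, Complex.exp_add]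
    ring
  simp_rw [e]
  rw [integral_add ((integrableOn_exp_mul_complex_Ioi h1 0).const_mul _)
    ((integrableOn_exp_mul_complex_Ioi h2 0).const_mul _), integral_const_mul, integral_const_mul,
    integral_exp_mul_complex_Ioi h1, integral_exp_mul_complex_Ioi h2]
  have n1 : -z + Complex.I * w ≠ 0 := fun h => by rw [h] at h1; simp at h1
  have n2 : -z - Complex.I * w ≠ 0 := fun h => by rw [h] at h2; simp at h2
  have n3 : z ^ 2 + (w : ℂ) ^ 2 = (-z + Complex.I * w) * (-z - Complex.I * w) := by
    ring_nf; simp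
  rw [n3]
  field_simp
  simp
  ring

lemma JTilde_eq {α : ℤ → ℝ} {p : ℝ → ℝ} (hp : IsProfile α p) {z : ℂ} (hz : 0 < z.re) :
    JTilde α z = ∫ k : UnitAddCircle, z / (z ^ 2 + (omega α (rep k) : ℂ) ^ 2) := by
  have hω : Continuous fun k : UnitAddCircle => omega α (rep k) :=
    continuous_iff_continuousAt.2 hp.continuousAt_omega
  have hint : Integrable (Function.uncurry fun (t : ℝ) (k : UnitAddCircle) =>
      Complex.exp (-(z * (t : ℂ))) * (Real.cos (omega α (rep k) * t) : ℂ))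
      ((volume.restrict (Ioi (0 : ℝ))).prod volume) := by
    have hdom : Integrable (fun q : ℝ × UnitAddCircle => Real.exp (-z.re * q.1) * 1)
        ((volume.restrict (Ioi (0 : ℝ))).prod volume) :=
      Integrable.mul_prod (f := fun t => Real.exp (-z.re * t)) (g := fun _ => (1 : ℝ))
        (integrableOn_exp_mul_Ioi (neg_lt_zero.2 hz) 0) (integrable_const _)
    refine hdom.mono' ?_ ?_
    · refine Continuous.aestronglyMeasurable ?_
      simp only [Function.uncurry_def]
      have : Continuous fun q : ℝ × UnitAddCircle => omega α (rep q.2) := hω.comp continuous_snd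
      fun_prop
    · refine Eventually.of_forall fun q => ?_
      simp only [Function.uncurry_def]
      rw [norm_mul, Complex.norm_exp, Complex.norm_real, Real.norm_eq_abs]
      refine mul_le_mul (le_of_eq ?_) (Real.abs_cos_le_one _) (abs_nonneg _) (Real.exp_pos _).le
      simp
  rw [JTilde]
  calc ∫ t in Ioi (0 : ℝ), Complex.exp (-(z * (t : ℂ))) * (J α t : ℂ)
      = ∫ t in Ioi (0 : ℝ), ∫ k : UnitAddCircle,
          Complex.exp (-(z * (t : ℂ))) * (Real.cos (omega α (rep k) * t) : ℂ) := by
        congr 1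
        ext t
        rw [J, integral_const_mul, integral_complex_ofReal]
    _ = ∫ k : UnitAddCircle, ∫ t in Ioi (0 : ℝ),
          Complex.exp (-(z * (t : ℂ))) * (Real.cos (omega α (rep k) * t) : ℂ) :=
        integral_integral_swap hint
    _ = _ := by
        congr 1
        ext k
        rw [integral_exp_mul_cos hz]

lemma integral_fourier_pow {m : ℤ} (hm : m ≠ 0) {n : ℕ} (hn : n ≠ 0) :
    ∫ k : UnitAddCircle, (fourier m k : ℂ) ^ n = 0 := by
  have e : ∀ k : UnitAddCircle, (fourier m k : ℂ) ^ n = fourier (n * m : ℤ) k := fun k => by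
    rw [fourier_apply, fourier_apply, ← Circle.coe_pow, ← AddCircle.toCircle_nsmul, mul_smul,
      natCast_zsmul]
  simp_rw [e]
  have h0 : (n * m : ℤ) ≠ 0 := mul_ne_zero (by exact_mod_cast hn) hm
  exact integral_eq_zero_of_add_right_eq_neg (fourier_add_half_inv_index h0 one_pos)

/-- All terms of the geometric series except the constant one have mean zero. -/
lemma integral_geometric {q : ℂ} (hq : ‖q‖ < 1) (f : C(UnitAddCircle, ℂ)) (hf : ∀ k, ‖f k‖ = 1)
    (hf0 : ∀ n : ℕ, n ≠ 0 → ∫ k : UnitAddCircle, (f k) ^ n = 0) :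
    ∫ k : UnitAddCircle, (1 - q * f k)⁻¹ = 1 := by
  have hs : ∀ k, HasSum (fun n : ℕ => (q * f k) ^ n) (1 - q * f k)⁻¹ := fun k =>
    hasSum_geometric_of_norm_lt_one (by rwa [norm_mul, hf, mul_one])
  have hint : ∀ n : ℕ, Integrable (fun k => (q * f k) ^ n) (volume : Measure UnitAddCircle) :=
    fun n => (by fun_prop : Continuous fun k => (q * f k) ^ n).integrable_of_hasCompactSupport
      (HasCompactSupport.of_compactSpace _)
  have hval : ∀ n : ℕ, ∫ k : UnitAddCircle, (q * f k) ^ n = if n = 0 then 1 else 0 := fun n => by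
    split_ifs with h
    · simp [h]
    · simp_rw [mul_pow]
      rw [integral_const_mul, hf0 n h, mul_zero]
  have h := hasSum_integral_of_summable_integral_norm hint ?_
  · simp_rw [hval, (hs _).tsum_eq] at h
    exact h.unique (hasSum_ite_eq 0 1)
  · simp only [norm_pow, norm_mul, hf, mul_one, integral_const, probReal_univ, one_smul]
    exact summable_geometric_of_lt_one (norm_nonneg _) hq

lemma cosT_eq_fourier (k : UnitAddCircle) :
    (cosT k : ℂ) = (fourier 1 k + fourier (-1) k) / 2 := by
  conv_rhs => rw [← coe_rep k]
  rw [fourier_coe_apply, fourier_coe_apply, cosT, Complex.ofReal_cos, Complex.cos]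
  congr 3 <;> push_cast <;> ring

/-- The two roots have product `1`. If neither lies inside the unit disc, both lie on the circle and
are conjugate, which forces their half-sum `ζ` to be real. -/
lemma exists_joukowski {ζ : ℂ} (hζ : ζ.im ≠ 0) :
    ∃ q : ℂ, ‖q‖ < 1 ∧ q ≠ 0 ∧ q ^ 2 - 2 * ζ * q + 1 = 0 := by
  obtain ⟨w, hw⟩ := IsAlgClosed.exists_pow_nat_eq (ζ ^ 2 - 1) (n := 2) (by norm_num)
  have hprod : (ζ + w) * (ζ - w) = 1 := by linear_combination -hw
  have hn : ‖ζ + w‖ * ‖ζ - w‖ = 1 := by rw [← norm_mul, hprod, norm_one]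
  have h1 : ζ + w ≠ 0 := left_ne_zero_of_mul_eq_one hprod
  have h2 : ζ - w ≠ 0 := right_ne_zero_of_mul_eq_one hprod
  rcases lt_trichotomy ‖ζ + w‖ 1 with h | h | h
  · exact ⟨ζ + w, h, h1, by linear_combination hw⟩
  · exfalso
    apply hζ
    have h3 : ζ - w = (starRingEnd ℂ) (ζ + w) := by
      have h4 : (ζ + w) * (starRingEnd ℂ) (ζ + w) = 1 := by
        rw [Complex.mul_conj, Complex.normSq_eq_norm_sq, h]; norm_num
      exact mul_left_cancel₀ h1 (hprod.trans h4.symm)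
    have h5 := congrArg Complex.im h3
    simp at h5
    linarith
  · refine ⟨ζ - w, ?_, h2, by linear_combination hw⟩
    by_contra hcon
    push Not at hcon
    nlinarith [norm_nonneg (ζ - w)]

lemma sub_cosT_ne_zero {ζ : ℂ} (hζ : ζ.im ≠ 0) (k : UnitAddCircle) : ζ - cosT k ≠ 0 := by
  intro h
  apply hζ
  have := congrArg Complex.im h
  simpa using this

/-- With `2ζ = q + 1/q` and `|q| < 1`, partial fractions split the resolvent into two geometric
series, so the integral is `2q / (1 - q²)`. Squaring eliminates `q`; the lost sign is recovered from
the imaginary part in `integral_resolvent_cosT_im_nonneg`. -/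
lemma integral_resolvent_cosT {ζ : ℂ} (hζ : ζ.im ≠ 0) :
    (∫ k : UnitAddCircle, (ζ - cosT k)⁻¹) ^ 2 * (ζ ^ 2 - 1) = 1 := by
  obtain ⟨q, hq, hq0, hqe⟩ := exists_joukowski hζ
  have hnf : ∀ (m : ℤ) (k : UnitAddCircle), ‖(fourier m k : ℂ)‖ = 1 := fun m k => by
    rw [fourier_apply]; exact Circle.norm_coe _
  have hne : ∀ (m : ℤ) (k : UnitAddCircle), 1 - q * fourier m k ≠ 0 := fun m k h => by
    have h1 : ‖q * fourier m k‖ = 1 := by rw [← sub_eq_zero.1 h, norm_one]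
    rw [norm_mul, hnf, mul_one] at h1
    linarith
  have hq2 : 1 - q ^ 2 ≠ 0 := fun h => by
    have h1 : ‖q ^ 2‖ = 1 := by rw [← sub_eq_zero.1 h, norm_one]
    rw [norm_pow] at h1
    nlinarith [norm_nonneg q]
  have hff : ∀ k : UnitAddCircle, (fourier 1 k : ℂ) * fourier (-1) k = 1 := fun k => by
    rw [← fourier_add]; simp
  have hpt : ∀ k : UnitAddCircle, (ζ - cosT k)⁻¹ = 2 * q / (1 - q ^ 2) *
      ((1 - q * fourier 1 k)⁻¹ + (1 - q * fourier (-1) k)⁻¹ - 1) := fun k => by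
    have h0 := sub_cosT_ne_zero hζ k
    have h1 := hne 1 k
    have h2 := hne (-1) k
    have h3 := hff k
    have hz : (ζ - cosT k) * (2 * q) = (1 - q * fourier 1 k) * (1 - q * fourier (-1) k) := by
      rw [cosT_eq_fourier]
      linear_combination (-hqe) - q ^ 2 * h3
    have hsum : (1 - q * fourier 1 k)⁻¹ + (1 - q * fourier (-1) k)⁻¹ - 1 =
        (1 - q ^ 2) * ((1 - q * fourier 1 k)⁻¹ * (1 - q * fourier (-1) k)⁻¹) := by
      rw [inv_add_inv h1 h2, ← mul_inv, ← div_eq_mul_inv, div_sub_one (mul_ne_zero h1 h2)]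
      congr 1
      linear_combination (-q ^ 2) * h3
    rw [hsum, ← mul_inv, ← hz]
    field_simp
  have hi : ∀ m : ℤ, Integrable (fun k : UnitAddCircle => (1 - q * fourier m k)⁻¹) := fun m =>
    ((by fun_prop : Continuous fun k : UnitAddCircle => 1 - q * (fourier m k : ℂ)).inv₀
      (hne m)).integrable_of_hasCompactSupport (HasCompactSupport.of_compactSpace _)
  have hI : ∫ k : UnitAddCircle, (ζ - cosT k)⁻¹ = 2 * q / (1 - q ^ 2) := by
    simp_rw [hpt]
    have hadd : Integrable (fun k : UnitAddCircle =>
        (1 - q * fourier 1 k)⁻¹ + (1 - q * fourier (-1) k)⁻¹) := (hi 1).add (hi (-1))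
    rw [integral_const_mul, integral_sub hadd (integrable_const _),
      integral_add (hi 1) (hi (-1)),
      integral_geometric hq _ (hnf 1) (fun n hn => integral_fourier_pow (by norm_num) hn),
      integral_geometric hq _ (hnf (-1)) (fun n hn => integral_fourier_pow (by norm_num) hn)]
    simp
  rw [hI]
  have hw : (1 - q ^ 2) ^ 2 = (2 * q) ^ 2 * (ζ ^ 2 - 1) := by
    linear_combination (1 + q ^ 2 + 2 * ζ * q) * hqe
  field_simp
  rw [hw]; ring

lemma integrable_resolvent_cosT {ζ : ℂ} (hζ : ζ.im ≠ 0) :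
    Integrable fun k : UnitAddCircle => (ζ - cosT k)⁻¹ := by
  have hc : Continuous fun k : UnitAddCircle => ζ - (cosT k : ℂ) :=
    continuous_const.sub (Complex.continuous_ofReal.comp continuous_cosT)
  exact (hc.inv₀ (sub_cosT_ne_zero hζ)).integrable_of_hasCompactSupport
    (HasCompactSupport.of_compactSpace _)

lemma integral_resolvent_cosT_im_nonneg {ζ : ℂ} (hζ : ζ.im < 0) :
    0 ≤ (∫ k : UnitAddCircle, (ζ - cosT k)⁻¹).im := by
  have h : (∫ k : UnitAddCircle, (ζ - cosT k)⁻¹).im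
      = ∫ k : UnitAddCircle, ((ζ - cosT k)⁻¹).im := by
    have := integral_im (integrable_resolvent_cosT hζ.ne)
    exact this.symm
  rw [h]
  refine integral_nonneg fun k => ?_
  simp only [Pi.zero_apply, Complex.inv_im, Complex.sub_im, Complex.ofReal_im, sub_zero]
  exact div_nonneg (by linarith) (Complex.normSq_nonneg _)

/-- The square of the integral tends to `(i/s)²` with `s = √(1 - c²)`. Factoring the difference of
squares, the factor `I + i/s` stays away from `0` because `Im I ≥ 0`, so the other factor must tend
to `0`. This selects the branch without any choice of complex square root. -/
lemma tendsto_integral_resolvent_cosT {ι : Type*} {l : Filter ι} {ζ : ι → ℂ} {c : ℝ}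
    (hc : c ^ 2 < 1) (hζ : Tendsto ζ l (𝓝 c)) (him : ∀ᶠ i in l, (ζ i).im < 0) :
    Tendsto (fun i => ∫ k : UnitAddCircle, (ζ i - cosT k)⁻¹) l
      (𝓝 (Complex.I / √(1 - c ^ 2))) := by
  set s := √(1 - c ^ 2) with hs
  have hs0 : 0 < s := Real.sqrt_pos.2 (by linarith)
  have hss : s ^ 2 = 1 - c ^ 2 := Real.sq_sqrt (by linarith)
  have hssC : (s : ℂ) ^ 2 = 1 - (c : ℂ) ^ 2 := by exact_mod_cast hss
  have hsC : (s : ℂ) ≠ 0 := by exact_mod_cast hs0.ne'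
  rw [tendsto_iff_norm_sub_tendsto_zero]
  have hlim : Tendsto (fun i => s * ‖((ζ i) ^ 2 - 1)⁻¹ + 1 / (s : ℂ) ^ 2‖) l (𝓝 0) := by
    have h1 : Tendsto (fun i => (ζ i) ^ 2 - 1) l (𝓝 ((c : ℂ) ^ 2 - 1)) := (hζ.pow 2).sub_const 1
    have hne : (c : ℂ) ^ 2 - 1 ≠ 0 := by
      rw [← neg_ne_zero, neg_sub, ← hssC]; positivity
    have h2 := ((h1.inv₀ hne).add_const (1 / (s : ℂ) ^ 2)).norm.const_mul s
    have h3 : s * ‖((c : ℂ) ^ 2 - 1)⁻¹ + 1 / (s : ℂ) ^ 2‖ = 0 := by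
      have : ((c : ℂ) ^ 2 - 1)⁻¹ + 1 / (s : ℂ) ^ 2 = 0 := by
        rw [hssC, ← neg_sub (1 : ℂ), ← hssC, inv_neg, one_div, neg_add_cancel]
      rw [this, norm_zero, mul_zero]
    rwa [h3] at h2
  refine squeeze_zero' (Eventually.of_forall fun _ => norm_nonneg _) ?_ hlim
  filter_upwards [him] with i hi
  set I := ∫ k : UnitAddCircle, (ζ i - cosT k)⁻¹ with hI
  have h1 := integral_resolvent_cosT hi.ne
  have h2 := integral_resolvent_cosT_im_nonneg hi
  rw [← hI] at h1 h2
  have h3 : ((ζ i) ^ 2 - 1)⁻¹ = I ^ 2 := by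
    have := right_ne_zero_of_mul_eq_one h1
    field_simp
    rw [mul_comm, h1]
  have h4 : I ^ 2 + 1 / (s : ℂ) ^ 2 = (I - Complex.I / s) * (I + Complex.I / s) := by
    have := Complex.I_sq
    field_simp
    linear_combination this
  rw [h3, h4, norm_mul]
  have h5 : 1 / s ≤ ‖I + Complex.I / s‖ := by
    refine le_trans ?_ (Complex.abs_im_le_norm _)
    refine le_trans ?_ (le_abs_self _)
    have : (Complex.I / (s : ℂ)).im = 1 / s := by
      rw [Complex.div_ofReal_im]; simp
    rw [Complex.add_im, this]
    linarith
  have h6 : 1 ≤ s * ‖I + Complex.I / s‖ := by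
    rwa [div_le_iff₀' hs0] at h5
  nlinarith [norm_nonneg (I - Complex.I / s)]

end
end KineticInterface

namespace KineticInterface
noncomputable section

/-! ### The interface coefficients -/

lemma abs_le_two_mul_norm_add {x : ℝ} {η : ℂ} (hη : |η.re| ≤ |η.im|) :
    |x| ≤ 2 * ‖(x : ℂ) + η‖ := by
  have h1 := Complex.abs_re_le_norm ((x : ℂ) + η)
  have h2 := Complex.abs_im_le_norm ((x : ℂ) + η)
  simp only [Complex.add_re, Complex.ofReal_re, Complex.add_im, Complex.ofReal_im, zero_add]
    at h1 h2
  have h3 : |x| ≤ |x + η.re| + |η.re| := by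
    have := abs_sub (x + η.re) η.re
    rwa [add_sub_cancel_right] at this
  linarith

/-- The regularised form of: two quantities of size at least `mδ` that differ by at most `Mδ²` have
inverses within `O(M/m²)`, uniformly in `δ`. The condition on `η` prevents its real part from
cancelling `x` or `y`. -/
lemma norm_inv_add_sub_inv_add_le {x y δ m M : ℝ} {η : ℂ} (hη : |η.re| ≤ |η.im|) (hm : 0 < m)
    (hM : 0 ≤ M) (hδ : 0 ≤ δ) (hx : m * δ ≤ |x|) (hy : m * δ ≤ |y|) (hxy : |x - y| ≤ M * δ ^ 2) :
    ‖((x : ℂ) + η)⁻¹ - ((y : ℂ) + η)⁻¹‖ ≤ 4 * M / m ^ 2 := by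
  rcases hδ.eq_or_lt with rfl | hδ
  · have : x = y := by
      have : |x - y| ≤ 0 := by simpa using hxy
      linarith [abs_eq_zero.1 (le_antisymm this (abs_nonneg _))]
    rw [this, sub_self, norm_zero]
    positivity
  · have hx2 := hx.trans (abs_le_two_mul_norm_add hη)
    have hy2 := hy.trans (abs_le_two_mul_norm_add hη)
    have hmδ : 0 < m * δ := by positivity
    have nx : 0 < ‖(x : ℂ) + η‖ := by linarith
    have ny : 0 < ‖(y : ℂ) + η‖ := by linarith
    rw [inv_sub_inv (norm_pos_iff.1 nx) (norm_pos_iff.1 ny), norm_div, norm_mul,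
      div_le_div_iff₀ (by positivity) (by positivity)]
    have e : ‖(y : ℂ) + η - ((x : ℂ) + η)‖ = |x - y| := by
      rw [add_sub_add_right_eq_sub, ← Complex.ofReal_sub, Complex.norm_real, Real.norm_eq_abs,
        abs_sub_comm]
    rw [e]
    have h1 : m * δ * (m * δ) ≤ (2 * ‖(x : ℂ) + η‖) * (2 * ‖(y : ℂ) + η‖) :=
      mul_le_mul hx2 hy2 hmδ.le (by positivity)
    calc |x - y| * m ^ 2 ≤ M * δ ^ 2 * m ^ 2 := mul_le_mul_of_nonneg_right hxy (by positivity)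
      _ = M * (m * δ * (m * δ)) := by ring
      _ ≤ M * ((2 * ‖(x : ℂ) + η‖) * (2 * ‖(y : ℂ) + η‖)) := mul_le_mul_of_nonneg_left h1 hM
      _ = _ := by ring

/-- The regular part of the principal value integral `∫ dk / (p (cos 2πk) - p c)`. -/
def regularPart (p : ℝ → ℝ) (c : ℝ) : ℝ :=
  ∫ k : UnitAddCircle, ((p (cosT k) - p c)⁻¹ - (deriv p c * (cosT k - c))⁻¹)

lemma ae_cosT_ne (k₀ : UnitAddCircle) :
    ∀ᵐ k : UnitAddCircle, k ≠ 0 ∧ cosT k ≠ cosT k₀ := by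
  have h : ∀ a : UnitAddCircle, ∀ᵐ k : UnitAddCircle, k ≠ a := fun a => by
    have h := AddCircle.volume_closedBall (T := (1 : ℝ)) (x := a) 0
    rw [Metric.closedBall_zero] at h
    simpa [ae_iff] using h
  filter_upwards [h 0, h k₀, h (-k₀)] with k h0 h1 h2
  refine ⟨h0, fun h3 => ?_⟩
  rcases abs_rep_injOn h3.symm with h4 | h4
  · exact h1 h4
  · exact h2 h4

/-! ### Boundary values of the resolvent and the formula for `℘` -/

namespace IsProfile
variable {α : ℤ → ℝ} {p : ℝ → ℝ}

lemma continuous_comp_cosT (hp : IsProfile α p) : Continuous fun k => p (cosT k) :=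
  continuous_iff_continuousAt.2 fun k =>
    ContinuousAt.comp (f := cosT) (g := p) (hp.continuousAt (cosT_mem k))
      continuous_cosT.continuousAt

lemma diff_bound (hp : IsProfile α p) {c₁ : ℝ} (hc₁ : c₁ < 1) : ∃ C : ℝ,
    ∀ d ∈ Icc (-1 : ℝ) c₁, ∀ c ∈ Icc (-1 : ℝ) 1, ∀ η : ℂ, |η.re| ≤ |η.im| →
    ‖(((p c - p d : ℝ) : ℂ) + η)⁻¹ - (((deriv p d * (c - d) : ℝ) : ℂ) + η)⁻¹‖ ≤ C := by
  obtain ⟨m, M, hm, hM, hb⟩ := hp.exists_bounds hc₁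
  refine ⟨4 * M / m ^ 2, fun d hd c hc η hη => ?_⟩
  obtain ⟨h1, h2⟩ := hb d hd
  obtain ⟨h3, h4⟩ := h2 c hc
  refine norm_inv_add_sub_inv_add_le hη hm hM (abs_nonneg (c - d)) h3 ?_ h4
  rw [abs_mul]
  exact mul_le_mul_of_nonneg_right h1 (abs_nonneg _)

lemma diff_bound_real (hp : IsProfile α p) {c₁ : ℝ} (hc₁ : c₁ < 1) : ∃ C : ℝ,
    ∀ d ∈ Icc (-1 : ℝ) c₁, ∀ c ∈ Icc (-1 : ℝ) 1,
    ‖(p c - p d)⁻¹ - (deriv p d * (c - d))⁻¹‖ ≤ C := by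
  obtain ⟨C, hC⟩ := hp.diff_bound hc₁
  refine ⟨C, fun d hd c hc => ?_⟩
  have := hC d hd c hc 0 (by simp)
  rw [add_zero, add_zero, ← Complex.ofReal_inv, ← Complex.ofReal_inv, ← Complex.ofReal_sub,
    Complex.norm_real] at this
  exact this

lemma p_ne (hp : IsProfile α p) {c d : ℝ} (hd : d ∈ Ico (-1 : ℝ) 1) (hc : c ∈ Icc (-1 : ℝ) 1)
    (h : c ≠ d) : p c - p d ≠ 0 := by
  obtain ⟨m, M, hm, hM, hb⟩ := hp.exists_bounds hd.2
  have h1 := ((hb d ⟨hd.1, le_rfl⟩).2 c hc).1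
  have h2 : 0 < m * |c - d| := mul_pos hm (abs_pos.2 (sub_ne_zero.2 h))
  exact abs_pos.1 (h2.trans_le h1)

lemma continuousAt_regularPart (hp : IsProfile α p) {k₀ : UnitAddCircle} (hk₀ : k₀ ≠ 0) :
    ContinuousAt (fun k => regularPart p (cosT k)) k₀ := by
  have hc := cosT_mem_Ico hk₀
  set c₁ := (1 + cosT k₀) / 2 with hc₁
  have h1 : c₁ < 1 := by rw [hc₁]; linarith [hc.2]
  have h2 : cosT k₀ < c₁ := by rw [hc₁]; linarith [hc.2]
  obtain ⟨C, hC⟩ := hp.diff_bound_real h1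
  refine continuousAt_of_dominated (bound := fun _ => C) (Eventually.of_forall fun k => ?_) ?_
    (integrable_const _) ?_
  · have h3 := hp.continuous_comp_cosT.measurable
    have h4 := continuous_cosT.measurable
    exact ((h3.sub_const _).inv.sub ((h4.sub_const _).const_mul _).inv).aestronglyMeasurable
  · filter_upwards [continuous_cosT.continuousAt.eventually (gt_mem_nhds h2)] with k hk
    exact Eventually.of_forall fun k' => hC _ ⟨(cosT_mem k).1, hk.le⟩ _ (cosT_mem k')
  · filter_upwards [ae_cosT_ne k₀] with k hk
    have hd := hp.deriv_neg _ hc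
    have e1 := hp.continuous_comp_cosT.continuousAt (x := k₀)
    have e2 := hp.continuousAt_deriv_cosT k₀
    have e3 := continuous_cosT.continuousAt (x := k₀)
    exact ((continuousAt_const.sub e1).inv₀ (hp.p_ne hc (cosT_mem k) hk.2)).sub
      ((e2.mul (continuousAt_const.sub e3)).inv₀ (mul_ne_zero hd.ne (sub_ne_zero.2 hk.2)))

lemma two_abs_vel (hp : IsProfile α p) {k : UnitAddCircle} (hk : k ≠ 0) :
    2 * |vel α k| = √(1 - cosT k ^ 2) * -deriv p (cosT k) / omega α (rep k) := by
  have hω := hp.omega_pos hk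
  have hd := hp.deriv_neg _ (cosT_mem_Ico hk)
  have hs : √(1 - cosT k ^ 2) = |Real.sin (2 * Real.pi * rep k)| := by
    rw [cosT, Real.abs_sin_eq_sqrt_one_sub_cos_sq]
  rw [hp.vel_eq hk, abs_div, abs_neg, abs_mul, abs_of_neg hd, hs,
    abs_of_pos (by positivity : 0 < 2 * omega α (rep k))]
  field_simp

/-- The denominator is compared with its linearisation in `cos 2πk` at the resonant value `c`. The
difference of the inverses is uniformly bounded and tends to `regularPart`; the linearised integral
is an explicit resolvent. Only the real part `1/(2|v|)` has to be known exactly; of the imaginary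
part continuity in `k₀` is enough. -/
lemma tendsto_JTilde (hp : IsProfile α p) {k₀ : UnitAddCircle} (hk₀ : k₀ ≠ 0) (hk₁ : k₀ ≠ half) :
    Tendsto (fun ε : ℝ => JTilde α ((ε : ℂ) - Complex.I * (omega α (rep k₀) : ℂ))) (𝓝[>] 0)
      (𝓝 (((2 * |vel α k₀|)⁻¹ : ℝ) -
        Complex.I * (omega α (rep k₀) * regularPart p (cosT k₀) : ℝ))) := by
  set ω := omega α (rep k₀) with hω
  set c := cosT k₀ with hc
  have hω0 : 0 < ω := hp.omega_pos hk₀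
  have hcI := cosT_mem_Ico hk₀
  rw [← hc] at hcI
  have hd := hp.deriv_neg _ hcI
  have hvel := hp.two_abs_vel hk₀
  rw [← hc, ← hω] at hvel
  have hv0 : 0 < 2 * |vel α k₀| := by
    have : vel α k₀ ≠ 0 := fun h => hk₁ (hp.eq_half_of_vel_eq_zero hk₀ h)
    positivity
  have hc2 : c ^ 2 < 1 := by
    by_contra hcon
    have : √(1 - c ^ 2) = 0 := Real.sqrt_eq_zero_of_nonpos (by linarith)
    rw [hvel, this] at hv0
    simp at hv0
  -- The square of `ε - iω` is `η ε - ω²`, so the denominator of the resolvent is `p (cos 2πk) - p c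
  -- + η ε`. For small `ε` the imaginary part of `η` dominates, as the comparison lemma requires.
  set η : ℝ → ℂ := fun ε => (ε : ℂ) ^ 2 - 2 * Complex.I * ε * ω with hη
  have hηre : ∀ ε, (η ε).re = ε ^ 2 := fun ε => by
    simp [hη, pow_two]
  have hηim : ∀ ε, (η ε).im = -(2 * ε * ω) := fun ε => by
    simp [hη, pow_two]
  have hηlim : Tendsto η (𝓝[>] 0) (𝓝 0) := by
    have h : Continuous η := by simp only [hη]; fun_prop
    have h0 := h.tendsto 0
    have : η 0 = 0 := by simp [hη]
    rw [this] at h0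
    exact h0.mono_left nhdsWithin_le_nhds
  have hsmall : ∀ᶠ ε : ℝ in 𝓝[>] 0, 0 < ε ∧ |(η ε).re| ≤ |(η ε).im| := by
    filter_upwards [self_mem_nhdsWithin, nhdsWithin_le_nhds (gt_mem_nhds hω0)] with ε h1 h2
    have h1' : 0 < ε := h1
    refine ⟨h1, ?_⟩
    rw [hηre, hηim, abs_neg, abs_of_pos (by positivity), abs_of_pos (by positivity)]
    nlinarith
  -- the integrands
  set X : UnitAddCircle → ℝ := fun k => p (cosT k) - p c with hX
  set Y : UnitAddCircle → ℝ := fun k => deriv p c * (cosT k - c) with hY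
  have hXc : Continuous X := hp.continuous_comp_cosT.sub continuous_const
  have hYc : Continuous Y := continuous_const.mul (continuous_cosT.sub continuous_const)
  have hint : ∀ (Z : UnitAddCircle → ℝ), Continuous Z → ∀ ε : ℝ, 0 < ε →
      Integrable fun k => ((Z k : ℂ) + η ε)⁻¹ := fun Z hZ ε hε => by
    have hcont : Continuous fun k => (Z k : ℂ) + η ε := by fun_prop
    refine (hcont.inv₀ fun k h => ?_).integrable_of_hasCompactSupport
      (HasCompactSupport.of_compactSpace _)
    have := congrArg Complex.im h
    simp only [Complex.add_im, Complex.ofReal_im, hηim, zero_add, Complex.zero_im] at this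
    nlinarith [mul_pos hε hω0]
  obtain ⟨C, hC⟩ := hp.diff_bound hcI.2
  have hlim1 : Tendsto (fun ε => ∫ k, (((X k : ℂ) + η ε)⁻¹ - ((Y k : ℂ) + η ε)⁻¹)) (𝓝[>] 0)
      (𝓝 (regularPart p c : ℂ)) := by
    have e : (regularPart p c : ℂ) = ∫ k, ((X k : ℂ)⁻¹ - (Y k : ℂ)⁻¹) := by
      rw [regularPart, ← integral_complex_ofReal]
      congr 1
      ext k
      simp [hX, hY]
    rw [e]
    refine tendsto_integral_filter_of_dominated_convergence (fun _ => C) ?_ ?_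
      (integrable_const _) ?_
    · filter_upwards [hsmall] with ε hε
      exact ((hint X hXc ε hε.1).sub (hint Y hYc ε hε.1)).aestronglyMeasurable
    · filter_upwards [hsmall] with ε hε
      exact Eventually.of_forall fun k => hC c ⟨hcI.1, le_rfl⟩ _ (cosT_mem k) _ hε.2
    · filter_upwards [ae_cosT_ne k₀] with k hk
      have hX0 : (X k : ℂ) ≠ 0 := by
        exact_mod_cast hp.p_ne hcI (cosT_mem k) hk.2
      have hY0 : (Y k : ℂ) ≠ 0 := by
        exact_mod_cast mul_ne_zero hd.ne (sub_ne_zero.2 hk.2)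
      have h1 : ∀ x : ℂ, x ≠ 0 → Tendsto (fun ε => (x + η ε)⁻¹) (𝓝[>] 0) (𝓝 x⁻¹) := fun x hx => by
        have := (hηlim.const_add x).inv₀ (by simpa using hx)
        simpa using this
      exact (h1 _ hX0).sub (h1 _ hY0)
  have hdC : ((deriv p c : ℝ) : ℂ) ≠ 0 := by exact_mod_cast hd.ne
  -- The linearised denominator is `-p'(c)(ζ - cos 2πk)`. Since `p'(c) < 0`, approaching from `ε >
  -- 0` puts `ζ` in the lower half-plane.
  set ζ : ℝ → ℂ := fun ε => (c : ℂ) - η ε / ((deriv p c : ℝ) : ℂ) with hζ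
  have hζlim : Tendsto ζ (𝓝[>] 0) (𝓝 c) := by
    have := (hηlim.div_const ((deriv p c : ℝ) : ℂ)).const_sub (c : ℂ)
    simpa using this
  have hζim : ∀ ε : ℝ, 0 < ε → (ζ ε).im < 0 := fun ε hε => by
    simp only [hζ, Complex.sub_im, Complex.ofReal_im, Complex.div_ofReal_im, hηim, zero_sub]
    rw [neg_div, neg_neg]
    exact div_neg_of_pos_of_neg (by positivity) hd
  have hlim2 := tendsto_integral_resolvent_cosT hc2 hζlim
    (hsmall.mono fun ε hε => hζim ε hε.1)
  have hYint : ∀ ε, ∫ k, ((Y k : ℂ) + η ε)⁻¹ =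
      -((deriv p c : ℝ) : ℂ)⁻¹ * ∫ k : UnitAddCircle, (ζ ε - cosT k)⁻¹ := fun ε => by
    rw [← integral_const_mul]
    congr 1
    ext k
    rw [← inv_neg, ← mul_inv]
    congr 1
    simp only [hY, hζ]
    push_cast
    field_simp
    ring
  have hz : Tendsto (fun ε : ℝ => (ε : ℂ) - Complex.I * ω) (𝓝[>] 0) (𝓝 (-(Complex.I * ω))) := by
    have h : Continuous fun ε : ℝ => (ε : ℂ) - Complex.I * ω := by fun_prop
    have h0 := h.tendsto 0
    simp only [Complex.ofReal_zero, zero_sub] at h0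
    exact h0.mono_left nhdsWithin_le_nhds
  have hfin := hz.mul (hlim1.add (hlim2.const_mul (-((deriv p c : ℝ) : ℂ)⁻¹)))
  have hval : -(Complex.I * ω) * ((regularPart p c : ℂ) +
      -((deriv p c : ℝ) : ℂ)⁻¹ * (Complex.I / (√(1 - c ^ 2) : ℂ))) =
      ((2 * |vel α k₀|)⁻¹ : ℝ) - Complex.I * (ω * regularPart p c : ℝ) := by
    rw [hvel]
    have hs0 : (√(1 - c ^ 2) : ℂ) ≠ 0 := by
      exact_mod_cast (Real.sqrt_pos.2 (by linarith)).ne'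
    have hωC : (ω : ℂ) ≠ 0 := by exact_mod_cast hω0.ne'
    have hI := Complex.I_sq
    push_cast
    field_simp
    linear_combination hI
  rw [hval] at hfin
  refine hfin.congr' ?_
  filter_upwards [hsmall] with ε hε
  have hzre : 0 < ((ε : ℂ) - Complex.I * ω).re := by simpa using hε.1
  have hXY : Integrable fun k => ((X k : ℂ) + η ε)⁻¹ - ((Y k : ℂ) + η ε)⁻¹ :=
    (hint X hXc ε hε.1).sub (hint Y hYc ε hε.1)
  rw [JTilde_eq hp hzre, ← hYint, ← integral_add hXY (hint Y hYc ε hε.1), ← integral_const_mul]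
  refine integral_congr_ae ?_
  filter_upwards [ae_cosT_ne k₀] with k hk
  have e1 : (omega α (rep k) : ℂ) ^ 2 = (p (cosT k) : ℂ) := by
    rw [hp.omega_sq, ← Complex.ofReal_pow, Real.sq_sqrt (hp.pos _ (cosT_mem_Ico hk.1)).le]
  have e2 : (ω : ℂ) ^ 2 = (p c : ℂ) := by
    rw [hω, hp.omega_sq, ← Complex.ofReal_pow, Real.sq_sqrt (hp.pos _ hcI).le]
  rw [sub_add_cancel, div_eq_mul_inv]
  congr 2
  rw [e1]
  simp only [hX, hη]
  push_cast
  have hI := Complex.I_sq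
  linear_combination e2 - (ω : ℂ) ^ 2 * hI

/-- The phase of the transmission amplitude. -/
def phase (α : ℤ → ℝ) (p : ℝ → ℝ) (k : UnitAddCircle) : ℝ :=
  omega α (rep k) * regularPart p (cosT k)

/-- Clearing the pole `1/(2|v|)` of the limit of `J̃` leaves a denominator with real part at least
`γ₁`. At zero velocity the formula yields the prescribed value `1`, so no case distinction is left.
-/
lemma wp_eq (hp : IsProfile α p) {γ₁ : ℝ} (hγ : 0 < γ₁) {k : UnitAddCircle} (hk : k ≠ 0) :
    wp α γ₁ k = γ₁ / ((γ₁ + 2 * |vel α k| : ℝ) -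
      (2 * |vel α k| * γ₁ * phase α p k : ℝ) * Complex.I) := by
  have hγC : (γ₁ : ℂ) ≠ 0 := by exact_mod_cast hγ.ne'
  by_cases hv : vel α k = 0
  · rw [wp, if_pos hv, hv]
    simp [hγC]
  · have hk1 : k ≠ half := fun h => hv (h ▸ hp.vel_half)
    have hb0 : 0 < 2 * |vel α k| := by positivity
    rw [wp, if_neg hv]
    set b := 2 * |vel α k| with hb
    set ψ := phase α p k with hψ
    have hlim := hp.tendsto_JTilde hk hk1
    rw [← hb] at hlim
    have hre : (1 + (γ₁ : ℂ) * ((b⁻¹ : ℝ) - Complex.I * (ψ : ℝ))).re = 1 + γ₁ * b⁻¹ := by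
      simp
    have hne : 1 + (γ₁ : ℂ) * ((b⁻¹ : ℝ) - Complex.I * (ψ : ℝ)) ≠ 0 := fun h => by
      rw [h] at hre
      have : 0 < 1 + γ₁ * b⁻¹ := by positivity
      rw [← hre] at this
      simp at this
    have hnu : nu α γ₁ k = (1 + (γ₁ : ℂ) * ((b⁻¹ : ℝ) - Complex.I * (ψ : ℝ)))⁻¹ := by
      refine Tendsto.limUnder_eq ?_
      exact ((hlim.const_mul (γ₁ : ℂ)).const_add 1).inv₀ hne
    rw [hnu]
    have hbC : (b : ℂ) ≠ 0 := by exact_mod_cast hb0.ne'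
    have e : ((γ₁ + b : ℝ) : ℂ) - (b * γ₁ * ψ : ℝ) * Complex.I =
        b * (1 + (γ₁ : ℂ) * ((b⁻¹ : ℝ) - Complex.I * (ψ : ℝ))) := by
      push_cast
      field_simp
      ring
    rw [e]
    field_simp

lemma denom_ne (hγ : 0 < (γ₁ : ℝ)) (b ψ : ℝ) (hb : 0 ≤ b) :
    ((γ₁ + b : ℝ) : ℂ) - (b * γ₁ * ψ : ℝ) * Complex.I ≠ 0 := fun h => by
  have := congrArg Complex.re h
  rw [Complex.sub_re, Complex.re_ofReal_mul, Complex.ofReal_re] at this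
  simp at this
  linarith

lemma continuousAt_wp (hp : IsProfile α p) {γ₁ : ℝ} (hγ : 0 < γ₁) {k : UnitAddCircle}
    (hk : k ≠ 0) : ContinuousAt (wp α γ₁) k := by
  have h : (fun k => γ₁ / ((γ₁ + 2 * |vel α k| : ℝ) -
      (2 * |vel α k| * γ₁ * phase α p k : ℝ) * Complex.I)) =ᶠ[𝓝 k] wp α γ₁ := by
    filter_upwards [isOpen_ne.mem_nhds hk] with k' hk'
    exact (hp.wp_eq hγ hk').symm
  refine ContinuousAt.congr ?_ h
  have h1 := (hp.continuousAt_vel hk).abs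
  have h2 : ContinuousAt (phase α p) k :=
    (hp.continuousAt_omega k).mul (hp.continuousAt_regularPart hk)
  have h3 : ContinuousAt (fun k => 2 * |vel α k|) k := h1.const_mul 2
  have h4 : ContinuousAt (fun k => 2 * |vel α k| * γ₁ * phase α p k) k :=
    (h3.mul_const γ₁).mul h2
  refine continuousAt_const.div ((Complex.continuous_ofReal.continuousAt.comp
    (h3.const_add γ₁)).sub ((Complex.continuous_ofReal.continuousAt.comp h4).mul_const _)) ?_
  exact denom_ne hγ _ _ (by positivity)

lemma continuousAt_pPlus (hp : IsProfile α p) {γ₁ : ℝ} (hγ : 0 < γ₁) {k : UnitAddCircle}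
    (hk : k ≠ 0) : ContinuousAt (pPlus α γ₁) k :=
  ((continuousAt_const.sub (hp.continuousAt_wp hγ hk)).norm).pow 2

lemma continuousAt_pMinus (hp : IsProfile α p) {γ₁ : ℝ} (hγ : 0 < γ₁) {k : UnitAddCircle}
    (hk : k ≠ 0) : ContinuousAt (pMinus α γ₁) k :=
  ((hp.continuousAt_wp hγ hk).norm).pow 2

lemma wp_neg (hp : IsProfile α p) {γ₁ : ℝ} (hγ : 0 < γ₁) (k : UnitAddCircle) :
    wp α γ₁ (-k) = wp α γ₁ k := by
  by_cases hk : k = 0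
  · rw [hk, neg_zero]
  · have hω : omega α (rep (-k)) = omega α (rep k) := by
      rw [comp_rep_neg (periodic_omega hp), omega_neg hp]
    rw [hp.wp_eq hγ hk, hp.wp_eq hγ (neg_ne_zero.2 hk), hp.vel_neg, abs_neg, phase, phase,
      cosT_neg, hω]

lemma pPlus_neg (hp : IsProfile α p) {γ₁ : ℝ} (hγ : 0 < γ₁) (k : UnitAddCircle) :
    pPlus α γ₁ (-k) = pPlus α γ₁ k := by rw [pPlus, hp.wp_neg hγ, pPlus]

lemma pMinus_neg (hp : IsProfile α p) {γ₁ : ℝ} (hγ : 0 < γ₁) (k : UnitAddCircle) :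
    pMinus α γ₁ (-k) = pMinus α γ₁ k := by rw [pMinus, hp.wp_neg hγ, pMinus]

lemma pPlus_half (hp : IsProfile α p) (γ₁ : ℝ) : pPlus α γ₁ half = 0 := by
  rw [pPlus, wp, if_pos hp.vel_half]; simp

lemma pMinus_half (hp : IsProfile α p) (γ₁ : ℝ) : pMinus α γ₁ half = 1 := by
  rw [pMinus, wp, if_pos hp.vel_half]; simp

/-- With `b = 2|v|` and `X` the real coefficient of `-i` in the denominator of `wp_eq`, the two
probabilities add up to `(γ₁² + b² + X²) / ((γ₁ + b)² + X²)`; what is missing from `1` is the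
absorption by the thermostat. At `k = 0` the convention `℘ = 1` is used. -/
lemma pPlus_add_pMinus_le (hp : IsProfile α p) {γ₁ : ℝ} (hγ : 0 < γ₁) (k : UnitAddCircle) :
    pPlus α γ₁ k + pMinus α γ₁ k ≤ 1 := by
  by_cases hk : k = 0
  · rw [pPlus, pMinus, wp, if_pos (hk ▸ hp.vel_zero)]; simp
  · rw [pPlus, pMinus, hp.wp_eq hγ hk]
    have hb : 0 ≤ 2 * |vel α k| := by positivity
    set b := 2 * |vel α k|
    set ψ := phase α p k
    have hD := denom_ne hγ b ψ hb
    have e1 : 1 - (γ₁ : ℂ) / (((γ₁ + b : ℝ) : ℂ) - (b * γ₁ * ψ : ℝ) * Complex.I) =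
        ((b : ℂ) - (b * γ₁ * ψ : ℝ) * Complex.I) /
          (((γ₁ + b : ℝ) : ℂ) - (b * γ₁ * ψ : ℝ) * Complex.I) := by
      rw [eq_div_iff hD, sub_mul, div_mul_cancel₀ _ hD]
      push_cast; ring
    have e2 : ∀ x y : ℝ, ‖(x : ℂ) - (y : ℂ) * Complex.I‖ ^ 2 = x ^ 2 + y ^ 2 := fun x y => by
      rw [← Complex.normSq_eq_norm_sq, Complex.normSq_apply]
      simp; ring
    rw [e1, norm_div, norm_div, div_pow, div_pow, ← add_div, e2, e2, Complex.norm_real,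
      Real.norm_eq_abs, sq_abs, div_le_one (by positivity)]
    nlinarith [mul_nonneg hγ.le hb]

end IsProfile
end
end KineticInterface

namespace KineticInterface
noncomputable section

set_option linter.unusedSectionVars false

/-! ### The mild equation on the half-line

By the symmetry `(y, k) ↦ (-y, -k)` the two half-lines are folded onto `y ≥ 0`. -/

/-- The total scattering rate `2γ₀R(k)`. -/
def rate (γ₀ : ℝ) (k : UnitAddCircle) : ℝ := 2 * γ₀ * totalKernel k

lemma rate_nonneg {γ₀ : ℝ} (hγ : 0 < γ₀) (k : UnitAddCircle) : 0 ≤ rate γ₀ k :=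
  mul_nonneg (by positivity) (totalKernel_nonneg k)

lemma rate_neg (γ₀ : ℝ) (k : UnitAddCircle) : rate γ₀ (-k) = rate γ₀ k := by
  rw [rate, totalKernel_neg, rate]

lemma rate_le {γ₀ : ℝ} (hγ : 0 < γ₀) (k : UnitAddCircle) : rate γ₀ k ≤ 32 * γ₀ := by
  have := totalKernel_le k
  rw [rate]; nlinarith

lemma continuous_rate (γ₀ : ℝ) : Continuous (rate γ₀) := continuous_const.mul continuous_totalKernel

variable {V : Type*} [NormedAddCommGroup V] [NormedSpace ℝ V]

/-- The data of a half-line transport problem with velocity `v` and boundary operator `ρ`. -/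
structure IsHalfLine (v : UnitAddCircle → ℝ) (ρ : UnitAddCircle → V →L[ℝ] V) : Prop where
  v_cont : ∀ k, k ≠ 0 → ContinuousAt v k
  v_neg : ∀ k, v (-k) = -v k
  ρ_cont : ∀ k, k ≠ 0 → ContinuousAt ρ k
  ρ_le : ∀ k x, ‖ρ k x‖ ≤ ‖x‖
  stationary : ∀ k, k ≠ 0 → v k = 0 → -k = k ∧ ∀ x, ρ k x = x

/-- Continuation of a function on the half-line beyond the boundary, so that the outgoing values
are produced by the boundary condition. -/
def reflectExt (ρ : UnitAddCircle → V →L[ℝ] V) (A : ℝ → UnitAddCircle → V) (x : ℝ)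
    (k : UnitAddCircle) : V :=
  open Classical in if 0 ≤ x then A x k else ρ k (A (-x) (-k))

/-- Joint continuity away from `k = 0`, and boundedness by `M`. -/
structure IsAdm (M : ℝ) (A : ℝ → ℝ → UnitAddCircle → V) : Prop where
  cont : ∀ t y k, k ≠ 0 →
    ContinuousAt (fun q : ℝ × ℝ × UnitAddCircle => A q.1 q.2.1 q.2.2) (t, y, k)
  bdd : ∀ t y k, k ≠ 0 → ‖A t y k‖ ≤ M

lemma norm_reflectExt_le {v : UnitAddCircle → ℝ} {ρ : UnitAddCircle → V →L[ℝ] V}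
    (h : IsHalfLine v ρ) {A : ℝ → UnitAddCircle → V} {k : UnitAddCircle} {M : ℝ}
    (hA : ∀ y, ‖A y k‖ ≤ M) (hA' : ∀ y, ‖A y (-k)‖ ≤ M) (x : ℝ) :
    ‖reflectExt ρ A x k‖ ≤ M := by
  rw [reflectExt]
  split_ifs
  · exact hA _
  · exact (h.ρ_le _ _).trans (hA' _)

/-- A jump is possible only where the argument passes through `0`. It is absent if the boundary
condition holds there, and irrelevant if the argument stays nonnegative nearby; these are the
alternatives of `hcond`. -/
lemma continuousAt_reflectExt {E : Type*} [TopologicalSpace E] {v : UnitAddCircle → ℝ}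
    {ρ : UnitAddCircle → V →L[ℝ] V} (h : IsHalfLine v ρ) {g : ℝ → ℝ → UnitAddCircle → V}
    (hg : ∀ t y k, k ≠ 0 →
      ContinuousAt (fun q : ℝ × ℝ × UnitAddCircle => g q.1 q.2.1 q.2.2) (t, y, k))
    {s x : E → ℝ} {κ : E → UnitAddCircle} {e : E} (hs : ContinuousAt s e) (hx : ContinuousAt x e)
    (hκ : ContinuousAt κ e) (hκ0 : κ e ≠ 0)
    (hcond : x e ≠ 0 ∨ g (s e) 0 (κ e) = ρ (κ e) (g (s e) 0 (-κ e)) ∨ ∀ᶠ e' in 𝓝 e, 0 ≤ x e') :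
    ContinuousAt (fun e => reflectExt ρ (g (s e)) (x e) (κ e)) e := by
  have f1 : ContinuousAt (fun e => g (s e) (x e) (κ e)) e :=
    ContinuousAt.comp (f := fun e => (s e, x e, κ e)) (hg (s e) (x e) (κ e) hκ0)
      (hs.prodMk (hx.prodMk hκ))
  have f2' : ContinuousAt (fun e => g (s e) (-x e) (-κ e)) e :=
    ContinuousAt.comp (f := fun e => (s e, -x e, -κ e)) (hg (s e) (-x e) (-κ e) (neg_ne_zero.2 hκ0))
      (hs.prodMk (hx.neg.prodMk hκ.neg))
  have f2 : ContinuousAt (fun e => ρ (κ e) (g (s e) (-x e) (-κ e))) e :=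
    (ContinuousAt.comp (f := κ) (g := ρ) (h.ρ_cont _ hκ0) hκ).clm_apply f2'
  rcases lt_trichotomy (x e) 0 with h0 | h0 | h0
  · refine f2.congr ?_
    filter_upwards [hx.eventually (gt_mem_nhds h0)] with e' he'
    rw [reflectExt, if_neg (not_le.2 he')]
  · rcases hcond with hc | hc | hc
    · exact absurd h0 hc
    · rw [ContinuousAt]
      have e1 : reflectExt ρ (g (s e)) (x e) (κ e) = g (s e) (x e) (κ e) := by
        rw [reflectExt, if_pos h0.ge]
      have e2 : ρ (κ e) (g (s e) (-x e) (-κ e)) = g (s e) (x e) (κ e) := by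
        rw [h0, neg_zero, hc]
      simp only [e1]
      rw [ContinuousAt, e2] at f2
      exact f1.tendsto.if' f2
    · refine f1.congr ?_
      filter_upwards [hc] with e' he'
      rw [reflectExt, if_pos he']
  · refine f1.congr ?_
    filter_upwards [hx.eventually (lt_mem_nhds h0)] with e' he'
    rw [reflectExt, if_pos he'.le]

/-- Free transport of the initial datum. -/
def freePart (v : UnitAddCircle → ℝ) (ρ : UnitAddCircle → V →L[ℝ] V) (γ₀ : ℝ)
    (A₀ : ℝ → UnitAddCircle → V) (t y : ℝ) (k : UnitAddCircle) : V :=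
  Real.exp (-(rate γ₀ k * max t 0)) • reflectExt ρ A₀ (max y 0 - v k * max t 0) k

/-- The Duhamel integral. -/
def duhamelPart (v : UnitAddCircle → ℝ) (ρ : UnitAddCircle → V →L[ℝ] V) (γ₀ : ℝ)
    (g : ℝ → ℝ → UnitAddCircle → V) (t y : ℝ) (k : UnitAddCircle) : V :=
  ∫ s in (0 : ℝ)..max t 0, Real.exp (-(rate γ₀ k * (max t 0 - s))) •
    reflectExt ρ (g s) (max y 0 - v k * (max t 0 - s)) k

/-- The gain term of the collision operator. -/
def gain (γ₀ : ℝ) (A : ℝ → ℝ → UnitAddCircle → V) (t y : ℝ) (k : UnitAddCircle) : V :=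
  (2 * γ₀) • ∫ k' : UnitAddCircle, scatKernel k k' • A t y k'

lemma ae_ne_zero_torus : ∀ᵐ k : UnitAddCircle, k ≠ 0 := by
  filter_upwards [ae_cosT_ne 0] with k hk using hk.1

lemma aestronglyMeasurable_of_continuousAt_ne_zero {f : UnitAddCircle → V}
    (hf : ∀ k, k ≠ 0 → ContinuousAt f k) : AEStronglyMeasurable f volume := by
  have h : ContinuousOn f {0}ᶜ := fun k hk => (hf k hk).continuousWithinAt
  have h2 := h.aestronglyMeasurable (μ := volume) (measurableSet_singleton 0).compl
  have h3 : (volume : Measure UnitAddCircle).restrict {0}ᶜ = volume := by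
    rw [Measure.restrict_eq_self_of_ae_mem]
    filter_upwards [ae_ne_zero_torus] with k hk using hk
  rwa [h3] at h2

section HalfLine

variable {v : UnitAddCircle → ℝ} {ρ : UnitAddCircle → V →L[ℝ] V} {γ₀ M : ℝ}

lemma IsAdm.section_continuousAt {A : ℝ → ℝ → UnitAddCircle → V} (hA : IsAdm M A) (t y : ℝ)
    {k : UnitAddCircle} (hk : k ≠ 0) : ContinuousAt (A t y) k :=
  ContinuousAt.comp (f := fun k : UnitAddCircle => (t, y, k)) (hA.cont t y k hk) (by fun_prop)

lemma IsAdm.nonneg {A : ℝ → ℝ → UnitAddCircle → V} (hA : IsAdm M A) : 0 ≤ M :=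
  (norm_nonneg _).trans (hA.bdd 0 0 half half_ne_zero)

lemma integrable_kernel_smul {f : UnitAddCircle → V} (hf : ∀ k, k ≠ 0 → ContinuousAt f k)
    (hb : ∀ k, k ≠ 0 → ‖f k‖ ≤ M) (k : UnitAddCircle) :
    Integrable fun k' => scatKernel k k' • f k' := by
  refine (integrable_const (16 * M)).mono' ((continuous_scatKernel_right k).aestronglyMeasurable.smul
    (aestronglyMeasurable_of_continuousAt_ne_zero hf)) ?_
  filter_upwards [ae_ne_zero_torus] with k' hk'
  rw [norm_smul, Real.norm_of_nonneg (scatKernel_nonneg _ _)]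
  exact mul_le_mul (scatKernel_le _ _) (hb k' hk') (norm_nonneg _) (by norm_num)

lemma norm_integral_kernel_smul_le {f : UnitAddCircle → V} (hb : ∀ k, k ≠ 0 → ‖f k‖ ≤ M)
    (k : UnitAddCircle) : ‖∫ k', scatKernel k k' • f k'‖ ≤ totalKernel k * M := by
  rw [totalKernel, ← integral_mul_const]
  refine norm_integral_le_of_norm_le ((integrable_scatKernel k).mul_const M) ?_
  filter_upwards [ae_ne_zero_torus] with k' hk'
  rw [norm_smul, Real.norm_of_nonneg (scatKernel_nonneg _ _)]
  exact mul_le_mul_of_nonneg_left (hb k' hk') (scatKernel_nonneg _ _)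

/-- The bound is stated with the exact loss rate rather than with a constant: gain and loss then
balance, which gives the maximum principle for existence and uniqueness. -/
lemma norm_gain_le (hγ : 0 < γ₀) {A : ℝ → ℝ → UnitAddCircle → V} {t y : ℝ}
    (hb : ∀ k, k ≠ 0 → ‖A t y k‖ ≤ M) (k : UnitAddCircle) : ‖gain γ₀ A t y k‖ ≤ rate γ₀ k * M := by
  rw [gain, norm_smul, Real.norm_of_nonneg (by positivity), rate, mul_assoc (2 * γ₀)]
  exact mul_le_mul_of_nonneg_left (norm_integral_kernel_smul_le hb k) (by positivity)

/-- Integration over `k'` removes the exceptional point: the gain is continuous for all `k`,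
including `k = 0`. -/
lemma continuous_gain {A : ℝ → ℝ → UnitAddCircle → V} (hA : IsAdm M A) :
    Continuous fun q : ℝ × ℝ × UnitAddCircle => gain γ₀ A q.1 q.2.1 q.2.2 := by
  refine Continuous.const_smul ?_ _
  refine continuous_iff_continuousAt.2 fun q₀ => ?_
  refine continuousAt_of_dominated (bound := fun _ => 16 * M) (Eventually.of_forall fun q => ?_)
    (Eventually.of_forall fun q => ?_) (integrable_const _) ?_
  · exact (integrable_kernel_smul (fun k hk => hA.section_continuousAt q.1 q.2.1 hk)
      (fun k hk => hA.bdd _ _ k hk) _).aestronglyMeasurable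
  · filter_upwards [ae_ne_zero_torus] with k' hk'
    rw [norm_smul, Real.norm_of_nonneg (scatKernel_nonneg _ _)]
    exact mul_le_mul (scatKernel_le _ _) (hA.bdd _ _ _ hk') (norm_nonneg _) (by norm_num)
  · filter_upwards [ae_ne_zero_torus] with k' hk'
    have h1 : Continuous fun q : ℝ × ℝ × UnitAddCircle => scatKernel q.2.2 k' := by
      simp only [fun k => scatKernel_comm k k']
      exact (continuous_scatKernel_right k').comp (by fun_prop : Continuous
        fun q : ℝ × ℝ × UnitAddCircle => q.2.2)
    have h2 : ContinuousAt (fun q : ℝ × ℝ × UnitAddCircle => A q.1 q.2.1 k') q₀ :=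
      ContinuousAt.comp (f := fun q : ℝ × ℝ × UnitAddCircle => (q.1, q.2.1, k'))
        (hA.cont q₀.1 q₀.2.1 k' hk') (by fun_prop)
    exact h1.continuousAt.smul h2

lemma continuousAt_freePart (h : IsHalfLine v ρ) {A₀ : ℝ → UnitAddCircle → V}
    (hA₀ : ∀ y k, k ≠ 0 → ContinuousAt (fun q : ℝ × UnitAddCircle => A₀ q.1 q.2) (y, k))
    (hbc : ∀ k, k ≠ 0 → 0 ≤ v k → A₀ 0 k = ρ k (A₀ 0 (-k))) (t y : ℝ) {k : UnitAddCircle}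
    (hk : k ≠ 0) : ContinuousAt
      (fun q : ℝ × ℝ × UnitAddCircle => freePart v ρ γ₀ A₀ q.1 q.2.1 q.2.2) (t, y, k) := by
  have hvc : ContinuousAt (fun q : ℝ × ℝ × UnitAddCircle => v q.2.2) (t, y, k) :=
    ContinuousAt.comp (f := fun q : ℝ × ℝ × UnitAddCircle => q.2.2) (g := v) (h.v_cont k hk)
      (by fun_prop)
  have hx : ContinuousAt (fun q : ℝ × ℝ × UnitAddCircle => max q.2.1 0 - v q.2.2 * max q.1 0)
      (t, y, k) :=
    (by fun_prop : ContinuousAt (fun q : ℝ × ℝ × UnitAddCircle => max q.2.1 0) (t, y, k)).sub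
      (hvc.mul (by fun_prop))
  have hr := (continuous_rate γ₀)
  refine ContinuousAt.smul (f := fun q : ℝ × ℝ × UnitAddCircle =>
    Real.exp (-(rate γ₀ q.2.2 * max q.1 0))) (by fun_prop) ?_
  refine continuousAt_reflectExt h (g := fun _ => A₀) (s := fun _ => 0) (fun t y k hk => ?_)
    continuousAt_const hx (by fun_prop) hk ?_
  · exact ContinuousAt.comp (x := (t, y, k)) (f := fun q : ℝ × ℝ × UnitAddCircle => q.2)
      (g := fun q : ℝ × UnitAddCircle => A₀ q.1 q.2) (hA₀ y k hk) (by fun_prop)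
  -- For outgoing `k` the data satisfy the boundary condition. For incoming `k` the backward
  -- characteristic never leaves the half-line.
  · rcases le_or_gt 0 (v k) with hv | hv
    · exact Or.inr (Or.inl (hbc k hk hv))
    · refine Or.inr (Or.inr ?_)
      filter_upwards [hvc.eventually (gt_mem_nhds hv)] with q hq
      nlinarith [le_max_right q.2.1 0, le_max_right q.1 0]

lemma norm_freePart_le (h : IsHalfLine v ρ) {A₀ : ℝ → UnitAddCircle → V}
    (hb : ∀ y k, k ≠ 0 → ‖A₀ y k‖ ≤ M) (t y : ℝ) {k : UnitAddCircle} (hk : k ≠ 0) :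
    ‖freePart v ρ γ₀ A₀ t y k‖ ≤ Real.exp (-(rate γ₀ k * max t 0)) * M := by
  rw [freePart, norm_smul, Real.norm_of_nonneg (Real.exp_pos _).le]
  exact mul_le_mul_of_nonneg_left (norm_reflectExt_le h (fun y => hb y k hk)
    (fun y => hb y (-k) (neg_ne_zero.2 hk)) _) (Real.exp_pos _).le

lemma stronglyMeasurable_duhamel_integrand {g : ℝ → ℝ → UnitAddCircle → V}
    (hg : Continuous fun q : ℝ × ℝ × UnitAddCircle => g q.1 q.2.1 q.2.2) (t y : ℝ)
    (k : UnitAddCircle) : StronglyMeasurable fun s => Real.exp (-(rate γ₀ k * (t - s))) •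
      reflectExt ρ (g s) (y - v k * (t - s)) k := by
  refine StronglyMeasurable.smul (by fun_prop : Continuous fun s =>
    Real.exp (-(rate γ₀ k * (t - s)))).stronglyMeasurable ?_
  refine StronglyMeasurable.ite ?_ ?_ ?_
  · exact measurableSet_le measurable_const (by fun_prop)
  · exact (hg.comp (by fun_prop : Continuous fun s => (s, y - v k * (t - s), k))).stronglyMeasurable
  · exact ((ρ k).continuous.comp (hg.comp (by fun_prop : Continuous fun s =>
      (s, -(y - v k * (t - s)), -k)))).stronglyMeasurable

/-- The gain does not satisfy the boundary condition, so its reflected extension jumps. The jump is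
met at no more than one time `s` along a moving characteristic, hence dominated convergence absorbs
it. -/
lemma continuousAt_duhamelPart (hγ : 0 < γ₀) (h : IsHalfLine v ρ)
    {g : ℝ → ℝ → UnitAddCircle → V}
    (hg : Continuous fun q : ℝ × ℝ × UnitAddCircle => g q.1 q.2.1 q.2.2)
    (hb : ∀ t y k, ‖g t y k‖ ≤ M) (t y : ℝ) {k : UnitAddCircle} (hk : k ≠ 0) : ContinuousAt
      (fun q : ℝ × ℝ × UnitAddCircle => duhamelPart v ρ γ₀ g q.1 q.2.1 q.2.2) (t, y, k) := by
  have hM : 0 ≤ M := (norm_nonneg _).trans (hb 0 0 0)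
  have e : ∀ q : ℝ × ℝ × UnitAddCircle, duhamelPart v ρ γ₀ g q.1 q.2.1 q.2.2 =
      ∫ s, (Ioc 0 (max q.1 0)).indicator (fun s => Real.exp (-(rate γ₀ q.2.2 * (max q.1 0 - s))) •
        reflectExt ρ (g s) (max q.2.1 0 - v q.2.2 * (max q.1 0 - s)) q.2.2) s := fun q => by
    rw [duhamelPart, intervalIntegral.integral_of_le (le_max_right _ _),
      integral_indicator measurableSet_Ioc]
  simp_rw [e]
  have hvc : ContinuousAt (fun q : ℝ × ℝ × UnitAddCircle => v q.2.2) (t, y, k) :=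
    ContinuousAt.comp (f := fun q : ℝ × ℝ × UnitAddCircle => q.2.2) (g := v) (h.v_cont k hk)
      (by fun_prop)
  have hmt : ContinuousAt (fun q : ℝ × ℝ × UnitAddCircle => max q.1 0) (t, y, k) := by fun_prop
  refine continuousAt_of_dominated
    (bound := (Ioc (0 : ℝ) (max t 0 + 1)).indicator fun _ => M) ?_ ?_ ?_ ?_
  · exact Eventually.of_forall fun q => ((stronglyMeasurable_duhamel_integrand hg _ _ _).indicator
      measurableSet_Ioc).aestronglyMeasurable
  · filter_upwards [hmt.eventually (gt_mem_nhds (lt_add_one (max t 0)))] with q hq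
    refine Eventually.of_forall fun s => ?_
    by_cases hs : s ∈ Ioc 0 (max q.1 0)
    · rw [indicator_of_mem hs, indicator_of_mem (mem_Ioc.2 ⟨hs.1, hs.2.trans hq.le⟩), norm_smul,
        Real.norm_of_nonneg (Real.exp_pos _).le]
      refine (mul_le_of_le_one_left (norm_nonneg _) (Real.exp_le_one_iff.2 ?_)).trans
        (norm_reflectExt_le h (fun y => hb s y _) (fun y => hb s y _) _)
      have := mul_nonneg (rate_nonneg hγ q.2.2) (sub_nonneg.2 hs.2)
      linarith
    · rw [indicator_of_notMem hs, norm_zero]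
      exact indicator_nonneg (fun _ _ => hM) _
  · exact (integrable_indicator_iff measurableSet_Ioc).2 (integrableOn_const (by simp))
  · have hne : ∀ a : ℝ, ∀ᵐ s : ℝ, s ≠ a := fun a => by simp [ae_iff]
    -- The excluded times are the end of integration, where the indicator jumps, and the time at
    -- which the characteristic meets the boundary. For `v k = 0` the second exclusion is an empty
    -- precaution.
    filter_upwards [hne (max t 0), hne (max t 0 - max y 0 / v k)] with s h1 h2
    by_cases hs : s ∈ Ioo 0 (max t 0)
    · have hev : (fun q : ℝ × ℝ × UnitAddCircle => Real.exp (-(rate γ₀ q.2.2 * (max q.1 0 - s))) •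
          reflectExt ρ (g s) (max q.2.1 0 - v q.2.2 * (max q.1 0 - s)) q.2.2) =ᶠ[𝓝 (t, y, k)]
          fun q => (Ioc 0 (max q.1 0)).indicator (fun s =>
            Real.exp (-(rate γ₀ q.2.2 * (max q.1 0 - s))) •
            reflectExt ρ (g s) (max q.2.1 0 - v q.2.2 * (max q.1 0 - s)) q.2.2) s := by
        filter_upwards [hmt.eventually (lt_mem_nhds hs.2)] with q hq
        rw [indicator_of_mem (mem_Ioc.2 ⟨hs.1, hq.le⟩)]
      refine ContinuousAt.congr ?_ hev
      have hr := (continuous_rate γ₀)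
      refine ContinuousAt.smul (f := fun q : ℝ × ℝ × UnitAddCircle =>
        Real.exp (-(rate γ₀ q.2.2 * (max q.1 0 - s)))) (by fun_prop) ?_
      refine continuousAt_reflectExt h (s := fun _ => s) (fun t y k _ => hg.continuousAt)
        continuousAt_const (ContinuousAt.sub (by fun_prop) (hvc.mul (by fun_prop)))
        (by fun_prop) hk ?_
      -- A stationary characteristic may lie on the boundary throughout. Then `-k = k` and `ρ k` is
      -- the identity, so that there is nothing to jump.
      by_cases hv : v k = 0
      · obtain ⟨e1, e2⟩ := h.stationary k hk hv
        exact Or.inr (Or.inl (by simp only [e2, e1]))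
      · left
        intro h0
        apply h2
        have h0' : max y 0 - v k * (max t 0 - s) = 0 := h0
        field_simp
        linarith
    · have hev : (fun _ => (0 : V)) =ᶠ[𝓝 (t, y, k)]
          fun q : ℝ × ℝ × UnitAddCircle => (Ioc 0 (max q.1 0)).indicator (fun s =>
            Real.exp (-(rate γ₀ q.2.2 * (max q.1 0 - s))) •
            reflectExt ρ (g s) (max q.2.1 0 - v q.2.2 * (max q.1 0 - s)) q.2.2) s := by
        by_cases hs0 : 0 < s
        · have hs1 : max t 0 < s :=
            lt_of_le_of_ne (not_lt.1 fun hlt => hs ⟨hs0, hlt⟩) (Ne.symm h1)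
          filter_upwards [hmt.eventually (gt_mem_nhds hs1)] with q hq
          rw [indicator_of_notMem (fun hc => not_lt.2 hc.2 hq)]
        · filter_upwards with q
          rw [indicator_of_notMem (fun hc => hs0 hc.1)]
      exact continuousAt_const.congr hev

lemma norm_duhamelPart_le (h : IsHalfLine v ρ) {g : ℝ → ℝ → UnitAddCircle → V}
    {φ : ℝ → ℝ} (hφ : Continuous φ) {k : UnitAddCircle} (t y : ℝ)
    (hb : ∀ s, 0 ≤ s → s ≤ max t 0 → ∀ y, ‖g s y k‖ ≤ φ s ∧ ‖g s y (-k)‖ ≤ φ s) :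
    ‖duhamelPart v ρ γ₀ g t y k‖ ≤
      ∫ s in (0 : ℝ)..max t 0, Real.exp (-(rate γ₀ k * (max t 0 - s))) * φ s := by
  refine intervalIntegral.norm_integral_le_of_norm_le (le_max_right _ _) ?_
    (Continuous.intervalIntegrable (by fun_prop) _ _)
  refine Eventually.of_forall fun s hs => ?_
  rw [norm_smul, Real.norm_of_nonneg (Real.exp_pos _).le]
  exact mul_le_mul_of_nonneg_left (norm_reflectExt_le h (fun y => (hb s hs.1.le hs.2 y).1)
    (fun y => (hb s hs.1.le hs.2 y).2) _) (Real.exp_pos _).le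

lemma integral_exp_rate (a M t : ℝ) :
    ∫ s in (0 : ℝ)..t, Real.exp (-(a * (t - s))) * (a * M) = (1 - Real.exp (-(a * t))) * M := by
  have hd : ∀ s ∈ uIcc 0 t, HasDerivAt (fun s => Real.exp (-(a * (t - s))) * M)
      (Real.exp (-(a * (t - s))) * (a * M)) s := fun s _ => by
    have h1 : HasDerivAt (fun s => -(a * (t - s))) a s := by
      have := (((hasDerivAt_id s).const_sub t).const_mul a).fun_neg
      exact this.congr_deriv (by ring)
    have := h1.exp.mul_const M
    exact this.congr_deriv (by ring)
  rw [intervalIntegral.integral_eq_sub_of_hasDerivAt hd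
    (Continuous.intervalIntegrable (by fun_prop) _ _)]
  simp; ring

end HalfLine
end
end KineticInterface

namespace KineticInterface
noncomputable section

set_option linter.unusedSectionVars false

/-! ### Picard iteration for the mild equation -/

variable {V : Type*} [NormedAddCommGroup V] [NormedSpace ℝ V]
  {v : UnitAddCircle → ℝ} {ρ : UnitAddCircle → V →L[ℝ] V} {γ₀ M : ℝ}

/-- The map whose fixed points solve the mild equation. -/
def mildMap (v : UnitAddCircle → ℝ) (ρ : UnitAddCircle → V →L[ℝ] V) (γ₀ : ℝ)
    (A₀ : ℝ → UnitAddCircle → V) (A : ℝ → ℝ → UnitAddCircle → V) (t y : ℝ)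
    (k : UnitAddCircle) : V :=
  freePart v ρ γ₀ A₀ t y k + duhamelPart v ρ γ₀ (gain γ₀ A) t y k

/-- The Picard iterates of the mild equation. -/
def picard (v : UnitAddCircle → ℝ) (ρ : UnitAddCircle → V →L[ℝ] V) (γ₀ : ℝ)
    (A₀ : ℝ → UnitAddCircle → V) : ℕ → ℝ → ℝ → UnitAddCircle → V
  | 0 => 0
  | n + 1 => mildMap v ρ γ₀ A₀ (picard v ρ γ₀ A₀ n)

/-- Admissible initial data on the half-line. -/
structure IsAdmData (M : ℝ) (v : UnitAddCircle → ℝ) (ρ : UnitAddCircle → V →L[ℝ] V)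
    (A₀ : ℝ → UnitAddCircle → V) : Prop where
  cont : ∀ y k, k ≠ 0 → ContinuousAt (fun q : ℝ × UnitAddCircle => A₀ q.1 q.2) (y, k)
  bdd : ∀ y k, k ≠ 0 → ‖A₀ y k‖ ≤ M
  boundary : ∀ k, k ≠ 0 → 0 ≤ v k → A₀ 0 k = ρ k (A₀ 0 (-k))

lemma norm_gain_le_const (hγ : 0 < γ₀) {A : ℝ → ℝ → UnitAddCircle → V} (hA : IsAdm M A) (t y : ℝ)
    (k : UnitAddCircle) : ‖gain γ₀ A t y k‖ ≤ 32 * γ₀ * M :=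
  (norm_gain_le hγ (fun k hk => hA.bdd t y k hk) k).trans
    (mul_le_mul_of_nonneg_right (rate_le hγ k) hA.nonneg)

/-- With `a` the rate, the free part contributes `exp (-at) M` and the Duhamel part `(1 - exp (-at))
M`. The same `M` therefore survives for all times. -/
lemma IsAdm.mildMap (hγ : 0 < γ₀) (h : IsHalfLine v ρ) {A₀ : ℝ → UnitAddCircle → V}
    (hA₀ : IsAdmData M v ρ A₀) {A : ℝ → ℝ → UnitAddCircle → V} (hA : IsAdm M A) :
    IsAdm M (mildMap v ρ γ₀ A₀ A) := by
  refine ⟨fun t y k hk => ?_, fun t y k hk => ?_⟩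
  · exact (continuousAt_freePart h hA₀.cont hA₀.boundary t y hk).add
      (continuousAt_duhamelPart hγ h (continuous_gain hA) (norm_gain_le_const hγ hA) t y hk)
  · have h1 := norm_freePart_le (γ₀ := γ₀) h hA₀.bdd t y hk
    have h2 := norm_duhamelPart_le (γ₀ := γ₀) (g := gain γ₀ A) (φ := fun _ => rate γ₀ k * M)
      h continuous_const (k := k) t y (fun s _ _ y =>
        ⟨norm_gain_le hγ (fun k hk => hA.bdd s y k hk) k, by
          rw [← rate_neg]; exact norm_gain_le hγ (fun k hk => hA.bdd s y k hk) (-k)⟩)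
    rw [integral_exp_rate] at h2
    refine (norm_add_le _ _).trans ?_
    linarith

lemma isAdm_picard (hγ : 0 < γ₀) (h : IsHalfLine v ρ) {A₀ : ℝ → UnitAddCircle → V}
    (hA₀ : IsAdmData M v ρ A₀) (n : ℕ) : IsAdm M (picard v ρ γ₀ A₀ n) := by
  induction n with
  | zero =>
    refine ⟨fun t y k _ => continuousAt_const, fun t y k hk => ?_⟩
    have := (norm_nonneg _).trans (hA₀.bdd 0 half half_ne_zero)
    simpa [picard] using this
  | succ n ih => exact ih.mildMap hγ h hA₀

lemma reflectExt_sub (A B : ℝ → UnitAddCircle → V) (x : ℝ) (k : UnitAddCircle) :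
    reflectExt ρ A x k - reflectExt ρ B x k = reflectExt ρ (fun x k => A x k - B x k) x k := by
  simp only [reflectExt]
  split_ifs
  · rfl
  · rw [map_sub]

lemma intervalIntegrable_duhamel (h : IsHalfLine v ρ)
    {g : ℝ → ℝ → UnitAddCircle → V}
    (hg : Continuous fun q : ℝ × ℝ × UnitAddCircle => g q.1 q.2.1 q.2.2)
    (hb : ∀ t y k, ‖g t y k‖ ≤ M) (t y : ℝ) (k : UnitAddCircle) (a b : ℝ) :
    IntervalIntegrable (fun s => Real.exp (-(rate γ₀ k * (t - s))) •
      reflectExt ρ (g s) (y - v k * (t - s)) k) volume a b := by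
  have hM : 0 ≤ M := (norm_nonneg _).trans (hb 0 0 0)
  have hφ : IntervalIntegrable (fun s => Real.exp (-(rate γ₀ k * (t - s))) * M) volume a b :=
    Continuous.intervalIntegrable (by fun_prop) _ _
  refine hφ.mono_fun' (stronglyMeasurable_duhamel_integrand hg _ _ _).aestronglyMeasurable ?_
  refine Eventually.of_forall fun s => ?_
  simp only []
  rw [norm_smul, Real.norm_of_nonneg (Real.exp_pos _).le]
  exact mul_le_mul_of_nonneg_left (norm_reflectExt_le h (fun y => hb s y _) (fun y => hb s y _) _)
    (Real.exp_pos _).le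

lemma duhamelPart_sub (h : IsHalfLine v ρ) {g₁ g₂ : ℝ → ℝ → UnitAddCircle → V}
    (hg₁ : Continuous fun q : ℝ × ℝ × UnitAddCircle => g₁ q.1 q.2.1 q.2.2)
    (hg₂ : Continuous fun q : ℝ × ℝ × UnitAddCircle => g₂ q.1 q.2.1 q.2.2)
    (hb₁ : ∀ t y k, ‖g₁ t y k‖ ≤ M) (hb₂ : ∀ t y k, ‖g₂ t y k‖ ≤ M) (t y : ℝ)
    (k : UnitAddCircle) : duhamelPart v ρ γ₀ g₁ t y k - duhamelPart v ρ γ₀ g₂ t y k =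
      duhamelPart v ρ γ₀ (fun s y k => g₁ s y k - g₂ s y k) t y k := by
  rw [duhamelPart, duhamelPart, duhamelPart, ← intervalIntegral.integral_sub
    (intervalIntegrable_duhamel h hg₁ hb₁ _ _ _ _ _)
    (intervalIntegrable_duhamel h hg₂ hb₂ _ _ _ _ _)]
  congr 1
  ext s
  rw [← smul_sub, reflectExt_sub]

lemma gain_sub {A B : ℝ → ℝ → UnitAddCircle → V} (hA : IsAdm M A) (hB : IsAdm M B) (t y : ℝ)
    (k : UnitAddCircle) : gain γ₀ A t y k - gain γ₀ B t y k =
      gain γ₀ (fun t y k => A t y k - B t y k) t y k := by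
  rw [gain, gain, gain, ← smul_sub, ← integral_sub
    (integrable_kernel_smul (fun k hk => hA.section_continuousAt t y hk)
      (fun k hk => hA.bdd t y k hk) k)
    (integrable_kernel_smul (fun k hk => hB.section_continuousAt t y hk)
      (fun k hk => hB.bdd t y k hk) k)]
  simp_rw [smul_sub]

/-- The exponent `64γ₀` is twice the largest rate, so integration against the weight gains a factor
`1/2`. -/
lemma integral_exp_weight_le (hγ : 0 < γ₀) (k : UnitAddCircle) {c t : ℝ} (hc : 0 ≤ c)
    (ht : 0 ≤ t) :
    ∫ s in (0 : ℝ)..t, Real.exp (-(rate γ₀ k * (t - s))) *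
      (rate γ₀ k * (c * Real.exp (64 * γ₀ * s))) ≤ c / 2 * Real.exp (64 * γ₀ * t) := by
  have hr := rate_nonneg hγ k
  have hr2 := rate_le hγ k
  calc ∫ s in (0 : ℝ)..t, Real.exp (-(rate γ₀ k * (t - s))) *
        (rate γ₀ k * (c * Real.exp (64 * γ₀ * s)))
      ≤ ∫ s in (0 : ℝ)..t, (c / 2) * (64 * γ₀ * Real.exp (64 * γ₀ * s)) := by
        refine intervalIntegral.integral_mono_on ht (Continuous.intervalIntegrable (by fun_prop) _ _)
          (Continuous.intervalIntegrable (by fun_prop) _ _) fun s hs => ?_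
        have h1 : Real.exp (-(rate γ₀ k * (t - s))) ≤ 1 := Real.exp_le_one_iff.2 (by
          have := mul_nonneg hr (sub_nonneg.2 hs.2)
          linarith)
        have h2 : 0 ≤ c * Real.exp (64 * γ₀ * s) := by positivity
        calc _ ≤ 1 * (rate γ₀ k * (c * Real.exp (64 * γ₀ * s))) :=
              mul_le_mul_of_nonneg_right h1 (by positivity)
          _ ≤ 32 * γ₀ * (c * Real.exp (64 * γ₀ * s)) := by
              rw [one_mul]; exact mul_le_mul_of_nonneg_right hr2 h2
          _ = _ := by ring
    _ = c / 2 * (Real.exp (64 * γ₀ * t) - Real.exp (64 * γ₀ * 0)) := by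
        rw [intervalIntegral.integral_const_mul, intervalIntegral.integral_eq_sub_of_hasDerivAt
          (f := fun s => Real.exp (64 * γ₀ * s)) (fun s _ => ?_)
          (Continuous.intervalIntegrable (by fun_prop) _ _)]
        have := ((hasDerivAt_id s).const_mul (64 * γ₀)).exp
        exact this.congr_deriv (by simp; ring)
    _ ≤ _ := by
        have := Real.exp_pos (64 * γ₀ * 0)
        nlinarith

lemma mildMap_lipschitz (hγ : 0 < γ₀) (h : IsHalfLine v ρ) (A₀ : ℝ → UnitAddCircle → V)
    {A B : ℝ → ℝ → UnitAddCircle → V} (hA : IsAdm M A) (hB : IsAdm M B) {c : ℝ} (hc : 0 ≤ c)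
    (hAB : ∀ t y k, k ≠ 0 → ‖A t y k - B t y k‖ ≤ c * Real.exp (64 * γ₀ * max t 0)) (t y : ℝ)
    (k : UnitAddCircle) : ‖mildMap v ρ γ₀ A₀ A t y k - mildMap v ρ γ₀ A₀ B t y k‖ ≤
      c / 2 * Real.exp (64 * γ₀ * max t 0) := by
  rw [mildMap, mildMap, add_sub_add_left_eq_sub, duhamelPart_sub h (continuous_gain hA)
    (continuous_gain hB) (norm_gain_le_const hγ hA) (norm_gain_le_const hγ hB)]
  simp_rw [gain_sub hA hB]
  refine (norm_duhamelPart_le (φ := fun s => rate γ₀ k * (c * Real.exp (64 * γ₀ * s))) h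
    (by fun_prop) t y fun s hs0 _ y => ?_).trans
    (integral_exp_weight_le hγ k hc (le_max_right _ _))
  have hb : ∀ k : UnitAddCircle, k ≠ 0 → ‖A s y k - B s y k‖ ≤ c * Real.exp (64 * γ₀ * s) :=
    fun k hk => by simpa [max_eq_left hs0] using hAB s y k hk
  refine ⟨norm_gain_le (A := fun t y k => A t y k - B t y k) hγ hb k, ?_⟩
  rw [← rate_neg]
  exact norm_gain_le (A := fun t y k => A t y k - B t y k) hγ hb (-k)

lemma picard_succ_sub_le (hγ : 0 < γ₀) (h : IsHalfLine v ρ) {A₀ : ℝ → UnitAddCircle → V}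
    (hA₀ : IsAdmData M v ρ A₀) (n : ℕ) (t y : ℝ) {k : UnitAddCircle} (hk : k ≠ 0) :
    ‖picard v ρ γ₀ A₀ (n + 1) t y k - picard v ρ γ₀ A₀ n t y k‖ ≤
      M * (1 / 2) ^ n * Real.exp (64 * γ₀ * max t 0) := by
  have hM : 0 ≤ M := (isAdm_picard hγ h hA₀ 0).nonneg
  induction n generalizing t y k with
  | zero =>
    have h1 := (isAdm_picard hγ h hA₀ 1).bdd t y k hk
    have h2 : (1 : ℝ) ≤ Real.exp (64 * γ₀ * max t 0) :=
      Real.one_le_exp (mul_nonneg (by positivity) (le_max_right _ _))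
    simp only [picard, Pi.zero_apply, sub_zero, pow_zero, mul_one] at h1 ⊢
    nlinarith
  | succ n ih =>
    have := mildMap_lipschitz hγ h A₀ (isAdm_picard hγ h hA₀ (n + 1)) (isAdm_picard hγ h hA₀ n)
      (c := M * (1 / 2) ^ n) (by positivity) (fun t y k hk => ih t y hk) t y k
    refine this.trans (le_of_eq ?_)
    rw [pow_succ]; ring

/-- The mild solution. -/
def mildSolution (v : UnitAddCircle → ℝ) (ρ : UnitAddCircle → V →L[ℝ] V) (γ₀ : ℝ)
    (A₀ : ℝ → UnitAddCircle → V) (t y : ℝ) (k : UnitAddCircle) : V :=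
  limUnder atTop fun n => picard v ρ γ₀ A₀ n t y k

lemma tendsto_picard [CompleteSpace V] (hγ : 0 < γ₀) (h : IsHalfLine v ρ)
    {A₀ : ℝ → UnitAddCircle → V} (hA₀ : IsAdmData M v ρ A₀) (t y : ℝ) {k : UnitAddCircle}
    (hk : k ≠ 0) : Tendsto (fun n => picard v ρ γ₀ A₀ n t y k) atTop
      (𝓝 (mildSolution v ρ γ₀ A₀ t y k)) := by
  have hc : CauchySeq fun n => picard v ρ γ₀ A₀ n t y k := by
    refine cauchySeq_of_le_geometric (1 / 2) (M * Real.exp (64 * γ₀ * max t 0)) (by norm_num)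
      fun n => ?_
    rw [dist_comm, dist_eq_norm]
    exact (picard_succ_sub_le hγ h hA₀ n t y hk).trans (le_of_eq (by ring))
  exact tendsto_nhds_limUnder (cauchySeq_tendsto_of_complete hc)

lemma norm_picard_sub_mildSolution_le [CompleteSpace V] (hγ : 0 < γ₀) (h : IsHalfLine v ρ)
    {A₀ : ℝ → UnitAddCircle → V} (hA₀ : IsAdmData M v ρ A₀) (n : ℕ) (t y : ℝ) {k : UnitAddCircle}
    (hk : k ≠ 0) : ‖picard v ρ γ₀ A₀ n t y k - mildSolution v ρ γ₀ A₀ t y k‖ ≤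
      2 * M * (1 / 2) ^ n * Real.exp (64 * γ₀ * max t 0) := by
  have := dist_le_of_le_geometric_of_tendsto (1 / 2) (M * Real.exp (64 * γ₀ * max t 0))
    (by norm_num) (f := fun n => picard v ρ γ₀ A₀ n t y k) (fun n => ?_)
    (tendsto_picard hγ h hA₀ t y hk) n
  · rw [dist_eq_norm] at this
    refine this.trans (le_of_eq ?_)
    field_simp
    ring
  · rw [dist_comm, dist_eq_norm]
    exact (picard_succ_sub_le hγ h hA₀ n t y hk).trans (le_of_eq (by ring))

/-- Picard convergence is uniform on bounded time intervals and in all `y` and `k ≠ 0`, hence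
continuity passes to the limit. -/
lemma isAdm_mildSolution [CompleteSpace V] (hγ : 0 < γ₀) (h : IsHalfLine v ρ)
    {A₀ : ℝ → UnitAddCircle → V} (hA₀ : IsAdmData M v ρ A₀) :
    IsAdm M (mildSolution v ρ γ₀ A₀) := by
  have hM : 0 ≤ M := (isAdm_picard hγ h hA₀ 0).nonneg
  refine ⟨fun t y k hk => ?_, fun t y k hk => ?_⟩
  · refine continuousAt_of_locally_uniform_approx_of_continuousAt fun u hu => ?_
    obtain ⟨ε, hε, hεu⟩ := Metric.mem_uniformity_dist.1 hu
    set c := 2 * M * Real.exp (64 * γ₀ * (max t 0 + 1)) with hc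
    have hlim : Tendsto (fun n : ℕ => c * (1 / 2) ^ n) atTop (𝓝 0) := by
      have := (tendsto_pow_atTop_nhds_zero_of_lt_one (by norm_num : (0 : ℝ) ≤ 1 / 2)
        (by norm_num)).const_mul c
      simpa using this
    obtain ⟨n, hn⟩ := (hlim.eventually (gt_mem_nhds hε)).exists
    have hmt : ContinuousAt (fun q : ℝ × ℝ × UnitAddCircle => max q.1 0) (t, y, k) := by fun_prop
    have hk' : ∀ᶠ q : ℝ × ℝ × UnitAddCircle in 𝓝 (t, y, k), q.2.2 ≠ 0 :=
      (by fun_prop : ContinuousAt (fun q : ℝ × ℝ × UnitAddCircle => q.2.2)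
        (t, y, k)).eventually (isOpen_ne.mem_nhds hk)
    refine ⟨_, (hmt.eventually (gt_mem_nhds (lt_add_one (max t 0)))).and hk',
      fun q => picard v ρ γ₀ A₀ n q.1 q.2.1 q.2.2, (isAdm_picard hγ h hA₀ n).cont t y k hk,
      fun q hq => hεu ?_⟩
    rw [dist_comm, dist_eq_norm]
    refine (norm_picard_sub_mildSolution_le hγ h hA₀ n q.1 q.2.1 hq.2).trans_lt (lt_of_le_of_lt ?_ hn)
    have h1 : Real.exp (64 * γ₀ * max q.1 0) ≤ Real.exp (64 * γ₀ * (max t 0 + 1)) :=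
      Real.exp_le_exp.2 (mul_le_mul_of_nonneg_left hq.1.le (by positivity))
    calc 2 * M * (1 / 2) ^ n * Real.exp (64 * γ₀ * max q.1 0)
        ≤ 2 * M * (1 / 2) ^ n * Real.exp (64 * γ₀ * (max t 0 + 1)) :=
          mul_le_mul_of_nonneg_left h1 (by positivity)
      _ = c * (1 / 2) ^ n := by rw [hc]; ring
  · exact le_of_tendsto (tendsto_picard hγ h hA₀ t y hk).norm
      (Eventually.of_forall fun n => (isAdm_picard hγ h hA₀ n).bdd t y k hk)

lemma mildSolution_eq [CompleteSpace V] (hγ : 0 < γ₀) (h : IsHalfLine v ρ)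
    {A₀ : ℝ → UnitAddCircle → V} (hA₀ : IsAdmData M v ρ A₀) (t y : ℝ) {k : UnitAddCircle}
    (hk : k ≠ 0) :
    mildSolution v ρ γ₀ A₀ t y k = mildMap v ρ γ₀ A₀ (mildSolution v ρ γ₀ A₀) t y k := by
  have hM : 0 ≤ M := (isAdm_picard hγ h hA₀ 0).nonneg
  refine tendsto_nhds_unique ((tendsto_picard hγ h hA₀ t y hk).comp (tendsto_add_atTop_nat 1)) ?_
  rw [tendsto_iff_norm_sub_tendsto_zero]
  refine squeeze_zero (fun _ => norm_nonneg _) (fun n => mildMap_lipschitz hγ h A₀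
    (isAdm_picard hγ h hA₀ n) (isAdm_mildSolution hγ h hA₀) (c := 2 * M * (1 / 2) ^ n)
    (by positivity) (fun t y k hk => norm_picard_sub_mildSolution_le hγ h hA₀ n t y hk) t y k) ?_
  have := (tendsto_pow_atTop_nhds_zero_of_lt_one (by norm_num : (0 : ℝ) ≤ 1 / 2)
    (by norm_num)).const_mul (M * Real.exp (64 * γ₀ * max t 0))
  rw [mul_zero] at this
  exact this.congr fun n => by ring

/-- The image of the mild map satisfies the boundary condition. -/
lemma mildMap_boundary (hγ : 0 < γ₀) (h : IsHalfLine v ρ) {A₀ : ℝ → UnitAddCircle → V}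
    (hA₀ : IsAdmData M v ρ A₀) {A : ℝ → ℝ → UnitAddCircle → V} (hA : IsAdm M A) (t : ℝ) {k : UnitAddCircle}
    (hk : k ≠ 0) (hv : 0 ≤ v k) [CompleteSpace V] :
    mildMap v ρ γ₀ A₀ A t 0 k = ρ k (mildMap v ρ γ₀ A₀ A t 0 (-k)) := by
  have hin : ∀ (B : ℝ → UnitAddCircle → V), ∀ τ, 0 ≤ τ →
      reflectExt ρ B (max 0 0 - v (-k) * τ) (-k) = B (v k * τ) (-k) := fun B τ hτ => by
    have : 0 ≤ v k * τ := mul_nonneg hv hτ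
    rw [h.v_neg, max_self, zero_sub, neg_mul, neg_neg, reflectExt, if_pos this]
  have hout : ∀ (B : ℝ → UnitAddCircle → V), ∀ τ, 0 ≤ τ →
      (v k * τ = 0 → B 0 k = ρ k (B 0 (-k))) →
      reflectExt ρ B (max 0 0 - v k * τ) k = ρ k (B (v k * τ) (-k)) := fun B τ hτ hB => by
    have h0 : 0 ≤ v k * τ := mul_nonneg hv hτ
    rw [max_self, zero_sub]
    rcases h0.eq_or_lt with h1 | h1
    · rw [← h1, neg_zero, reflectExt, if_pos le_rfl, hB h1.symm]
    · rw [reflectExt, if_neg (by linarith), neg_neg]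
  have ht := le_max_right t 0
  rw [mildMap, mildMap, map_add]
  congr 1
  · rw [freePart, freePart, hin _ _ ht, hout _ _ ht (fun _ => hA₀.boundary k hk hv), rate_neg,
      map_smul]
  · rw [duhamelPart, duhamelPart, ← ContinuousLinearMap.intervalIntegral_comp_comm _
      (intervalIntegrable_duhamel h (continuous_gain hA) (norm_gain_le_const hγ hA) _ _ _ _ _)]
    refine intervalIntegral.integral_congr_ae ?_
    have hne : ∀ᵐ s : ℝ, s ≠ max t 0 := by simp [ae_iff]
    filter_upwards [hne] with s hs1 hs
    rw [uIoc_of_le ht] at hs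
    have hτ : 0 < max t 0 - s := sub_pos.2 (lt_of_le_of_ne hs.2 hs1)
    rw [hin _ _ hτ.le, hout _ _ hτ.le (fun h0 => ?_), rate_neg, map_smul]
    -- The gain itself need not satisfy the boundary condition; it is asked for only when the
    -- characteristic stays at the boundary, and there the condition is void.
    have hv0 : v k = 0 := (mul_eq_zero.1 h0).resolve_right hτ.ne'
    obtain ⟨e1, e2⟩ := h.stationary k hk hv0
    rw [e2, e1]

end
end KineticInterface

namespace KineticInterface
noncomputable section

set_option linter.unusedSectionVars false

/-! ### Differentiation along characteristics -/

variable {V : Type*} [NormedAddCommGroup V] [NormedSpace ℝ V]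
  {v : UnitAddCircle → ℝ} {ρ : UnitAddCircle → V →L[ℝ] V} {γ₀ M : ℝ}

/-- Along a characteristic `y - v k * t` is constant. After an exponential has been pulled out, the
integrand no longer depends on the upper limit, and the fundamental theorem of calculus applies. -/
lemma mildMap_characteristic {A₀ : ℝ → UnitAddCircle → V} {A : ℝ → ℝ → UnitAddCircle → V}
    {t y σ : ℝ} {k : UnitAddCircle} (ht : 0 ≤ t + σ) (hy : 0 ≤ y + v k * σ) :
    mildMap v ρ γ₀ A₀ A (t + σ) (y + v k * σ) k = Real.exp (-(rate γ₀ k * (t + σ))) •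
      (reflectExt ρ A₀ (y - v k * t) k + ∫ s in (0 : ℝ)..(t + σ), Real.exp (rate γ₀ k * s) •
        reflectExt ρ (gain γ₀ A s) (y - v k * t + v k * s) k) := by
  rw [mildMap, freePart, duhamelPart, max_eq_left ht, max_eq_left hy, smul_add]
  congr 1
  · congr 2; ring
  · rw [← intervalIntegral.integral_smul]
    congr 1
    ext s
    rw [smul_smul, ← Real.exp_add]
    congr 2
    · ring_nf
    · ring

lemma hasDerivAt_mildMap_characteristic [CompleteSpace V] (hγ : 0 < γ₀) (h : IsHalfLine v ρ)
    {A₀ : ℝ → UnitAddCircle → V} {A : ℝ → ℝ → UnitAddCircle → V} (hA : IsAdm M A) {t y : ℝ}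
    {k : UnitAddCircle} (ht : 0 < t) (hy : 0 < y) (hk : k ≠ 0) :
    HasDerivAt (fun σ => mildMap v ρ γ₀ A₀ A (t + σ) (y + v k * σ) k)
      (-(rate γ₀ k • mildMap v ρ γ₀ A₀ A t y k) + gain γ₀ A t y k) 0 := by
  set H : ℝ → V := fun s => Real.exp (rate γ₀ k * s) •
    reflectExt ρ (gain γ₀ A s) (y - v k * t + v k * s) k with hH
  set E₀ := reflectExt ρ A₀ (y - v k * t) k
  have hev : (fun σ => Real.exp (-(rate γ₀ k * (t + σ))) • (E₀ + ∫ s in (0 : ℝ)..(t + σ), H s))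
      =ᶠ[𝓝 0] fun σ => mildMap v ρ γ₀ A₀ A (t + σ) (y + v k * σ) k := by
    have h1 : ContinuousAt (fun σ : ℝ => t + σ) 0 := by fun_prop
    have h2 : ContinuousAt (fun σ : ℝ => y + v k * σ) 0 := by fun_prop
    filter_upwards [h1.eventually (lt_mem_nhds (by simpa using ht : (0 : ℝ) < t + 0)),
      h2.eventually (lt_mem_nhds (by simpa using hy : (0 : ℝ) < y + v k * 0))] with σ hσ1 hσ2
    exact (mildMap_characteristic hσ1.le hσ2.le).symm
  have hval := mildMap_characteristic (v := v) (ρ := ρ) (γ₀ := γ₀) (A₀ := A₀) (A := A) (t := t)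
    (y := y) (σ := 0) (k := k) (by simpa using ht.le) (by simpa using hy.le)
  rw [add_zero, mul_zero, add_zero] at hval
  have hHs : ∀ s, H s = Real.exp (rate γ₀ k * t) • (Real.exp (-(rate γ₀ k * (t - s))) •
      reflectExt ρ (gain γ₀ A s) (y - v k * (t - s)) k) := fun s => by
    rw [smul_smul, ← Real.exp_add, hH]
    simp only
    congr 2
    · ring_nf
    · ring
  have hHm : StronglyMeasurable H := by
    simp only [funext hHs]
    exact (stronglyMeasurable_duhamel_integrand (continuous_gain hA) t y k).const_smul _
  have hHi : IntervalIntegrable H volume 0 t := by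
    simp only [funext hHs]
    exact (intervalIntegrable_duhamel h (continuous_gain hA) (norm_gain_le_const hγ hA) t y k
      0 t).smul _
  -- At `s = t` the argument of the extension is `y > 0`, away from its possible jump.
  have hHc : ContinuousAt H t := by
    refine ContinuousAt.smul (f := fun s => Real.exp (rate γ₀ k * s)) (by fun_prop) ?_
    refine continuousAt_reflectExt h (g := gain γ₀ A) (s := fun s => s)
      (fun t y k _ => (continuous_gain hA).continuousAt) continuousAt_id (by fun_prop)
      continuousAt_const hk (Or.inl ?_)
    rw [sub_add_cancel]; exact hy.ne'
  have hHt : H t = Real.exp (rate γ₀ k * t) • gain γ₀ A t y k := by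
    rw [hH]
    simp only
    rw [sub_add_cancel, reflectExt, if_pos hy.le]
  have hI : HasDerivAt (fun u => ∫ s in (0 : ℝ)..u, H s) (H t) t :=
    intervalIntegral.integral_hasDerivAt_right hHi hHm.stronglyMeasurableAtFilter hHc
  have hI' : HasDerivAt (fun σ => E₀ + ∫ s in (0 : ℝ)..(t + σ), H s) (H t) 0 := by
    refine HasDerivAt.const_add _ ?_
    have h0 : HasDerivAt (fun u => ∫ s in (0 : ℝ)..u, H s) (H t) (t + 0) := by rwa [add_zero]
    exact HasDerivAt.comp_const_add t 0 h0
  have hexp : HasDerivAt (fun σ => Real.exp (-(rate γ₀ k * (t + σ))))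
      (-(rate γ₀ k) * Real.exp (-(rate γ₀ k * t))) 0 := by
    have := ((((hasDerivAt_id (0 : ℝ)).const_add t).const_mul (rate γ₀ k)).fun_neg).exp
    exact this.congr_deriv (by simp; ring)
  refine HasDerivAt.congr_of_eventuallyEq ?_ hev.symm
  refine (hexp.smul hI').congr_deriv ?_
  rw [hHt, hval, add_zero, smul_smul, smul_smul, ← Real.exp_add, neg_add_cancel, Real.exp_zero,
    one_smul, add_comm, neg_mul, neg_smul]

end
end KineticInterface

namespace KineticInterface
noncomputable section

set_option linter.unusedSectionVars false

/-! ### Regularity of the components and the collision operator -/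

section Collision

variable {V : Type*} [NormedAddCommGroup V] [NormedSpace ℝ V] [CompleteSpace V]
  {v : UnitAddCircle → ℝ} {ρ : UnitAddCircle → V →L[ℝ] V} {γ₀ M : ℝ}
  {𝕜 : Type*} [RCLike 𝕜]

lemma continuous_gain_line {A : ℝ → ℝ → UnitAddCircle → V} (hA : IsAdm M A) (t y w : ℝ)
    (k : UnitAddCircle) : Continuous fun σ : ℝ => gain γ₀ A (t + σ) (y + w * σ) k := by
  have c1 : Continuous fun σ : ℝ => (t + σ, y + w * σ, k) := by fun_prop
  have := (continuous_gain (γ₀ := γ₀) hA).comp c1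
  exact this

lemma collision_eq {F : UnitAddCircle → 𝕜} (hF : ∀ k, k ≠ 0 → ContinuousAt F k)
    (hb : ∀ k, k ≠ 0 → ‖F k‖ ≤ M) (γ₀ : ℝ) (k : UnitAddCircle) :
    γ₀ • collision F k = -(rate γ₀ k • F k) + (2 * γ₀) • ∫ k', scatKernel k k' • F k' := by
  rw [collision]
  simp_rw [smul_sub]
  rw [integral_sub (integrable_kernel_smul hF hb k) ((integrable_scatKernel k).smul_const _),
    integral_smul_const, rate, ← totalKernel, smul_smul, smul_sub, smul_smul, mul_comm γ₀ 2]
  abel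

lemma hasDerivAt_component (hγ : 0 < γ₀) (h : IsHalfLine v ρ) {A₀ : ℝ → UnitAddCircle → V}
    (hA₀ : IsAdmData M v ρ A₀) (π : V →L[ℝ] 𝕜) {t y : ℝ} {k : UnitAddCircle} (ht : 0 < t)
    (hy : 0 < y) (hk : k ≠ 0) :
    HasDerivAt (fun σ => π (mildSolution v ρ γ₀ A₀ (t + σ) (y + v k * σ) k))
      (π (-(rate γ₀ k • mildSolution v ρ γ₀ A₀ t y k) + gain γ₀ (mildSolution v ρ γ₀ A₀) t y k))
      0 := by
  have h1 := hasDerivAt_mildMap_characteristic (A₀ := A₀) hγ h (isAdm_mildSolution hγ h hA₀) ht hy hk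
  rw [← mildSolution_eq hγ h hA₀ t y hk] at h1
  simp_rw [← mildSolution_eq hγ h hA₀ _ _ hk] at h1
  exact π.hasFDerivAt.comp_hasDerivAt 0 h1

lemma component_eq_collision (hγ : 0 < γ₀) (h : IsHalfLine v ρ) {A₀ : ℝ → UnitAddCircle → V}
    (hA₀ : IsAdmData M v ρ A₀) (π : V →L[ℝ] 𝕜) (t y : ℝ) (k : UnitAddCircle) :
    π (-(rate γ₀ k • mildSolution v ρ γ₀ A₀ t y k) + gain γ₀ (mildSolution v ρ γ₀ A₀) t y k) =
      γ₀ • collision (fun k' => π (mildSolution v ρ γ₀ A₀ t y k')) k := by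
  have hA := isAdm_mildSolution hγ h hA₀
  have hc := fun k (hk : k ≠ 0) => hA.section_continuousAt t y hk
  have hb := fun k (hk : k ≠ 0) => hA.bdd t y k hk
  rw [collision_eq (F := fun k' => π (mildSolution v ρ γ₀ A₀ t y k')) (M := ‖π‖ * M) (fun k hk => π.continuous.continuousAt.comp (hc k hk))
    (fun k hk => (π.le_opNorm _).trans (mul_le_mul_of_nonneg_left (hb k hk) (norm_nonneg _))),
    map_add, map_neg, map_smul, gain, map_smul,
    ← ContinuousLinearMap.integral_comp_comm _ (integrable_kernel_smul hc hb k)]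
  simp_rw [map_smul]

/-- The derivative formula at the base point holds at every nearby point of the same characteristic
after a translation, and its right-hand side is continuous there. -/
lemma contDiffAt_component (hγ : 0 < γ₀) (h : IsHalfLine v ρ) {A₀ : ℝ → UnitAddCircle → V}
    (hA₀ : IsAdmData M v ρ A₀) (π : V →L[ℝ] 𝕜) {t y : ℝ} {k : UnitAddCircle} (ht : 0 < t)
    (hy : 0 < y) (hk : k ≠ 0) :
    ContDiffAt ℝ 1 (fun σ => π (mildSolution v ρ γ₀ A₀ (t + σ) (y + v k * σ) k)) 0 := by
  set A := mildSolution v ρ γ₀ A₀ with hAdef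
  have hA := isAdm_mildSolution hγ h hA₀
  rw [← hAdef] at hA
  set D : ℝ → 𝕜 := fun σ => π (-(rate γ₀ k • A (t + σ) (y + v k * σ) k) +
    gain γ₀ A (t + σ) (y + v k * σ) k) with hD
  have hU : ∀ᶠ σ in 𝓝 (0 : ℝ), 0 < t + σ ∧ 0 < y + v k * σ := by
    have h1 : ContinuousAt (fun σ : ℝ => t + σ) 0 := by fun_prop
    have h2 : ContinuousAt (fun σ : ℝ => y + v k * σ) 0 := by fun_prop
    exact (h1.eventually (lt_mem_nhds (by simpa using ht : (0 : ℝ) < t + 0))).and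
      (h2.eventually (lt_mem_nhds (by simpa using hy : (0 : ℝ) < y + v k * 0)))
  have hDc : Continuous D := by
    have c1 : Continuous fun σ : ℝ => (t + σ, y + v k * σ, k) := by fun_prop
    have c2 : Continuous fun σ : ℝ => A (t + σ) (y + v k * σ) k :=
      continuous_iff_continuousAt.2 fun σ => ContinuousAt.comp
        (f := fun σ : ℝ => (t + σ, y + v k * σ, k)) (hA.cont _ _ k hk) c1.continuousAt
    have c3 : Continuous fun σ : ℝ => gain γ₀ A (t + σ) (y + v k * σ) k :=
      continuous_gain_line hA t y (v k) k
    exact π.continuous.comp ((c2.const_smul _).neg.add c3)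
  have hder : ∀ σ, 0 < t + σ ∧ 0 < y + v k * σ →
      HasDerivAt (fun σ => π (A (t + σ) (y + v k * σ) k)) (D σ) σ := fun σ hσ => by
    have h1 := hasDerivAt_component hγ h hA₀ π hσ.1 hσ.2 hk
    rw [← hAdef] at h1
    have h2 : HasDerivAt (fun σ' => π (A (t + σ + (σ' - σ)) (y + v k * σ + v k * (σ' - σ)) k))
        (D σ) σ := by
      have h3 : HasDerivAt (fun σ' : ℝ => σ' - σ) 1 σ := (hasDerivAt_id σ).sub_const σ
      have h4 := HasDerivAt.scomp (h := fun σ' : ℝ => σ' - σ) (h' := 1) σ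
        (by rw [sub_self]; exact h1) h3
      rw [one_smul] at h4
      exact h4
    have e : (fun σ' => π (A (t + σ + (σ' - σ)) (y + v k * σ + v k * (σ' - σ)) k)) =
        fun σ => π (A (t + σ) (y + v k * σ) k) := by
      ext σ'
      congr 2 <;> ring
    rwa [e] at h2
  rw [contDiffAt_one_iff]
  refine ⟨fun σ => ContinuousLinearMap.smulRight (1 : ℝ →L[ℝ] ℝ) (D σ), _, hU, ?_, fun σ hσ => ?_⟩
  · exact (by fun_prop : Continuous fun σ =>
      ContinuousLinearMap.smulRight (1 : ℝ →L[ℝ] ℝ) (D σ)).continuousOn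
  · simp only [ContinuousLinearMap.smulRight_one_eq_toSpanSingleton]
    exact (hder σ hσ).hasFDerivAt

end Collision

/-! ### Folding the two half-lines -/

variable {𝕜 : Type*} [RCLike 𝕜] {α : ℤ → ℝ} {p : ℝ → ℝ} {γ₀ γ₁ M : ℝ}

/-- The boundary operator of the folded problem. -/
def bdry (𝕜 : Type*) [RCLike 𝕜] (α : ℤ → ℝ) (γ₁ : ℝ) (k : UnitAddCircle) :
    𝕜 × 𝕜 →L[ℝ] 𝕜 × 𝕜 :=
  pMinus α γ₁ k • ContinuousLinearMap.id ℝ (𝕜 × 𝕜) +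
    pPlus α γ₁ k • (ContinuousLinearEquiv.prodComm ℝ 𝕜 𝕜 : 𝕜 × 𝕜 →L[ℝ] 𝕜 × 𝕜)

lemma bdry_apply (k : UnitAddCircle) (a b : 𝕜) : bdry 𝕜 α γ₁ k (a, b) =
    (pMinus α γ₁ k • a + pPlus α γ₁ k • b, pMinus α γ₁ k • b + pPlus α γ₁ k • a) := by
  simp [bdry]

lemma pPlus_nonneg (k : UnitAddCircle) : 0 ≤ pPlus α γ₁ k := by rw [pPlus]; positivity

lemma pMinus_nonneg (k : UnitAddCircle) : 0 ≤ pMinus α γ₁ k := by rw [pMinus]; positivity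

lemma IsProfile.norm_mix_le (hp : IsProfile α p) (hγ : 0 < γ₁) (k : UnitAddCircle) {a b : 𝕜}
    {C : ℝ} (ha : ‖a‖ ≤ C) (hb : ‖b‖ ≤ C) : ‖pMinus α γ₁ k • a + pPlus α γ₁ k • b‖ ≤ C := by
  have h1 := hp.pPlus_add_pMinus_le hγ k
  have h2 := pPlus_nonneg (α := α) (γ₁ := γ₁) k
  have h3 := pMinus_nonneg (α := α) (γ₁ := γ₁) k
  have hC := (norm_nonneg _).trans ha
  refine (norm_add_le _ _).trans ?_
  rw [norm_smul, norm_smul, Real.norm_of_nonneg h2, Real.norm_of_nonneg h3]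
  nlinarith

/-- Contractivity of `bdry` in the maximum norm of the pair is `p₊ + p₋ ≤ 1`. The limiting value `℘
= 1` at `k = 1/2` makes it the identity exactly where the velocity vanishes. -/
lemma IsProfile.isHalfLine (hp : IsProfile α p) (hγ : 0 < γ₁) :
    IsHalfLine (vel α) (bdry 𝕜 α γ₁) where
  v_cont k hk := hp.continuousAt_vel hk
  v_neg := hp.vel_neg
  ρ_cont k hk := ((hp.continuousAt_pMinus hγ hk).smul continuousAt_const).add
    ((hp.continuousAt_pPlus hγ hk).smul continuousAt_const)
  ρ_le k x := by
    obtain ⟨a, b⟩ := x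
    rw [bdry_apply, Prod.norm_def]
    have ha : ‖a‖ ≤ ‖(a, b)‖ := norm_fst_le (a, b)
    have hb : ‖b‖ ≤ ‖(a, b)‖ := norm_snd_le (a, b)
    exact max_le (hp.norm_mix_le hγ k ha hb) (hp.norm_mix_le hγ k hb ha)
  stationary k hk hv := by
    have := hp.eq_half_of_vel_eq_zero hk hv
    subst this
    refine ⟨neg_half, fun x => ?_⟩
    obtain ⟨a, b⟩ := x
    rw [bdry_apply, hp.pMinus_half, hp.pPlus_half]
    simp

lemma IsProfile.rep_pos_of_vel_nonneg (hp : IsProfile α p) {k : UnitAddCircle} (hk : k ≠ 0)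
    (hv : 0 ≤ vel α k) : 0 < rep k := by
  rcases lt_trichotomy (rep k) 0 with h | h | h
  · exact absurd (hp.vel_neg_of_rep_neg h) (not_lt.2 hv)
  · exact absurd (rep_eq_zero_iff.1 h) hk
  · exact h

lemma IsProfile.vel_nonneg_of_rep_pos (hp : IsProfile α p) {k : UnitAddCircle} (h : 0 < rep k) :
    0 ≤ vel α k := by
  by_cases hk : k = half
  · rw [hk, hp.vel_half]
  · exact (hp.vel_pos h hk).le

lemma ne_zero_of_rep {k : UnitAddCircle} (h : rep k ≠ 0) : k ≠ 0 := fun h' =>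
  h (rep_eq_zero_iff.2 h')

lemma IsProfile.boundary_of_interface (hp : IsProfile α p) (hγ : 0 < γ₁)
    {Fp Fm : UnitAddCircle → 𝕜} (hI : Interface α γ₁ Fp Fm) {k : UnitAddCircle} (hk : k ≠ 0)
    (hv : 0 ≤ vel α k) : (Fp k, Fm (-k)) = bdry 𝕜 α γ₁ k (Fp (-k), Fm (- -k)) := by
  have hr := hp.rep_pos_of_vel_nonneg hk hv
  rw [bdry_apply, neg_neg, Prod.mk.injEq]
  refine ⟨hI.1 k hr, ?_⟩
  -- As `-half = half` has positive representative, the second interface condition says nothing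
  -- there. The identity needed is trivial since `p₋ = 1` and `p₊ = 0`.
  by_cases hh : k = half
  · rw [hh, hp.pMinus_half, hp.pPlus_half, neg_half]
    simp
  · have h2 := hI.2 (-k) (by rw [rep_neg_of_ne_half hh]; linarith)
    rwa [hp.pMinus_neg hγ, hp.pPlus_neg hγ, neg_neg] at h2

lemma IsProfile.interface_of_boundary (hp : IsProfile α p) (hγ : 0 < γ₁)
    {Fp Fm : UnitAddCircle → 𝕜} (hb : ∀ k, k ≠ 0 → 0 ≤ vel α k →
      (Fp k, Fm (-k)) = bdry 𝕜 α γ₁ k (Fp (-k), Fm (- -k))) : Interface α γ₁ Fp Fm := by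
  refine ⟨fun k hk => ?_, fun k hk => ?_⟩
  · have h := hb k (ne_zero_of_rep hk.ne') (hp.vel_nonneg_of_rep_pos hk)
    rw [bdry_apply, Prod.mk.injEq, neg_neg] at h
    exact h.1
  · have h := hb (-k) (neg_ne_zero.2 (ne_zero_of_rep hk.ne))
      (by rw [hp.vel_neg]; linarith [hp.vel_neg_of_rep_neg hk])
    rw [bdry_apply, Prod.mk.injEq, neg_neg, hp.pMinus_neg hγ, hp.pPlus_neg hγ] at h
    exact h.2

lemma continuousAt_clamp {X : Type*} [TopologicalSpace X] {G : ℝ × UnitAddCircle → X}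
    (hG : ContinuousOn G (Ici 0 ×ˢ {0}ᶜ)) (y : ℝ) {k : UnitAddCircle} (hk : k ≠ 0) :
    ContinuousAt (fun q : ℝ × UnitAddCircle => G (max q.1 0, q.2)) (y, k) := by
  have h1 : ContinuousWithinAt G (Ici 0 ×ˢ {0}ᶜ) (max y 0, k) := hG _ (mk_mem_prod (mem_Ici.2 (le_max_right _ _)) hk)
  refine Tendsto.comp (f := fun q : ℝ × UnitAddCircle => (max q.1 0, q.2)) h1
    (tendsto_nhdsWithin_iff.2 ⟨?_, ?_⟩)
  · exact (by fun_prop : Continuous fun q : ℝ × UnitAddCircle => (max q.1 0, q.2)).tendsto (y, k)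
  · filter_upwards [(by fun_prop : ContinuousAt (fun q : ℝ × UnitAddCircle => q.2)
      (y, k)).eventually (isOpen_ne.mem_nhds hk)] with q hq
    exact mk_mem_prod (mem_Ici.2 (le_max_right _ _)) hq

lemma norm_clamp_le {G F : ℝ × UnitAddCircle → 𝕜} (hG : ContinuousOn G (Ici 0 ×ˢ {0}ᶜ))
    (hF : EqOn G F (Ioi 0 ×ˢ {0}ᶜ)) {C : ℝ} (hC : ∀ y k, 0 < y → k ≠ 0 → ‖F (y, k)‖ ≤ C) (y : ℝ)
    {k : UnitAddCircle} (hk : k ≠ 0) : ‖G (max y 0, k)‖ ≤ C := by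
  have hpos : ∀ y, 0 < y → ‖G (y, k)‖ ≤ C := fun y hy => by
    rw [hF (mk_mem_prod (mem_Ioi.2 hy) hk)]; exact hC y k hy hk
  rcases (le_max_right y 0).eq_or_lt with h | h
  · rw [← h]
    have h1 := continuousAt_clamp hG 0 hk
    have h2 : ContinuousAt (fun y : ℝ => G (max y 0, k)) 0 :=
      ContinuousAt.comp (f := fun y : ℝ => (y, k)) h1 (by fun_prop)
    have h3 := (h2.tendsto.mono_left (nhdsWithin_le_nhds (s := Ioi 0))).norm
    rw [max_self] at h3
    refine le_of_tendsto h3 ?_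
    filter_upwards [self_mem_nhdsWithin] with y hy
    rw [max_eq_left (le_of_lt hy)]
    exact hpos y hy
  · exact hpos _ h

/-- Folding of a pair of extensions. -/
def foldPair (Gp Gm : ℝ × UnitAddCircle → 𝕜) (y : ℝ) (k : UnitAddCircle) : 𝕜 × 𝕜 :=
  (Gp (max y 0, k), Gm (-max y 0, -k))

/-- The function on `ℝ × 𝕋` obtained by unfolding. -/
def unfold (A : ℝ → UnitAddCircle → 𝕜 × 𝕜) (x : ℝ × UnitAddCircle) : 𝕜 :=
  open Classical in if 0 ≤ x.1 then (A x.1 x.2).1 else (A (-x.1) (-x.2)).2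

lemma unfold_of_pos (A : ℝ → UnitAddCircle → 𝕜 × 𝕜) {y : ℝ} (hy : 0 < y) (k : UnitAddCircle) :
    unfold A (y, k) = (A y k).1 := if_pos hy.le

lemma unfold_of_neg (A : ℝ → UnitAddCircle → 𝕜 × 𝕜) {y : ℝ} (hy : y < 0) (k : UnitAddCircle) :
    unfold A (y, k) = (A (-y) (-k)).2 := if_neg (not_le.2 hy)

lemma continuousOn_reflect {G : ℝ × UnitAddCircle → 𝕜} (hG : ContinuousOn G (Iic 0 ×ˢ {0}ᶜ)) :
    ContinuousOn (fun q : ℝ × UnitAddCircle => G (-q.1, -q.2)) (Ici 0 ×ˢ {0}ᶜ) := by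
  refine hG.comp (by fun_prop) fun q hq => ⟨?_, ?_⟩
  · simpa using hq.1
  · simpa using hq.2

lemma IsProfile.isAdmData (hp : IsProfile α p) (hγ : 0 < γ₁) {W₀ Gp Gm : ℝ × UnitAddCircle → 𝕜}
    {C : ℝ} (hC : ∀ y : ℝ, ∀ k : UnitAddCircle, y ≠ 0 → k ≠ 0 → ‖W₀ (y, k)‖ ≤ C)
    (hGp : ContinuousOn Gp (Ici 0 ×ˢ {0}ᶜ)) (hGpe : EqOn Gp W₀ (Ioi 0 ×ˢ {0}ᶜ))
    (hGm : ContinuousOn Gm (Iic 0 ×ˢ {0}ᶜ)) (hGme : EqOn Gm W₀ (Iio 0 ×ˢ {0}ᶜ))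
    (hI : Interface α γ₁ (fun k => Gp (0, k)) (fun k => Gm (0, k))) :
    IsAdmData C (vel α) (bdry 𝕜 α γ₁) (foldPair Gp Gm) := by
  have hGm' := continuousOn_reflect hGm
  refine ⟨fun y k hk => ?_, fun y k hk => ?_, fun k hk hv => ?_⟩
  · exact (continuousAt_clamp hGp y hk).prodMk (continuousAt_clamp hGm' y hk)
  · rw [Prod.norm_def]
    refine max_le (norm_clamp_le hGp hGpe (fun y k hy hk => hC y k hy.ne' hk) y hk)
      (norm_clamp_le (F := fun q => W₀ (-q.1, -q.2)) hGm' (fun q hq => ?_)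
        (fun y k hy hk => hC (-y) (-k) (by simpa using hy.ne') (neg_ne_zero.2 hk)) y hk)
    exact hGme ⟨by simpa using hq.1, by simpa using hq.2⟩
  · have := hp.boundary_of_interface hγ hI hk hv
    simpa [foldPair] using this

end
end KineticInterface

namespace KineticInterface
noncomputable section

set_option linter.unusedSectionVars false

/-! ### Existence of classical solutions -/

variable {𝕜 : Type*} [RCLike 𝕜] {α : ℤ → ℝ} {p : ℝ → ℝ} {γ₀ γ₁ M : ℝ}

lemma mildSolution_zero {v : UnitAddCircle → ℝ} {ρ : UnitAddCircle → 𝕜 × 𝕜 →L[ℝ] 𝕜 × 𝕜}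
    (hγ : 0 < γ₀) (h : IsHalfLine v ρ) {A₀ : ℝ → UnitAddCircle → 𝕜 × 𝕜}
    (hA₀ : IsAdmData M v ρ A₀) {y : ℝ} (hy : 0 ≤ y) {k : UnitAddCircle} (hk : k ≠ 0) :
    mildSolution v ρ γ₀ A₀ 0 y k = A₀ y k := by
  rw [mildSolution_eq hγ h hA₀ 0 y hk, mildMap, freePart, duhamelPart]
  simp [reflectExt, hy]

lemma collision_reflect (F : UnitAddCircle → 𝕜) (k : UnitAddCircle) :
    collision (fun k' => F (-k')) (-k) = collision F k := by
  rw [collision, collision]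
  congr 1
  rw [← integral_neg_eq_self]
  simp only [scatKernel_neg_left, scatKernel_neg_right, neg_neg]

/-- The components of the folded mild solution. -/
lemma unfold_eventually_pos (A : ℝ → ℝ → UnitAddCircle → 𝕜 × 𝕜) (t w : ℝ) {y : ℝ} (hy : 0 < y)
    (k : UnitAddCircle) : (fun s : ℝ => unfold (A (t + s)) (y + w * s, k)) =ᶠ[𝓝 0]
      fun s => (A (t + s) (y + w * s) k).1 := by
  have h2 : ContinuousAt (fun σ : ℝ => y + w * σ) 0 := by fun_prop
  filter_upwards [h2.eventually (lt_mem_nhds (by simpa using hy : (0 : ℝ) < y + w * 0))] with σ hσ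
  exact unfold_of_pos _ hσ k

lemma unfold_eventually_neg (A : ℝ → ℝ → UnitAddCircle → 𝕜 × 𝕜) (t w : ℝ) {y : ℝ} (hy : y < 0)
    (k : UnitAddCircle) : (fun s : ℝ => unfold (A (t + s)) (y + w * s, k)) =ᶠ[𝓝 0]
      fun s => (A (t + s) (-y + -w * s) (-k)).2 := by
  have h2 : ContinuousAt (fun σ : ℝ => y + w * σ) 0 := by fun_prop
  filter_upwards [h2.eventually (gt_mem_nhds (by simpa using hy : y + w * 0 < (0 : ℝ)))] with σ hσ
  rw [unfold_of_neg _ hσ k]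
  congr 2
  ring

/-- Unfolding the mild solution solves the problem: the two components are its values for `y > 0`
and `y < 0`, the clamped arguments supply the one-sided extensions, and `mildMap_boundary` gives the
interface conditions at every time. -/
theorem IsProfile.isClassicalSolution (hp : IsProfile α p) (hγ₀ : 0 < γ₀) (hγ₁ : 0 < γ₁)
    {W₀ Gp Gm : ℝ × UnitAddCircle → 𝕜} (hA₀ : IsAdmData M (vel α) (bdry 𝕜 α γ₁) (foldPair Gp Gm))
    (hGpe : EqOn Gp W₀ (Ioi 0 ×ˢ {0}ᶜ)) (hGme : EqOn Gm W₀ (Iio 0 ×ˢ {0}ᶜ)) :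
    IsClassicalSolution α γ₀ γ₁ W₀
      (fun t => unfold (mildSolution (vel α) (bdry 𝕜 α γ₁) γ₀ (foldPair Gp Gm) t)) := by
  have h : IsHalfLine (vel α) (bdry 𝕜 α γ₁) := hp.isHalfLine hγ₁
  set A := mildSolution (vel α) (bdry 𝕜 α γ₁) γ₀ (foldPair Gp Gm) with hAdef
  have hA : IsAdm M A := isAdm_mildSolution hγ₀ h hA₀
  have c1 : ∀ t y k, k ≠ 0 → ContinuousAt
      (fun q : ℝ × ℝ × UnitAddCircle => (A q.1 q.2.1 q.2.2).1) (t, y, k) := fun t y k hk =>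
    (hA.cont t y k hk).fst
  have c2 : ∀ t y k, k ≠ 0 → ContinuousAt
      (fun q : ℝ × ℝ × UnitAddCircle => (A q.1 (-q.2.1) (-q.2.2)).2) (t, y, k) := fun t y k hk =>
    ContinuousAt.comp (x := (t, y, k))
      (f := fun q : ℝ × ℝ × UnitAddCircle => (q.1, -q.2.1, -q.2.2))
      (g := fun q : ℝ × ℝ × UnitAddCircle => (A q.1 q.2.1 q.2.2).2)
      (hA.cont t (-y) (-k) (neg_ne_zero.2 hk)).snd (by fun_prop)
  have hcont : ∀ t y k, y ≠ 0 → k ≠ 0 → ContinuousAt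
      (fun q : ℝ × (ℝ × UnitAddCircle) => unfold (A q.1) q.2) (t, (y, k)) := by
    intro t y k hy hk
    have hcy : ContinuousAt (fun q : ℝ × ℝ × UnitAddCircle => q.2.1) (t, y, k) := by fun_prop
    rcases lt_or_gt_of_ne hy with hy | hy
    · refine (c2 t y k hk).congr ?_
      filter_upwards [hcy.eventually (gt_mem_nhds hy)] with q hq
      exact (unfold_of_neg _ hq _).symm
    · refine (c1 t y k hk).congr ?_
      filter_upwards [hcy.eventually (lt_mem_nhds hy)] with q hq
      exact (unfold_of_pos _ hq _).symm
  have hbd : ∀ t y k, k ≠ 0 → ‖unfold (A t) (y, k)‖ ≤ M := by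
    intro t y k hk
    rw [unfold]
    split_ifs
    · exact (norm_fst_le _).trans (hA.bdd _ _ _ hk)
    · exact (norm_snd_le _).trans (hA.bdd _ _ _ (neg_ne_zero.2 hk))
  have hinit : ∀ y k, y ≠ 0 → k ≠ 0 → unfold (A 0) (y, k) = W₀ (y, k) := by
    intro y k hy hk
    rcases lt_or_gt_of_ne hy with hy | hy
    · rw [unfold_of_neg _ hy, hAdef, mildSolution_zero hγ₀ h hA₀ (by linarith) (neg_ne_zero.2 hk),
        foldPair]
      have e : max (-y) 0 = -y := max_eq_left (by linarith)
      simp only [e, neg_neg]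
      exact hGme (mk_mem_prod (mem_Iio.2 hy) hk)
    · rw [unfold_of_pos _ hy, hAdef, mildSolution_zero hγ₀ h hA₀ hy.le hk, foldPair]
      simp only [max_eq_left hy.le]
      exact hGpe (mk_mem_prod (mem_Ioi.2 hy) hk)
  have hder : ∀ t y k, 0 < t → y ≠ 0 → k ≠ 0 →
      deriv (fun s : ℝ => unfold (A (t + s)) (y + vel α k * s, k)) 0 =
        γ₀ • collision (fun k' => unfold (A t) (y, k')) k := by
    intro t y k ht hy hk
    rcases lt_or_gt_of_ne hy with hy | hy
    · have hk' := neg_ne_zero.2 hk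
      rw [(unfold_eventually_neg A t (vel α k) hy k).deriv_eq, ← hp.vel_neg]
      have h1 := hasDerivAt_component hγ₀ h hA₀ (ContinuousLinearMap.snd ℝ 𝕜 𝕜) ht
        (neg_pos.2 hy) hk'
      rw [component_eq_collision hγ₀ h hA₀] at h1
      refine h1.deriv.trans ?_
      rw [← collision_reflect]
      simp only [unfold_of_neg _ hy, neg_neg]
      rfl
    · rw [(unfold_eventually_pos A t (vel α k) hy k).deriv_eq]
      have h1 := hasDerivAt_component hγ₀ h hA₀ (ContinuousLinearMap.fst ℝ 𝕜 𝕜) ht hy hk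
      rw [component_eq_collision hγ₀ h hA₀] at h1
      refine h1.deriv.trans ?_
      simp only [unfold_of_pos _ hy]
      rfl
  refine ⟨?_, ⟨M, fun t _ y k _ hk => hbd t y k hk⟩, ?_, ?_, ?_,
    fun t ht y k hy hk => hder t y k ht hy hk, hinit, ?_⟩
  · rintro ⟨t, y, k⟩ ⟨-, hy, hk⟩
    exact (hcont t y k hy hk).continuousWithinAt
  · refine ⟨fun q => (A q.1 q.2.1 q.2.2).1, fun q => (A q.1 (-q.2.1) (-q.2.2)).2, ?_, ?_, ?_, ?_, ?_⟩
    · rintro ⟨t, y, k⟩ ⟨-, -, hk⟩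
      exact (c1 t y k hk).continuousWithinAt
    · rintro ⟨t, y, k⟩ ⟨-, hy, -⟩
      exact (unfold_of_pos _ hy _).symm
    · rintro ⟨t, y, k⟩ ⟨-, -, hk⟩
      exact (c2 t y k hk).continuousWithinAt
    · rintro ⟨t, y, k⟩ ⟨-, hy, -⟩
      exact (unfold_of_neg _ hy _).symm
    · intro t _
      refine hp.interface_of_boundary hγ₁ fun k hk hv => ?_
      have hb := mildMap_boundary (γ₀ := γ₀) hγ₀ h hA₀ hA t hk hv
      rw [← mildSolution_eq hγ₀ h hA₀ t 0 hk, ← mildSolution_eq hγ₀ h hA₀ t 0 (neg_ne_zero.2 hk),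
        ← hAdef] at hb
      simp only [neg_zero, neg_neg]
      exact hb
  · intro t ht y k hy hk
    rcases lt_or_gt_of_ne hy with hy | hy
    · have h1 := contDiffAt_component hγ₀ h hA₀ (ContinuousLinearMap.snd ℝ 𝕜 𝕜) ht
        (neg_pos.2 hy) (neg_ne_zero.2 hk)
      refine h1.congr_of_eventuallyEq ?_
      have h2 := unfold_eventually_neg A t (vel α k) hy k
      rw [← hp.vel_neg] at h2
      exact h2
    · exact (contDiffAt_component hγ₀ h hA₀ (ContinuousLinearMap.fst ℝ 𝕜 𝕜) ht
        hy hk).congr_of_eventuallyEq (unfold_eventually_pos A t (vel α k) hy k)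
  · refine ⟨32 * γ₀ * M + 32 * γ₀ * M, fun t ht y k hy hk => ?_⟩
    rw [hder t y k ht hy hk, collision_eq (F := fun k' => unfold (A t) (y, k')) (M := M)
      (fun k hk => ContinuousAt.comp (x := k)
        (f := fun k : UnitAddCircle => (t, (y, k))) (hcont t y k hy hk) (by fun_prop))
      (fun k hk => hbd t y k hk)]
    refine (norm_add_le _ _).trans (add_le_add ?_ ?_)
    · rw [norm_neg, norm_smul, Real.norm_of_nonneg (rate_nonneg hγ₀ k)]
      exact mul_le_mul (rate_le hγ₀ k) (hbd t y k hk) (norm_nonneg _) (by positivity)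
    · have := norm_gain_le (γ₀ := γ₀) (A := fun t y k => unfold (A t) (y, k)) (t := t) (y := y) hγ₀
        (fun k hk => hbd t y k hk) k
      exact this.trans (mul_le_mul_of_nonneg_right (rate_le hγ₀ k) hA.nonneg)
  · intro y k hy hk
    have h1 : ContinuousAt (fun t => unfold (A t) (y, k)) 0 :=
      ContinuousAt.comp (f := fun t : ℝ => (t, (y, k))) (hcont 0 y k hy hk) (by fun_prop)
    have h2 := h1.tendsto.mono_left (nhdsWithin_le_nhds (s := Ioi 0))
    rwa [hinit y k hy hk] at h2

end
end KineticInterface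

namespace KineticInterface
noncomputable section

set_option linter.unusedSectionVars false

/-! ### Uniqueness of classical solutions -/

section Uniqueness

variable {V : Type*} [NormedAddCommGroup V] [NormedSpace ℝ V]
  {v : UnitAddCircle → ℝ} {ρ : UnitAddCircle → V →L[ℝ] V} {γ₀ : ℝ}

/-- Variation of constants as an inequality: relaxation at rate `a` towards values of norm at most
`N` gives a convex combination of the initial norm and `N`. -/
lemma norm_le_of_relaxation {φ : ℝ → V} {a N s₀ t : ℝ} (hst : s₀ < t)
    (hφ : ContinuousOn φ (Icc s₀ t)) (g : ℝ → V)
    (hd : ∀ s ∈ Ioo s₀ t, HasDerivAt φ (-(a • φ s) + g s) s)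
    (hg : ∀ s ∈ Ioo s₀ t, ‖g s‖ ≤ a * N) :
    ‖φ t‖ ≤ Real.exp (-(a * (t - s₀))) * ‖φ s₀‖ + (1 - Real.exp (-(a * (t - s₀)))) * N := by
  -- The equation is available only in the open interval, because `s₀` may be the initial time or
  -- the moment of reflection. The estimate starts at `s₁ > s₀` and continuity lets `s₁` tend to
  -- `s₀`.
  have key : ∀ s₁ ∈ Ioo s₀ t, Real.exp (a * t) * ‖φ t‖ ≤
      Real.exp (a * s₁) * ‖φ s₁‖ + (Real.exp (a * t) - Real.exp (a * s₁)) * N := by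
    intro s₁ hs₁
    have he : ∀ s : ℝ, HasDerivAt (fun s => Real.exp (a * s)) (a * Real.exp (a * s)) s := fun s => by
      have := ((hasDerivAt_id s).const_mul a).exp
      exact this.congr_deriv (by simp; ring)
    have hmain := image_norm_le_of_norm_deriv_right_le_deriv_boundary (a := s₁) (b := t)
      (f := fun s => Real.exp (a * s) • φ s) (f' := fun s => Real.exp (a * s) • g s)
      (B := fun s => Real.exp (a * s₁) * ‖φ s₁‖ + (Real.exp (a * s) - Real.exp (a * s₁)) * N)
      (B' := fun s => a * Real.exp (a * s) * N)
      ?_ ?_ ?_ ?_ ?_ (right_mem_Icc.2 hs₁.2.le)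
    · simpa [norm_smul] using hmain
    · exact (by fun_prop : Continuous fun s => Real.exp (a * s)).continuousOn.smul
        (hφ.mono (Icc_subset_Icc_left hs₁.1.le))
    · intro s hs
      refine (((he s).smul (hd s ⟨hs₁.1.trans_le hs.1, hs.2⟩)).congr_deriv ?_).hasDerivWithinAt
      rw [smul_add, smul_neg, smul_smul, mul_comm (Real.exp (a * s)) a]
      abel
    · simp [norm_smul]
    · intro s
      exact (((he s).sub_const _).mul_const N).const_add _
    · intro s hs
      rw [norm_smul, Real.norm_of_nonneg (Real.exp_pos _).le]
      have := mul_le_mul_of_nonneg_left (hg s ⟨hs₁.1.trans_le hs.1, hs.2⟩) (Real.exp_pos (a * s)).le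
      linarith
  have hlim : Tendsto (fun s₁ => Real.exp (a * s₁) * ‖φ s₁‖ +
      (Real.exp (a * t) - Real.exp (a * s₁)) * N) (𝓝[>] s₀)
      (𝓝 (Real.exp (a * s₀) * ‖φ s₀‖ + (Real.exp (a * t) - Real.exp (a * s₀)) * N)) := by
    have h1 : Tendsto φ (𝓝[>] s₀) (𝓝 (φ s₀)) := by
      have := hφ s₀ (left_mem_Icc.2 hst.le)
      exact this.tendsto.mono_left (by
        rw [nhdsWithin_le_iff]
        exact Icc_mem_nhdsGT hst)
    have h2 : Tendsto (fun s => Real.exp (a * s)) (𝓝[>] s₀) (𝓝 (Real.exp (a * s₀))) :=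
      ((by fun_prop : Continuous fun s => Real.exp (a * s)).tendsto s₀).mono_left
        nhdsWithin_le_nhds
    exact (h2.mul h1.norm).add ((tendsto_const_nhds.sub h2).mul_const N)
  have h := ge_of_tendsto hlim (by
    filter_upwards [Ioo_mem_nhdsGT hst] with s hs using key s hs)
  have e1 : Real.exp (-(a * (t - s₀))) = Real.exp (-(a * t)) * Real.exp (a * s₀) := by
    rw [← Real.exp_add]; congr 1; ring
  have e2 : Real.exp (-(a * t)) * Real.exp (a * t) = 1 := by
    rw [← Real.exp_add]; simp
  have h3 := mul_le_mul_of_nonneg_left h (Real.exp_pos (-(a * t))).le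
  rw [e1]
  calc ‖φ t‖ = Real.exp (-(a * t)) * (Real.exp (a * t) * ‖φ t‖) := by rw [← mul_assoc, e2, one_mul]
    _ ≤ _ := h3
    _ = _ := by linear_combination N * e2

/-- Solutions of the homogeneous half-line problem. -/
structure IsHomogeneous (v : UnitAddCircle → ℝ) (ρ : UnitAddCircle → V →L[ℝ] V) (γ₀ : ℝ)
    (D : ℝ → ℝ → UnitAddCircle → V) : Prop where
  cont : ContinuousOn (fun q : ℝ × ℝ × UnitAddCircle => D q.1 q.2.1 q.2.2)
    (Ici 0 ×ˢ (Ici 0 ×ˢ {0}ᶜ))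
  boundary : ∀ t k, 0 ≤ t → k ≠ 0 → 0 ≤ v k → D t 0 k = ρ k (D t 0 (-k))
  init : ∀ y k, 0 < y → k ≠ 0 → D 0 y k = 0
  deriv : ∀ t y k, 0 < t → 0 < y → k ≠ 0 → HasDerivAt (fun σ => D (t + σ) (y + v k * σ) k)
    (-(rate γ₀ k • D t y k) + gain γ₀ D t y k) 0

lemma IsHomogeneous.segment (hγ : 0 < γ₀) {D : ℝ → ℝ → UnitAddCircle → V}
    (hD : IsHomogeneous v ρ γ₀ D) {T N : ℝ}
    (hN : ∀ t y k, 0 < t → t ≤ T → 0 < y → k ≠ 0 → ‖D t y k‖ ≤ N) {s₀ t y : ℝ}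
    {k : UnitAddCircle} (hs₀ : 0 ≤ s₀) (hst : s₀ < t) (htT : t ≤ T) (hk : k ≠ 0)
    (hy : ∀ s ∈ Ioo s₀ t, 0 < y - v k * (t - s)) (hy0 : 0 ≤ y - v k * (t - s₀)) (hyt : 0 ≤ y) :
    ‖D t y k‖ ≤ Real.exp (-(rate γ₀ k * (t - s₀))) * ‖D s₀ (y - v k * (t - s₀)) k‖ +
      (1 - Real.exp (-(rate γ₀ k * (t - s₀)))) * N := by
  have h := norm_le_of_relaxation (φ := fun s => D s (y - v k * (t - s)) k) (a := rate γ₀ k)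
    (N := N) hst ?_ (fun s => gain γ₀ D s (y - v k * (t - s)) k) ?_ ?_
  · simpa using h
  · refine hD.cont.comp (f := fun s => (s, y - v k * (t - s), k)) (by fun_prop) fun s hs => ?_
    refine ⟨hs₀.trans hs.1, ?_, hk⟩
    rcases hs.1.eq_or_lt with h1 | h1
    · rw [← h1]; exact hy0
    · rcases hs.2.eq_or_lt with h2 | h2
      · rw [h2]; simpa using hyt
      · exact (hy s ⟨h1, h2⟩).le
  · intro s hs
    have h1 := hD.deriv s _ k (hs₀.trans_lt hs.1) (hy s hs) hk
    have h3 : HasDerivAt (fun s' : ℝ => s' - s) 1 s := (hasDerivAt_id s).sub_const s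
    have h4 := HasDerivAt.scomp (h := fun s' : ℝ => s' - s) (h' := 1) s
        (by rw [sub_self]; exact h1) h3
    rw [one_smul] at h4
    refine h4.congr_of_eventuallyEq (Eventually.of_forall fun s' => ?_)
    simp only [Function.comp_apply]
    congr 1 <;> ring
  · intro s hs
    exact norm_gain_le hγ (fun k' hk' => hN s _ k' (hs₀.trans_lt hs.1) (hs.2.le.trans htT)
      (hy s hs) hk') k

lemma IsHomogeneous.init' {D : ℝ → ℝ → UnitAddCircle → V} (hD : IsHomogeneous v ρ γ₀ D) {y : ℝ}
    {k : UnitAddCircle} (hy : 0 ≤ y) (hk : k ≠ 0) : D 0 y k = 0 := by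
  rcases hy.eq_or_lt with rfl | hy
  · have h1 : ContinuousOn (fun y => D 0 y k) (Ici 0) :=
      hD.cont.comp (f := fun y => ((0 : ℝ), y, k)) (by fun_prop)
        fun y hy => ⟨le_refl (0 : ℝ), hy, hk⟩
    have h2 : Tendsto (fun y => D 0 y k) (𝓝[>] 0) (𝓝 (D 0 0 k)) :=
      (h1 0 self_mem_Ici).tendsto.mono_left (nhdsWithin_mono _ Ioi_subset_Ici_self)
    refine tendsto_nhds_unique h2 (tendsto_const_nhds.congr' ?_)
    filter_upwards [self_mem_nhdsWithin] with y hy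
    exact (hD.init y k hy hk).symm
  · exact hD.init y k hy hk

lemma IsHomogeneous.norm_le_of_incoming (hγ : 0 < γ₀) {D : ℝ → ℝ → UnitAddCircle → V}
    (hD : IsHomogeneous v ρ γ₀ D) {T N : ℝ}
    (hN : ∀ t y k, 0 < t → t ≤ T → 0 < y → k ≠ 0 → ‖D t y k‖ ≤ N) {t y : ℝ}
    {k : UnitAddCircle} (ht : 0 < t) (htT : t ≤ T) (hk : k ≠ 0) (hy : 0 ≤ y)
    (hyt : 0 < y - v k * t) : ‖D t y k‖ ≤ (1 - Real.exp (-(rate γ₀ k * t))) * N := by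
  have h := hD.segment hγ hN (s₀ := 0) le_rfl ht htT hk (y := y) (fun s hs => ?_)
    (by rw [sub_zero]; exact hyt.le) hy
  · rwa [sub_zero, hD.init' hyt.le hk, norm_zero, mul_zero, zero_add] at h
  · have h1 := mul_pos (sub_pos.2 hs.2) hyt
    have h2 : 0 ≤ s * y := mul_nonneg hs.1.le hy
    have h3 : 0 < t * (y - v k * (t - s)) := by linarith [h1, h2]
    exact (mul_pos_iff_of_pos_left ht).1 h3

/-- The backward characteristic either reaches time `0`, where the solution vanishes, or meets the
boundary. In the second case the contraction `ρ` passes to `-k`, whose characteristic moves inward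
backwards in time and reaches time `0` without a further reflection. The rates at `k` and `-k`
agree, so the two exponential factors multiply. -/
lemma IsHomogeneous.norm_le (hγ : 0 < γ₀) (h : IsHalfLine v ρ) {D : ℝ → ℝ → UnitAddCircle → V}
    (hD : IsHomogeneous v ρ γ₀ D) {T N : ℝ}
    (hN : ∀ t y k, 0 < t → t ≤ T → 0 < y → k ≠ 0 → ‖D t y k‖ ≤ N) {t y : ℝ}
    {k : UnitAddCircle} (ht : 0 < t) (htT : t ≤ T) (hk : k ≠ 0) (hy : 0 < y) :
    ‖D t y k‖ ≤ (1 - Real.exp (-(rate γ₀ k * t))) * N := by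
  rcases lt_or_ge 0 (y - v k * t) with hyt | hyt
  · exact hD.norm_le_of_incoming hγ hN ht htT hk hy.le hyt
  · have hv : 0 < v k := by
      by_contra hcon
      nlinarith
    set s₀ := t - y / v k with hs₀
    have hys : y = v k * (t - s₀) := by rw [hs₀]; field_simp; ring
    have hs0 : 0 ≤ s₀ := by
      rw [hs₀, sub_nonneg, div_le_iff₀ hv]; linarith
    have hst : s₀ < t := by rw [hs₀]; have := div_pos hy hv; linarith
    have h1 := hD.segment hγ hN hs0 hst htT hk (y := y) (fun s hs => by
      have := mul_pos hv (sub_pos.2 hs.1)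
      linarith) (by rw [← hys, sub_self]) hy.le
    rw [← hys, sub_self] at h1
    have h2 : ‖D s₀ 0 k‖ ≤ (1 - Real.exp (-(rate γ₀ k * s₀))) * N := by
      rcases hs0.eq_or_lt with h0 | h0
      · rw [← h0, hD.init' le_rfl hk]; simp
      · rw [hD.boundary s₀ k hs0 hk hv.le]
        refine (h.ρ_le _ _).trans ?_
        rw [← rate_neg]
        exact hD.norm_le_of_incoming hγ hN h0 (hst.le.trans htT) (neg_ne_zero.2 hk) le_rfl
          (by rw [h.v_neg]; have := mul_pos hv h0; linarith)
    have e : Real.exp (-(rate γ₀ k * (t - s₀))) * Real.exp (-(rate γ₀ k * s₀)) =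
        Real.exp (-(rate γ₀ k * t)) := by rw [← Real.exp_add]; congr 1; ring
    have h3 := mul_le_mul_of_nonneg_left h2 (Real.exp_pos (-(rate γ₀ k * (t - s₀)))).le
    calc ‖D t y k‖ ≤ _ := h1
      _ ≤ Real.exp (-(rate γ₀ k * (t - s₀))) * ((1 - Real.exp (-(rate γ₀ k * s₀))) * N) +
          (1 - Real.exp (-(rate γ₀ k * (t - s₀)))) * N := by linarith
      _ = _ := by rw [← e]; ring

/-- Up to time `t` each application of the previous estimate multiplies a uniform bound by `θ = 1 -
exp (-32γ₀t) < 1`; iteration gives zero. -/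
lemma IsHomogeneous.eq_zero (hγ : 0 < γ₀) (h : IsHalfLine v ρ) {D : ℝ → ℝ → UnitAddCircle → V}
    (hD : IsHomogeneous v ρ γ₀ D) {B : ℝ}
    (hB : ∀ t y k, 0 < t → 0 < y → k ≠ 0 → ‖D t y k‖ ≤ B) {t y : ℝ}
    {k : UnitAddCircle} (ht : 0 < t) (hk : k ≠ 0) (hy : 0 < y) : D t y k = 0 := by
  set θ := 1 - Real.exp (-(32 * γ₀ * t)) with hθ
  have hB0 : 0 ≤ B := (norm_nonneg _).trans (hB t y k ht hy hk)
  have hθ0 : 0 ≤ θ := by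
    rw [hθ, sub_nonneg]
    exact Real.exp_le_one_iff.2 (by have : 0 < 32 * γ₀ * t := by positivity
                                    linarith)
  have hθ1 : θ < 1 := by rw [hθ]; linarith [Real.exp_pos (-(32 * γ₀ * t))]
  have hind : ∀ n : ℕ, ∀ t' y k, 0 < t' → t' ≤ t → 0 < y → k ≠ 0 → ‖D t' y k‖ ≤ θ ^ n * B := by
    intro n
    induction n with
    | zero => intro t' y k ht' _ hy hk; simpa using hB t' y k ht' hy hk
    | succ n ih =>
      intro t' y k ht' htt hy hk
      refine (hD.norm_le hγ h ih ht' htt hk hy).trans ?_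
      have h1 : rate γ₀ k * t' ≤ 32 * γ₀ * t :=
        mul_le_mul (rate_le hγ k) htt ht'.le (by positivity)
      have h2 : Real.exp (-(32 * γ₀ * t)) ≤ Real.exp (-(rate γ₀ k * t')) :=
        Real.exp_le_exp.2 (by linarith)
      have h3 : 1 - Real.exp (-(rate γ₀ k * t')) ≤ θ := by rw [hθ]; linarith
      calc _ ≤ θ * (θ ^ n * B) := mul_le_mul_of_nonneg_right h3 (by positivity)
        _ = θ ^ (n + 1) * B := by ring
  have hlim := (tendsto_pow_atTop_nhds_zero_of_lt_one hθ0 hθ1).mul_const B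
  rw [zero_mul] at hlim
  have := ge_of_tendsto hlim (Eventually.of_forall fun n => hind n t y k ht le_rfl hy hk)
  exact norm_le_zero_iff.1 this

end Uniqueness

variable {𝕜 : Type*} [RCLike 𝕜] {α : ℤ → ℝ} {p : ℝ → ℝ} {γ₀ γ₁ : ℝ}

lemma gain_prod {A B : ℝ → ℝ → UnitAddCircle → 𝕜} {t y : ℝ} {k : UnitAddCircle}
    (hA : Integrable fun k' => scatKernel k k' • A t y k')
    (hB : Integrable fun k' => scatKernel k k' • B t y k') :
    gain γ₀ (fun t y k => (A t y k, B t y k)) t y k = (gain γ₀ A t y k, gain γ₀ B t y k) := by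
  have := integral_pair hA hB
  rw [gain, gain, gain, ← Prod.smul_mk, ← this]
  rfl

lemma IsClassicalSolution.continuousAt_section {W₀ : ℝ × UnitAddCircle → 𝕜}
    {W : ℝ → ℝ × UnitAddCircle → 𝕜} (hW : IsClassicalSolution α γ₀ γ₁ W₀ W) {t y : ℝ} (ht : 0 < t)
    (hy : y ≠ 0) {k : UnitAddCircle} (hk : k ≠ 0) :
    ContinuousAt (fun q : ℝ × (ℝ × UnitAddCircle) => W q.1 q.2) (t, (y, k)) :=
  hW.continuousOn.continuousAt ((isOpen_Ioi.prod (isOpen_compl_singleton.prod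
    isOpen_compl_singleton)).mem_nhds ⟨ht, hy, hk⟩)

lemma IsClassicalSolution.continuousAt_k {W₀ : ℝ × UnitAddCircle → 𝕜}
    {W : ℝ → ℝ × UnitAddCircle → 𝕜} (hW : IsClassicalSolution α γ₀ γ₁ W₀ W) {t y : ℝ} (ht : 0 < t)
    (hy : y ≠ 0) {k : UnitAddCircle} (hk : k ≠ 0) : ContinuousAt (fun k => W t (y, k)) k :=
  ContinuousAt.comp (x := k) (f := fun k : UnitAddCircle => (t, (y, k)))
    (hW.continuousAt_section ht hy hk) (by fun_prop)

lemma IsClassicalSolution.hasDerivAt {W₀ : ℝ × UnitAddCircle → 𝕜}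
    {W : ℝ → ℝ × UnitAddCircle → 𝕜} (hW : IsClassicalSolution α γ₀ γ₁ W₀ W) {t y : ℝ} (ht : 0 < t)
    (hy : y ≠ 0) {k : UnitAddCircle} (hk : k ≠ 0) :
    HasDerivAt (fun s : ℝ => W (t + s) (y + vel α k * s, k))
      (-(rate γ₀ k • W t (y, k)) + (2 * γ₀) • ∫ k', scatKernel k k' • W t (y, k')) 0 := by
  obtain ⟨C, hC⟩ := hW.bounded
  have h1 := ((hW.contDiffAt t ht y k hy hk).differentiableAt (by norm_num)).hasDerivAt
  rwa [hW.equation t ht y k hy hk, collision_eq (F := fun k' => W t (y, k'))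
    (fun k hk => hW.continuousAt_k ht hy hk) (fun k hk => hC t ht y k hy hk)] at h1

/-- Classical solutions are determined by their initial datum. -/
lemma IsProfile.unique (hp : IsProfile α p) (hγ₀ : 0 < γ₀) (hγ₁ : 0 < γ₁)
    {W₀ : ℝ × UnitAddCircle → 𝕜} {W W' : ℝ → ℝ × UnitAddCircle → 𝕜}
    (hW : IsClassicalSolution α γ₀ γ₁ W₀ W) (hW' : IsClassicalSolution α γ₀ γ₁ W₀ W') {t y : ℝ}
    {k : UnitAddCircle} (ht : 0 ≤ t) (hy : y ≠ 0) (hk : k ≠ 0) : W t (y, k) = W' t (y, k) := by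
  rcases ht.eq_or_lt with rfl | ht
  · rw [hW.initial y k hy hk, hW'.initial y k hy hk]
  have h : IsHalfLine (vel α) (bdry 𝕜 α γ₁) := hp.isHalfLine hγ₁
  set Z : ℝ → ℝ × UnitAddCircle → 𝕜 := fun t x => W t x - W' t x with hZ
  obtain ⟨C, hC⟩ := hW.bounded
  obtain ⟨C', hC'⟩ := hW'.bounded
  obtain ⟨Gp, Gm, c1, e1, c2, e2, hI⟩ := hW.extension
  obtain ⟨Gp', Gm', c1', e1', c2', e2', hI'⟩ := hW'.extension
  have hZb : ∀ t, 0 < t → ∀ y k, y ≠ 0 → k ≠ 0 → ‖Z t (y, k)‖ ≤ C + C' := fun t ht y k hy hk =>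
    (norm_sub_le _ _).trans (add_le_add (hC t ht y k hy hk) (hC' t ht y k hy hk))
  have hZc : ∀ t y, 0 < t → y ≠ 0 → ∀ k, k ≠ 0 → ContinuousAt (fun k => Z t (y, k)) k :=
    fun t y ht hy k hk => (hW.continuousAt_k ht hy hk).sub (hW'.continuousAt_k ht hy hk)
  have hZd : ∀ t y k, 0 < t → y ≠ 0 → k ≠ 0 →
      HasDerivAt (fun s : ℝ => Z (t + s) (y + vel α k * s, k))
        (-(rate γ₀ k • Z t (y, k)) + (2 * γ₀) • ∫ k', scatKernel k k' • Z t (y, k')) 0 := by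
    intro t y k ht hy hk
    refine ((hW.hasDerivAt ht hy hk).sub (hW'.hasDerivAt ht hy hk)).congr_deriv ?_
    simp only [hZ]
    simp_rw [smul_sub]
    rw [integral_sub (integrable_kernel_smul (fun k hk => hW.continuousAt_k ht hy hk)
      (fun k hk => hC t ht y k hy hk) k) (integrable_kernel_smul
      (fun k hk => hW'.continuousAt_k ht hy hk) (fun k hk => hC' t ht y k hy hk) k), smul_sub]
    abel
  -- The difference is formed with the continuous extensions, since the values of `W` itself at `y =
  -- 0` carry no information.
  set D : ℝ → ℝ → UnitAddCircle → 𝕜 × 𝕜 := fun t y k =>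
    (Gp (t, (y, k)) - Gp' (t, (y, k)), Gm (t, (-y, -k)) - Gm' (t, (-y, -k))) with hD
  have hDZ : ∀ t y k, 0 < t → 0 < y → k ≠ 0 → D t y k = (Z t (y, k), Z t (-y, -k)) := by
    intro t y k ht hy hk
    have m1 : ((t, (y, k)) : ℝ × (ℝ × UnitAddCircle)) ∈ Ioi (0 : ℝ) ×ˢ (Ioi (0 : ℝ) ×ˢ {0}ᶜ) :=
      ⟨ht, hy, hk⟩
    have m2 : ((t, (-y, -k)) : ℝ × (ℝ × UnitAddCircle)) ∈
        Ioi (0 : ℝ) ×ˢ (Iio (0 : ℝ) ×ˢ {0}ᶜ) :=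
      ⟨ht, by simpa using hy, neg_ne_zero.2 hk⟩
    simp only [hD, hZ, e1 m1, e1' m1, e2 m2, e2' m2]
  have hDc : ContinuousOn (fun q : ℝ × ℝ × UnitAddCircle => D q.1 q.2.1 q.2.2)
      (Ici 0 ×ˢ (Ici 0 ×ˢ {0}ᶜ)) := by
    refine ContinuousOn.prodMk (c1.sub c1') ?_
    refine (c2.sub c2').comp (f := fun q : ℝ × ℝ × UnitAddCircle => (q.1, (-q.2.1, -q.2.2)))
      (by fun_prop) fun q hq => ⟨hq.1, ?_, ?_⟩
    · simpa using hq.2.1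
    · simpa using hq.2.2
  -- The extensions agree with `W` for `t > 0` only. That they vanish at `t = 0` has to come from
  -- the convergence of both solutions to the same datum.
  have hcollapse : ∀ y k, y ≠ 0 → k ≠ 0 → Tendsto (fun t => Z t (y, k)) (𝓝[>] 0) (𝓝 0) := by
    intro y k hy hk
    have := (hW.tendsto_initial y k hy hk).sub (hW'.tendsto_initial y k hy hk)
    rwa [sub_self] at this
  have hDh : IsHomogeneous (vel α) (bdry 𝕜 α γ₁) γ₀ D := by
    refine ⟨hDc, fun t k ht hk hv => ?_, fun y k hy hk => ?_, fun t y k ht hy hk => ?_⟩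
    · have b1 := hp.boundary_of_interface hγ₁ (hI t ht) hk hv
      have b2 := hp.boundary_of_interface hγ₁ (hI' t ht) hk hv
      have b3 := congrArg₂ (· - ·) b1 b2
      simp only [← map_sub, Prod.mk_sub_mk] at b3
      simpa [hD] using b3
    · have h1 : ContinuousOn (fun t => D t y k) (Ici 0) :=
        hDc.comp (f := fun t => (t, y, k)) (by fun_prop) fun t ht => ⟨ht, hy.le, hk⟩
      have h2 : Tendsto (fun t => D t y k) (𝓝[>] 0) (𝓝 (D 0 y k)) :=
        (h1 0 self_mem_Ici).tendsto.mono_left (nhdsWithin_mono _ Ioi_subset_Ici_self)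
      have h3 : Tendsto (fun t => (Z t (y, k), Z t (-y, -k))) (𝓝[>] 0) (𝓝 (0, 0)) :=
        (hcollapse y k hy.ne' hk).prodMk_nhds
          (hcollapse (-y) (-k) (neg_ne_zero.2 hy.ne') (neg_ne_zero.2 hk))
      refine tendsto_nhds_unique h2 (h3.congr' ?_)
      filter_upwards [self_mem_nhdsWithin] with t ht
      exact (hDZ t y k ht hy hk).symm
    · have hk' := neg_ne_zero.2 hk
      have hy' := neg_ne_zero.2 hy.ne'
      have d1 := hZd t y k ht hy.ne' hk
      have d2 := hZd t (-y) (-k) ht hy' hk'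
      have hev : (fun s : ℝ => (Z (t + s) (y + vel α k * s, k),
          Z (t + s) (-y + vel α (-k) * s, -k))) =ᶠ[𝓝 0]
          fun σ => D (t + σ) (y + vel α k * σ) k := by
        have h1 : ContinuousAt (fun σ : ℝ => t + σ) 0 := by fun_prop
        have h2 : ContinuousAt (fun σ : ℝ => y + vel α k * σ) 0 := by fun_prop
        filter_upwards [h1.eventually (lt_mem_nhds (by simpa using ht : (0 : ℝ) < t + 0)),
          h2.eventually (lt_mem_nhds (by simpa using hy : (0 : ℝ) < y + vel α k * 0))] with σ g1 g2
        rw [hDZ _ _ _ g1 g2 hk, hp.vel_neg]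
        congr 3
        ring
      refine ((d1.prodMk d2).congr_of_eventuallyEq hev.symm).congr_deriv ?_
      have i1 := integrable_kernel_smul (hZc t y ht hy.ne')
        (fun k hk => hZb t ht y k hy.ne' hk) k
      have i2 := integrable_kernel_smul (f := fun k' => Z t (-y, -k')) (fun k hk =>
        ContinuousAt.comp (x := k) (f := fun k : UnitAddCircle => -k)
          (g := fun k' => Z t (-y, k')) (hZc t (-y) ht hy' (-k) (neg_ne_zero.2 hk)) (by fun_prop))
        (fun k hk => hZb t ht (-y) (-k) hy' (neg_ne_zero.2 hk)) k
      have hg : gain γ₀ D t y k =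
          gain γ₀ (fun t y k => (Z t (y, k), Z t (-y, -k))) t y k := by
        rw [gain, gain]
        congr 1
        refine integral_congr_ae ?_
        filter_upwards [ae_ne_zero_torus] with k' hk'
        rw [hDZ t y k' ht hy hk']
      have i3 : ∫ k', scatKernel (-k) k' • Z t (-y, k') =
          ∫ k', scatKernel k k' • Z t (-y, -k') := by
        rw [← integral_neg_eq_self]
        simp only [scatKernel_neg_left, scatKernel_neg_right]
      rw [hg, gain_prod (A := fun t y k => Z t (y, k)) (B := fun t y k => Z t (-y, -k)) i1 i2,
        hDZ t y k ht hy hk, rate_neg, i3]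
      rfl
  have hDb : ∀ t y k, 0 < t → 0 < y → k ≠ 0 → ‖D t y k‖ ≤ C + C' := fun t y k ht hy hk => by
    rw [hDZ t y k ht hy hk, Prod.norm_def]
    exact max_le (hZb t ht y k hy.ne' hk)
      (hZb t ht (-y) (-k) (neg_ne_zero.2 hy.ne') (neg_ne_zero.2 hk))
  refine sub_eq_zero.1 ?_
  rcases lt_or_gt_of_ne hy with hy | hy
  · have h0 := hDh.eq_zero hγ₀ h hDb ht (neg_ne_zero.2 hk) (neg_pos.2 hy)
    rw [hDZ t _ _ ht (neg_pos.2 hy) (neg_ne_zero.2 hk), neg_neg, neg_neg] at h0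
    exact congrArg Prod.snd h0
  · have h0 := hDh.eq_zero hγ₀ h hDb ht hk hy
    rw [hDZ t _ _ ht hy hk] at h0
    exact congrArg Prod.fst h0

end
end KineticInterface

namespace KineticInterface
noncomputable section

set_option linter.unusedSectionVars false

/-! ### Square-integrable estimates for the free evolution -/

variable {𝕜 : Type*} [RCLike 𝕜] {α : ℤ → ℝ} {p : ℝ → ℝ} {γ₀ γ₁ : ℝ}

lemma enorm_sq_eq_ofReal {E : Type*} [NormedAddCommGroup E] (x : E) :
    ‖x‖ₑ ^ 2 = ENNReal.ofReal (‖x‖ ^ 2) := by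
  rw [← ofReal_norm, ENNReal.ofReal_pow (norm_nonneg _)]

lemma eLpNorm_two_sq {β E : Type*} [MeasurableSpace β] [NormedAddCommGroup E] (μ : Measure β)
    (F : β → E) : eLpNorm F 2 μ ^ 2 = ∫⁻ x, ‖F x‖ₑ ^ 2 ∂μ := by
  have := eLpNorm_nnreal_pow_eq_lintegral (f := F) (μ := μ) (p := 2) (by norm_num)
  simpa using this

lemma eLpNorm_two_le_of_lintegral_sq_le {β E : Type*} [MeasurableSpace β] [NormedAddCommGroup E]
    {μ : Measure β} {F G : β → E} {C : NNReal}
    (h : ∫⁻ x, ‖G x‖ₑ ^ 2 ∂μ ≤ C ^ 2 * ∫⁻ x, ‖F x‖ₑ ^ 2 ∂μ) :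
    eLpNorm G 2 μ ≤ C * eLpNorm F 2 μ := by
  rw [← eLpNorm_two_sq, ← eLpNorm_two_sq, ← mul_pow] at h
  exact (ENNReal.pow_le_pow_left_iff two_ne_zero).1 h

lemma ae_fst_ne_zero : ∀ᵐ x : ℝ × UnitAddCircle, x.1 ≠ 0 :=
  Measure.quasiMeasurePreserving_fst.ae (Measure.ae_ne volume (0 : ℝ))

lemma ae_snd_ne_zero : ∀ᵐ x : ℝ × UnitAddCircle, x.2 ≠ 0 :=
  Measure.quasiMeasurePreserving_snd.ae ae_ne_zero_torus

/-- The shear `(y, k) ↦ (y - v(k), k)`. -/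
def shear (v : UnitAddCircle → ℝ) (hv : Measurable v) :
    ℝ × UnitAddCircle ≃ᵐ ℝ × UnitAddCircle where
  toFun x := (x.1 - v x.2, x.2)
  invFun x := (x.1 + v x.2, x.2)
  left_inv x := by simp
  right_inv x := by simp
  measurable_toFun := by
    change Measurable fun x : ℝ × UnitAddCircle => (x.1 - v x.2, x.2)
    fun_prop
  measurable_invFun := by
    change Measurable fun x : ℝ × UnitAddCircle => (x.1 + v x.2, x.2)
    fun_prop

lemma measurePreserving_shear {v : UnitAddCircle → ℝ} (hv : Measurable v) :
    MeasurePreserving (shear v hv) := by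
  have h1 : MeasurePreserving (fun q : UnitAddCircle × ℝ => (q.1, q.2 - v q.1))
      ((volume : Measure UnitAddCircle).prod (volume : Measure ℝ))
      ((volume : Measure UnitAddCircle).prod (volume : Measure ℝ)) := by
    refine (MeasurePreserving.id volume).skew_product (g := fun k y => y - v k) ?_ ?_
    · change Measurable fun q : UnitAddCircle × ℝ => q.2 - v q.1
      fun_prop
    · exact Eventually.of_forall fun k => (measurePreserving_sub_right volume (v k)).map_eq
  exact (Measure.measurePreserving_swap.comp h1).comp Measure.measurePreserving_swap

lemma measurePreserving_reflect :
    MeasurePreserving (fun x : ℝ × UnitAddCircle => (-x.1, -x.2)) :=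
  (Measure.measurePreserving_neg (volume : Measure ℝ)).prod
    (Measure.measurePreserving_neg (volume : Measure UnitAddCircle))

lemma lintegral_reflect (f : ℝ × UnitAddCircle → ENNReal) :
    ∫⁻ x : ℝ × UnitAddCircle, f (-x.1, -x.2) = ∫⁻ x, f x :=
  measurePreserving_reflect.lintegral_comp_emb
    ((MeasurableEquiv.neg ℝ).prodCongr (MeasurableEquiv.neg UnitAddCircle)).measurableEmbedding f

lemma IsProfile.measurable_vel (hp : IsProfile α p) : Measurable (vel α) :=
  measurable_of_continuousOn_compl_singleton 0 fun _ hk =>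
    (hp.continuousAt_vel hk).continuousWithinAt

lemma IsProfile.measurable_pPlus (hp : IsProfile α p) (hγ : 0 < γ₁) : Measurable (pPlus α γ₁) :=
  measurable_of_continuousOn_compl_singleton 0 fun _ hk =>
    (hp.continuousAt_pPlus hγ hk).continuousWithinAt

lemma IsProfile.measurable_pMinus (hp : IsProfile α p) (hγ : 0 < γ₁) :
    Measurable (pMinus α γ₁) :=
  measurable_of_continuousOn_compl_singleton 0 fun _ hk =>
    (hp.continuousAt_pMinus hγ hk).continuousWithinAt

/-- The points that have crossed the interface during a time span `t`, in terms of their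
initial position. -/
def crossing (α : ℤ → ℝ) (t : ℝ) : Set (ℝ × UnitAddCircle) :=
  {z | z.1 + vel α z.2 * t ∈ uIcc 0 (vel α z.2 * t)}

lemma IsProfile.measurableSet_crossing (hp : IsProfile α p) (t : ℝ) :
    MeasurableSet (crossing α t) := by
  have hv := hp.measurable_vel
  have : crossing α t = {z | min 0 (vel α z.2 * t) ≤ z.1 + vel α z.2 * t} ∩
      {z | z.1 + vel α z.2 * t ≤ max 0 (vel α z.2 * t)} := rfl
  rw [this]
  exact (measurableSet_le (by fun_prop) (by fun_prop)).inter
    (measurableSet_le (by fun_prop) (by fun_prop))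

lemma IsProfile.neg_mem_crossing (hp : IsProfile α p) (t : ℝ) (z : ℝ × UnitAddCircle) :
    (-z.1, -z.2) ∈ crossing α t ↔ z ∈ crossing α t := by
  simp only [crossing, mem_ofPred_eq, hp.vel_neg, mem_uIcc]
  constructor
  · rintro (h | h)
    · right; constructor <;> linarith [h.1, h.2]
    · left; constructor <;> linarith [h.1, h.2]
  · rintro (h | h)
    · right; constructor <;> linarith [h.1, h.2]
    · left; constructor <;> linarith [h.1, h.2]

lemma norm_mix_sq_le {a b : 𝕜} {P Q : ℝ} (hP : 0 ≤ P) (hQ : 0 ≤ Q) (h : P + Q ≤ 1) :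
    ‖P • a + Q • b‖ ^ 2 ≤ P * ‖a‖ ^ 2 + Q * ‖b‖ ^ 2 := by
  have h1 : ‖P • a + Q • b‖ ≤ P * ‖a‖ + Q * ‖b‖ := by
    refine (norm_add_le _ _).trans_eq ?_
    rw [norm_smul, norm_smul, Real.norm_of_nonneg hP, Real.norm_of_nonneg hQ]
  have h2 : ‖P • a + Q • b‖ ^ 2 ≤ (P * ‖a‖ + Q * ‖b‖) ^ 2 :=
    pow_le_pow_left₀ (norm_nonneg _) h1 2
  have h3 : 0 ≤ P * Q * (‖a‖ - ‖b‖) ^ 2 := by positivity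
  have h4 : 0 ≤ (1 - (P + Q)) * (P * ‖a‖ ^ 2 + Q * ‖b‖ ^ 2) :=
    mul_nonneg (by linarith) (by positivity)
  nlinarith

/-- The effect of the interface and of the absorption in the free evolution, without the
transport. -/
def interfaceMix (α : ℤ → ℝ) (γ₀ γ₁ t : ℝ) (F : ℝ × UnitAddCircle → 𝕜) (z : ℝ × UnitAddCircle) :
    𝕜 :=
  Real.exp (-(rate γ₀ z.2 * t)) • (open Classical in if z ∈ crossing α t then
    pPlus α γ₁ z.2 • F z + pMinus α γ₁ z.2 • F (-z.1, -z.2) else F z)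

/-- In terms of the initial position, transport is a measure-preserving shear, and what remains is a
pointwise mixing of `F` at `z` and `-z`. -/
lemma unperturbed_eq_shear (hv : Measurable (vel α)) (t : ℝ) (F : ℝ × UnitAddCircle → 𝕜)
    (x : ℝ × UnitAddCircle) :
    unperturbed α γ₀ γ₁ t F x =
      interfaceMix α γ₀ γ₁ t F (shear (fun k => vel α k * t) (hv.mul_const t) x) := by
  have h1 : shear (fun k => vel α k * t) (hv.mul_const t) x = (x.1 - vel α x.2 * t, x.2) := rfl
  have h2 : (x.1 - vel α x.2 * t, x.2) ∈ crossing α t ↔ x.1 ∈ uIcc 0 (vel α x.2 * t) := by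
    rw [crossing, mem_ofPred_eq, sub_add_cancel]
  rw [h1, unperturbed, interfaceMix, rate, neg_sub, neg_add_eq_sub]
  congr 1
  by_cases hc : x.1 ∈ uIcc 0 (vel α x.2 * t)
  · rw [if_pos hc, if_pos (h2.2 hc)]
  · rw [if_neg hc, if_neg (mt h2.1 hc)]

lemma IsProfile.aestronglyMeasurable_unperturbed (hp : IsProfile α p) (hγ : 0 < γ₁) (t : ℝ)
    {F : ℝ × UnitAddCircle → 𝕜} (hF : AEStronglyMeasurable F volume) :
    AEStronglyMeasurable (unperturbed α γ₀ γ₁ t F) volume := by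
  have hv := hp.measurable_vel
  have hP := hp.measurable_pPlus hγ
  have hQ := hp.measurable_pMinus hγ
  have hr := (continuous_rate γ₀).measurable
  have he : unperturbed α γ₀ γ₁ t F = interfaceMix α γ₀ γ₁ t F ∘
      shear (fun k => vel α k * t) (hv.mul_const t) := funext (unperturbed_eq_shear hv t F)
  rw [he]
  refine AEStronglyMeasurable.comp_quasiMeasurePreserving ?_
    (measurePreserving_shear _).quasiMeasurePreserving
  have hF' : AEStronglyMeasurable (fun z : ℝ × UnitAddCircle => F (-z.1, -z.2)) volume :=
    hF.comp_quasiMeasurePreserving measurePreserving_reflect.quasiMeasurePreserving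
  classical
  refine AEStronglyMeasurable.smul (Measurable.aestronglyMeasurable (by fun_prop)) ?_
  refine AEStronglyMeasurable.piecewise (s := crossing α t) (hp.measurableSet_crossing t) ?_
    hF.restrict
  refine AEStronglyMeasurable.restrict ?_
  exact ((hP.comp measurable_snd).aestronglyMeasurable.smul hF).add
    ((hQ.comp measurable_snd).aestronglyMeasurable.smul hF')

/-- Convexity bounds the mixed square by the weighted squares, and the reflection `z ↦ -z`, which
preserves `crossing`, moves the second term back to `z`; the weights then add up to at most `1`. The
damping factor is kept on the right because it must compensate the gain in the Euler estimate. -/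
lemma IsProfile.lintegral_unperturbed_le (hp : IsProfile α p) (hγ : 0 < γ₁) (t : ℝ)
    {F : ℝ × UnitAddCircle → 𝕜} (hF : AEStronglyMeasurable F volume) :
    ∫⁻ x, ‖unperturbed α γ₀ γ₁ t F x‖ₑ ^ 2 ≤
      ∫⁻ x, ‖Real.exp (-(rate γ₀ x.2 * t)) • F x‖ₑ ^ 2 := by
  classical
  have hv := hp.measurable_vel
  have hP := hp.measurable_pPlus hγ
  have hQ := hp.measurable_pMinus hγ
  have hr := (continuous_rate γ₀).measurable
  set w : ℝ × UnitAddCircle → ENNReal := fun z => ‖Real.exp (-(rate γ₀ z.2 * t))‖ₑ ^ 2 with hw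
  set a : ℝ × UnitAddCircle → ENNReal := fun z =>
    if z ∈ crossing α t then ENNReal.ofReal (pPlus α γ₁ z.2) else 1 with ha
  set b : ℝ × UnitAddCircle → ENNReal := fun z =>
    if z ∈ crossing α t then ENNReal.ofReal (pMinus α γ₁ z.2) else 0 with hb
  have hab : ∀ z, a z + b z ≤ 1 := by
    intro z
    simp only [ha, hb]
    split_ifs
    · rw [← ENNReal.ofReal_add (pPlus_nonneg _) (pMinus_nonneg _)]
      exact ENNReal.ofReal_le_one.2 (hp.pPlus_add_pMinus_le hγ _)
    · simp
  have hwm : Measurable w := by fun_prop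
  have ham : Measurable a :=
    Measurable.ite (hp.measurableSet_crossing t) (by fun_prop) measurable_const
  have hbm : Measurable b :=
    Measurable.ite (hp.measurableSet_crossing t) (by fun_prop) measurable_const
  calc ∫⁻ x, ‖unperturbed α γ₀ γ₁ t F x‖ₑ ^ 2
      ≤ ∫⁻ z, (w z * a z * ‖F z‖ₑ ^ 2 + w z * b z * ‖F (-z.1, -z.2)‖ₑ ^ 2) := by
        rw [MeasurePreserving.lintegral_map_equiv (fun z => w z * a z * ‖F z‖ₑ ^ 2 +
          w z * b z * ‖F (-z.1, -z.2)‖ₑ ^ 2) _ (measurePreserving_shear (hv.mul_const t))]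
        refine lintegral_mono fun x => ?_
        rw [unperturbed_eq_shear hv]
        generalize shear (fun k => vel α k * t) (hv.mul_const t) x = z
        simp only [hw, ha, hb, interfaceMix]
        rw [enorm_smul, mul_pow, mul_assoc, mul_assoc, ← mul_add]
        gcongr
        split_ifs
        · rw [enorm_sq_eq_ofReal, enorm_sq_eq_ofReal, enorm_sq_eq_ofReal,
            ← ENNReal.ofReal_mul (pPlus_nonneg _), ← ENNReal.ofReal_mul (pMinus_nonneg _),
            ← ENNReal.ofReal_add (mul_nonneg (pPlus_nonneg _) (sq_nonneg _))
              (mul_nonneg (pMinus_nonneg _) (sq_nonneg _))]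
          exact ENNReal.ofReal_le_ofReal (norm_mix_sq_le (pPlus_nonneg _) (pMinus_nonneg _)
            (hp.pPlus_add_pMinus_le hγ _))
        · simp
    _ = (∫⁻ z, w z * a z * ‖F z‖ₑ ^ 2) + ∫⁻ z, w z * b z * ‖F z‖ₑ ^ 2 := by
        rw [lintegral_add_left' (by fun_prop)]
        congr 1
        rw [← lintegral_reflect (fun z => w z * b z * ‖F z‖ₑ ^ 2)]
        refine lintegral_congr fun z => ?_
        simp only [hw, hb, rate_neg, hp.neg_mem_crossing, hp.pMinus_neg hγ]
    _ = ∫⁻ z, (w z * a z * ‖F z‖ₑ ^ 2 + w z * b z * ‖F z‖ₑ ^ 2) := by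
        rw [lintegral_add_left' (by fun_prop)]
    _ ≤ ∫⁻ x, ‖Real.exp (-(rate γ₀ x.2 * t)) • F x‖ₑ ^ 2 := by
        refine lintegral_mono fun z => ?_
        rw [← add_mul, ← mul_add, enorm_smul, mul_pow]
        gcongr
        exact mul_le_of_le_one_right' (hab z)

/-- An operation on functions that is linear and `L²`-bounded defines an operator on `L²`. -/
lemma exists_isGivenBy (Φ : (ℝ × UnitAddCircle → 𝕜) → ℝ × UnitAddCircle → 𝕜) (C : NNReal)
    (hmeas : ∀ F, MemLp F 2 volume → AEStronglyMeasurable (Φ F) volume)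
    (hadd : ∀ F G, MemLp F 2 volume → MemLp G 2 volume → Φ (F + G) =ᵐ[volume] Φ F + Φ G)
    (hsmul : ∀ (c : 𝕜) F, MemLp F 2 volume → Φ (c • F) =ᵐ[volume] c • Φ F)
    (hb : ∀ F, MemLp F 2 volume → ∫⁻ x, ‖Φ F x‖ₑ ^ 2 ≤ C ^ 2 * ∫⁻ x, ‖F x‖ₑ ^ 2) :
    ∃ A : L2 𝕜 →L[𝕜] L2 𝕜, IsGivenBy A Φ ∧ ∀ f, ‖A f‖ ≤ C * ‖f‖ := by
  have hmem : ∀ F, MemLp F 2 volume → MemLp (Φ F) 2 volume := fun F hF =>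
    ⟨hmeas F hF, (eLpNorm_two_le_of_lintegral_sq_le (hb F hF)).trans_lt
      (ENNReal.mul_lt_top ENNReal.coe_lt_top hF.2)⟩
  -- Independence of the representative is not assumed: by linearity and the bound, `Φ` annihilates
  -- `F - G` almost everywhere.
  have hcongr : ∀ F G, MemLp F 2 volume → F =ᵐ[volume] G → Φ F =ᵐ[volume] Φ G := by
    intro F G hF hFG
    have hG : MemLp G 2 volume := hF.ae_eq hFG
    have h1 := hadd F ((-1 : 𝕜) • G) hF (hG.const_smul _)
    have h2 := hsmul (-1) G hG
    have h3 := hb (F + (-1 : 𝕜) • G) (hF.add (hG.const_smul _))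
    have h4 : ∫⁻ x, ‖(F + (-1 : 𝕜) • G) x‖ₑ ^ 2 = 0 := by
      rw [lintegral_congr_ae (g := fun _ => 0)]
      · simp
      · filter_upwards [hFG] with x hx
        simp [hx]
    rw [h4, mul_zero, nonpos_iff_eq_zero, ← eLpNorm_two_sq, pow_eq_zero_iff two_ne_zero,
      eLpNorm_eq_zero_iff (hmeas _ (hF.add (hG.const_smul _))) two_ne_zero] at h3
    filter_upwards [h1, h2, h3] with x e1 e2 e3
    rw [e3, Pi.add_apply, e2] at e1
    simp only [Pi.zero_apply, Pi.smul_apply, neg_smul, one_smul] at e1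
    exact (add_neg_eq_zero.1 e1.symm)
  have hco : ∀ f : L2 𝕜, MemLp (f : ℝ × UnitAddCircle → 𝕜) 2 volume := fun f => Lp.memLp f
  let A₀ : L2 𝕜 →ₗ[𝕜] L2 𝕜 :=
    { toFun := fun f => (hmem f (hco f)).toLp _
      map_add' := fun f g => by
        rw [← MemLp.toLp_add, MemLp.toLp_eq_toLp_iff]
        exact (hcongr _ _ (hco _) (Lp.coeFn_add f g)).trans (hadd _ _ (hco f) (hco g))
      map_smul' := fun c f => by
        rw [RingHom.id_apply, ← MemLp.toLp_const_smul, MemLp.toLp_eq_toLp_iff]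
        exact (hcongr _ _ (hco _) (Lp.coeFn_smul c f)).trans (hsmul _ _ (hco f)) }
  have hA₀ : ∀ f, ‖A₀ f‖ ≤ C * ‖f‖ := by
    intro f
    change ‖(hmem f (hco f)).toLp _‖ ≤ _
    rw [Lp.norm_toLp, Lp.norm_def, ← ENNReal.coe_toReal, ← ENNReal.toReal_mul]
    exact ENNReal.toReal_mono (ENNReal.mul_ne_top ENNReal.coe_ne_top (hco f).2.ne)
      (eLpNorm_two_le_of_lintegral_sq_le (hb _ (hco f)))
  refine ⟨A₀.mkContinuous C hA₀, fun F hF => ?_, hA₀⟩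
  exact (MemLp.coeFn_toLp (hmem _ (hco (hF.toLp F)))).trans (hcongr _ _ (hco _) hF.coeFn_toLp)

lemma IsProfile.exists_free (hp : IsProfile α p) (hγ₀ : 0 < γ₀) (hγ₁ : 0 < γ₁) {t : ℝ}
    (ht : 0 ≤ t) : ∃ A : L2 𝕜 →L[𝕜] L2 𝕜, IsGivenBy A (unperturbed α γ₀ γ₁ t) ∧
      ∀ f, ‖A f‖ ≤ ‖f‖ := by
  have := exists_isGivenBy (𝕜 := 𝕜) (unperturbed α γ₀ γ₁ t) 1
    (fun F hF => hp.aestronglyMeasurable_unperturbed hγ₁ t hF.1) ?_ ?_ ?_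
  · simpa using this
  · intro F G _ _
    refine Eventually.of_forall fun x => ?_
    simp only [unperturbed, Pi.add_apply, ← smul_add]
    congr 1
    split_ifs
    · simp only [smul_add]; abel
    · rfl
  · intro c F _
    refine Eventually.of_forall fun x => ?_
    simp only [unperturbed, Pi.smul_apply]
    rw [smul_comm c]
    congr 1
    split_ifs
    · rw [smul_add, smul_comm c, smul_comm c]
    · rfl
  · intro F hF
    refine (hp.lintegral_unperturbed_le hγ₁ t hF.1).trans ?_
    rw [ENNReal.coe_one, one_pow, one_mul]
    refine lintegral_mono fun x => ?_
    rw [enorm_smul]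
    gcongr
    refine mul_le_of_le_one_left' ?_
    rw [← ofReal_norm, Real.norm_of_nonneg (Real.exp_pos _).le]
    refine ENNReal.ofReal_le_one.2 (Real.exp_le_one_iff.2 ?_)
    have := mul_nonneg (rate_nonneg hγ₀ x.2) ht
    linarith

end
end KineticInterface

namespace KineticInterface
noncomputable section

set_option linter.unusedSectionVars false

/-! ### Square-integrable estimates for the scattering operator -/

variable {𝕜 : Type*} [RCLike 𝕜] {γ₀ : ℝ}

lemma integrable_scatKernel_smul {E : Type*} [NormedAddCommGroup E] [NormedSpace ℝ E]
    {g : UnitAddCircle → E} (hg : Integrable g) (k : UnitAddCircle) :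
    Integrable fun k' => scatKernel k k' • g k' := by
  refine (hg.norm.const_mul 16).mono'
    ((continuous_scatKernel_right k).aestronglyMeasurable.smul hg.1) (Eventually.of_forall fun k' => ?_)
  rw [norm_smul, Real.norm_of_nonneg (scatKernel_nonneg _ _)]
  exact mul_le_mul_of_nonneg_right (scatKernel_le _ _) (norm_nonneg _)

section Slice

variable {f : UnitAddCircle → 𝕜}

lemma integrable_norm_sq (hf : MemLp f 2 volume) : Integrable fun k => ‖f k‖ ^ 2 :=
  (memLp_two_iff_integrable_sq_norm hf.1).1 hf

lemma norm_integral_scatKernel_sq_le (hf : MemLp f 2 volume) (k : UnitAddCircle) :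
    ‖∫ k', scatKernel k k' • f k'‖ ^ 2 ≤
      totalKernel k * ∫ k', scatKernel k k' * ‖f k'‖ ^ 2 := by
  have hf1 : Integrable f := hf.integrable one_le_two
  have i1 : Integrable fun k' => scatKernel k k' * ‖f k'‖ := integrable_scatKernel_smul hf1.norm k
  have i2 : Integrable fun k' => scatKernel k k' * ‖f k'‖ ^ 2 :=
    integrable_scatKernel_smul (integrable_norm_sq hf) k
  have i0 := integrable_scatKernel k
  -- Cauchy–Schwarz for the weight `R(k, ·)`, through the discriminant of the nonnegative quadratic
  -- `x ↦ ∫ R(k, k') (x - |f(k')|)² dk'`.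
  have hq : ∀ x : ℝ, 0 ≤ totalKernel k * (x * x) + (-2 * ∫ k', scatKernel k k' * ‖f k'‖) * x +
      ∫ k', scatKernel k k' * ‖f k'‖ ^ 2 := by
    intro x
    have h1 : 0 ≤ ∫ k', scatKernel k k' * (x - ‖f k'‖) ^ 2 :=
      integral_nonneg fun k' => mul_nonneg (scatKernel_nonneg _ _) (sq_nonneg _)
    have h2 : ∫ k', scatKernel k k' * (x - ‖f k'‖) ^ 2 = ∫ k', ((scatKernel k k' * (x * x) -
        scatKernel k k' * ‖f k'‖ * (2 * x)) + scatKernel k k' * ‖f k'‖ ^ 2) :=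
      integral_congr_ae (Eventually.of_forall fun k' => by ring)
    have i3 : Integrable fun k' => scatKernel k k' * (x * x) - scatKernel k k' * ‖f k'‖ * (2 * x) :=
      (i0.mul_const _).sub (i1.mul_const _)
    rw [h2, integral_add i3 i2,
      integral_sub (i0.mul_const _) (i1.mul_const _), integral_mul_const, integral_mul_const] at h1
    rw [totalKernel]
    linarith
  have hd := discrim_le_zero hq
  have h3 : ‖∫ k', scatKernel k k' • f k'‖ ≤ ∫ k', scatKernel k k' * ‖f k'‖ := by
    refine norm_integral_le_of_norm_le i1 (Eventually.of_forall fun k' => ?_)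
    rw [norm_smul, Real.norm_of_nonneg (scatKernel_nonneg _ _)]
  have h4 := pow_le_pow_left₀ (norm_nonneg _) h3 2
  rw [discrim] at hd
  nlinarith

lemma integral_scatKernel_sq_le (hf : MemLp f 2 volume) (k : UnitAddCircle) :
    ∫ k', scatKernel k k' * ‖f k'‖ ^ 2 ≤ 16 * ∫ k', ‖f k'‖ ^ 2 := by
  rw [← integral_const_mul]
  refine integral_mono (integrable_scatKernel_smul (integrable_norm_sq hf) k)
    ((integrable_norm_sq hf).const_mul 16) fun k' => ?_
  exact mul_le_mul_of_nonneg_right (scatKernel_le _ _) (sq_nonneg _)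

lemma lintegral_enorm_sq (hf : MemLp f 2 volume) :
    ∫⁻ k, ‖f k‖ₑ ^ 2 = ENNReal.ofReal (∫ k, ‖f k‖ ^ 2) := by
  rw [ofReal_integral_eq_lintegral_ofReal (integrable_norm_sq hf)
    (Eventually.of_forall fun k => sq_nonneg _)]
  simp only [enorm_sq_eq_ofReal]

lemma lintegral_scatter_slice_le (hf : MemLp f 2 volume) :
    ∫⁻ k, ‖∫ k', scatKernel k k' • f k'‖ₑ ^ 2 ≤ (16 : NNReal) ^ 2 * ∫⁻ k, ‖f k‖ₑ ^ 2 := by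
  have h : ∀ k, ‖∫ k', scatKernel k k' • f k'‖ₑ ^ 2 ≤ ENNReal.ofReal (16 ^ 2 * ∫ k, ‖f k‖ ^ 2) := by
    intro k
    rw [enorm_sq_eq_ofReal]
    refine ENNReal.ofReal_le_ofReal ((norm_integral_scatKernel_sq_le hf k).trans ?_)
    rw [pow_two, mul_assoc]
    exact mul_le_mul (totalKernel_le k) (integral_scatKernel_sq_le hf k)
      (integral_nonneg fun k' => mul_nonneg (scatKernel_nonneg _ _) (sq_nonneg _)) (by norm_num)
  refine (lintegral_mono h).trans ?_
  rw [lintegral_const, measure_univ, mul_one, lintegral_enorm_sq hf,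
    ENNReal.ofReal_mul (by positivity)]
  norm_num

/-- Cauchy–Schwarz for the vectors `(1, √(cR))` and `(‖x‖, √(cz))`. -/
lemma norm_add_smul_sq_le {x y : 𝕜} {c R z : ℝ} (hc : 0 ≤ c) (hR : 0 ≤ R) (hz : 0 ≤ z)
    (h : ‖y‖ ^ 2 ≤ R * z) : ‖x + c • y‖ ^ 2 ≤ (1 + c * R) * (‖x‖ ^ 2 + c * z) := by
  have h1 : ‖x + c • y‖ ≤ ‖x‖ + c * ‖y‖ := by
    refine (norm_add_le _ _).trans_eq ?_
    rw [norm_smul, Real.norm_of_nonneg hc]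
  have h2 := pow_le_pow_left₀ (norm_nonneg _) h1 2
  have h3 : 2 * (‖x‖ * ‖y‖) ≤ R * ‖x‖ ^ 2 + z := by
    refine abs_le_of_sq_le_sq' ?_ (by positivity) |>.2
    nlinarith [sq_nonneg (R * ‖x‖ ^ 2 - z), mul_le_mul_of_nonneg_left h (sq_nonneg ‖x‖)]
  nlinarith [mul_le_mul_of_nonneg_left h3 hc, mul_le_mul_of_nonneg_left h (sq_nonneg c)]

lemma exp_neg_add_self_le {x : ℝ} (hx : 0 ≤ x) : Real.exp (-x) + x ≤ 1 + x ^ 2 := by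
  have h1 := Real.add_one_le_exp x
  have h2 : Real.exp (-x) * (x + 1) ≤ 1 := by
    calc _ ≤ Real.exp (-x) * Real.exp x := mul_le_mul_of_nonneg_left h1 (Real.exp_pos _).le
      _ = 1 := by rw [← Real.exp_add]; simp
  have h3 : (Real.exp (-x) + x - 1 - x ^ 2) * (x + 1) ≤ 0 := by nlinarith [pow_nonneg hx 3]
  by_contra hcon
  push Not at hcon
  have := mul_pos (show 0 < Real.exp (-x) + x - 1 - x ^ 2 by linarith) (show 0 < x + 1 by linarith)
  linarith

/-- With `a` the rate, the factor `1 + ah` from Cauchy–Schwarz is eaten by one of the two factors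
`exp (-ah)`. By symmetry of the kernel the gain term then integrates to `ah|f|²`, and `exp (-ah) +
ah ≤ 1 + (ah)²` leaves only a second-order error. -/
lemma lintegral_euler_slice_le (hγ : 0 < γ₀) {h : ℝ} (hh : 0 ≤ h) (hf : MemLp f 2 volume) :
    ∫⁻ k, ‖Real.exp (-(rate γ₀ k * h)) • (f k + (2 * γ₀ * h) • ∫ k', scatKernel k k' • f k')‖ₑ ^ 2
      ≤ ENNReal.ofReal (1 + (32 * γ₀ * h) ^ 2) * ∫⁻ k, ‖f k‖ₑ ^ 2 := by
  set z : UnitAddCircle → ℝ := fun k => ∫ k', scatKernel k k' * ‖f k'‖ ^ 2 with hz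
  have hz0 : ∀ k, 0 ≤ z k := fun k =>
    integral_nonneg fun k' => mul_nonneg (scatKernel_nonneg _ _) (sq_nonneg _)
  have hf2 := integrable_norm_sq hf
  have hc : 0 ≤ 2 * γ₀ * h := by positivity
  have hpw : ∀ k, ‖Real.exp (-(rate γ₀ k * h)) •
      (f k + (2 * γ₀ * h) • ∫ k', scatKernel k k' • f k')‖ ^ 2 ≤
      Real.exp (-(rate γ₀ k * h)) * ‖f k‖ ^ 2 + 2 * γ₀ * h * z k := by
    intro k
    set e := Real.exp (-(rate γ₀ k * h)) with he
    have he0 : 0 < e := Real.exp_pos _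
    have he1 : e ≤ 1 := Real.exp_le_one_iff.2
      (by have := mul_nonneg (rate_nonneg hγ k) hh; linarith)
    have he2 : e * (1 + 2 * γ₀ * h * totalKernel k) ≤ 1 := by
      have h1 := Real.add_one_le_exp (rate γ₀ k * h)
      calc _ ≤ e * Real.exp (rate γ₀ k * h) :=
            mul_le_mul_of_nonneg_left (by rw [rate] at h1 ⊢; linarith) he0.le
        _ = 1 := by rw [he, ← Real.exp_add]; simp
    rw [norm_smul, mul_pow, Real.norm_of_nonneg he0.le]
    have h1 := norm_add_smul_sq_le (x := f k) hc (totalKernel_nonneg k) (hz0 k)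
      (norm_integral_scatKernel_sq_le hf k)
    have hA : 0 ≤ ‖f k‖ ^ 2 + 2 * γ₀ * h * z k :=
      add_nonneg (sq_nonneg _) (mul_nonneg hc (hz0 k))
    calc _ ≤ e ^ 2 * ((1 + 2 * γ₀ * h * totalKernel k) * (‖f k‖ ^ 2 + 2 * γ₀ * h * z k)) :=
          mul_le_mul_of_nonneg_left h1 (sq_nonneg _)
      _ = e * ((e * (1 + 2 * γ₀ * h * totalKernel k)) * (‖f k‖ ^ 2 + 2 * γ₀ * h * z k)) := by ring
      _ ≤ e * (1 * (‖f k‖ ^ 2 + 2 * γ₀ * h * z k)) := by gcongr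
      _ = e * ‖f k‖ ^ 2 + e * (2 * γ₀ * h * z k) := by ring
      _ ≤ _ := by
        have := mul_le_of_le_one_left (mul_nonneg hc (hz0 k)) he1
        linarith
  have iK : Integrable (Function.uncurry fun k k' => scatKernel k k' * ‖f k'‖ ^ 2)
      ((volume : Measure UnitAddCircle).prod volume) := by
    refine ((hf2.comp_snd (volume : Measure UnitAddCircle)).const_mul 16).mono'
      (continuous_scatKernel.aestronglyMeasurable.mul
        (hf2.comp_snd (volume : Measure UnitAddCircle)).1) (Eventually.of_forall fun q => ?_)
    simp only [Function.uncurry]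
    rw [norm_mul, Real.norm_of_nonneg (scatKernel_nonneg _ _), Real.norm_of_nonneg (sq_nonneg _)]
    exact mul_le_mul_of_nonneg_right (scatKernel_le _ _) (sq_nonneg _)
  have iz : Integrable z := iK.integral_prod_left
  have ie : Integrable fun k => Real.exp (-(rate γ₀ k * h)) * ‖f k‖ ^ 2 := by
    refine hf2.mono' ((by have := continuous_rate γ₀; fun_prop :
      Continuous fun k => Real.exp (-(rate γ₀ k * h))).aestronglyMeasurable.mul hf2.1)
      (Eventually.of_forall fun k => ?_)
    rw [norm_mul, Real.norm_of_nonneg (Real.exp_pos _).le, Real.norm_of_nonneg (sq_nonneg _)]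
    exact mul_le_of_le_one_left (sq_nonneg _) (Real.exp_le_one_iff.2
      (by have := mul_nonneg (rate_nonneg hγ k) hh; linarith))
  have ir : Integrable fun k => rate γ₀ k * ‖f k‖ ^ 2 := by
    refine (hf2.const_mul (32 * γ₀)).mono' ((continuous_rate γ₀).aestronglyMeasurable.mul hf2.1)
      (Eventually.of_forall fun k => ?_)
    rw [norm_mul, Real.norm_of_nonneg (rate_nonneg hγ k), Real.norm_of_nonneg (sq_nonneg _)]
    exact mul_le_mul_of_nonneg_right (rate_le hγ k) (sq_nonneg _)
  -- The one place where symmetry is essential: the total gain of `|f|²` equals its total loss.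
  have hzint : 2 * γ₀ * ∫ k, z k = ∫ k, rate γ₀ k * ‖f k‖ ^ 2 := by
    rw [hz, integral_integral_swap iK, ← integral_const_mul]
    refine integral_congr_ae (Eventually.of_forall fun k => ?_)
    simp only [integral_mul_const, rate, totalKernel, mul_assoc]
    simp only [scatKernel_comm _ k]
  have hint : ∫ k, (Real.exp (-(rate γ₀ k * h)) * ‖f k‖ ^ 2 + 2 * γ₀ * h * z k) ≤
      (1 + (32 * γ₀ * h) ^ 2) * ∫ k, ‖f k‖ ^ 2 := by
    rw [integral_add ie (iz.const_mul _), integral_const_mul]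
    have h1 : 2 * γ₀ * h * ∫ k, z k = ∫ k, h * (rate γ₀ k * ‖f k‖ ^ 2) := by
      rw [integral_const_mul, ← hzint]; ring
    rw [h1, ← integral_add ie (ir.const_mul _), ← integral_const_mul]
    refine integral_mono (ie.add (ir.const_mul _)) (hf2.const_mul _) fun k => ?_
    have h2 : 0 ≤ rate γ₀ k * h := mul_nonneg (rate_nonneg hγ k) hh
    have h3 := exp_neg_add_self_le h2
    have h4 : (rate γ₀ k * h) ^ 2 ≤ (32 * γ₀ * h) ^ 2 :=
      pow_le_pow_left₀ h2 (mul_le_mul_of_nonneg_right (rate_le hγ k) hh) 2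
    have h5 := mul_le_mul_of_nonneg_right (show Real.exp (-(rate γ₀ k * h)) + rate γ₀ k * h ≤
      1 + (32 * γ₀ * h) ^ 2 by linarith) (sq_nonneg ‖f k‖)
    simp only
    linarith
  calc _ ≤ ∫⁻ k, ENNReal.ofReal (Real.exp (-(rate γ₀ k * h)) * ‖f k‖ ^ 2 + 2 * γ₀ * h * z k) :=
        lintegral_mono fun k => by
          rw [enorm_sq_eq_ofReal]; exact ENNReal.ofReal_le_ofReal (hpw k)
    _ = ENNReal.ofReal (∫ k, (Real.exp (-(rate γ₀ k * h)) * ‖f k‖ ^ 2 + 2 * γ₀ * h * z k)) := by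
        refine (ofReal_integral_eq_lintegral_ofReal (ie.add (iz.const_mul _))
          (Eventually.of_forall fun k => ?_)).symm
        exact add_nonneg (mul_nonneg (Real.exp_pos _).le (sq_nonneg _)) (mul_nonneg hc (hz0 k))
    _ ≤ _ := by
        rw [lintegral_enorm_sq hf, ← ENNReal.ofReal_mul (by positivity)]
        exact ENNReal.ofReal_le_ofReal hint

end Slice

lemma ae_memLp_slice {F : ℝ × UnitAddCircle → 𝕜} (hF : MemLp F 2 volume) :
    ∀ᵐ y : ℝ, MemLp (fun k => F (y, k)) 2 volume := by
  have h1 := (memLp_two_iff_integrable_sq_norm hF.1).1 hF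
  have h2 := Integrable.prod_right_ae (μ := volume) (ν := volume) h1
  have h3 := AEStronglyMeasurable.prodMk_left (μ := volume) (ν := volume) hF.1
  filter_upwards [h2, h3] with y e2 e3
  exact (memLp_two_iff_integrable_sq_norm e3).2 e2

lemma lintegral_le_of_slice_le {F G : ℝ × UnitAddCircle → 𝕜} (hF : AEStronglyMeasurable F volume)
    (hG : AEStronglyMeasurable G volume) (c : ENNReal)
    (h : ∀ᵐ y : ℝ, ∫⁻ k : UnitAddCircle, ‖G (y, k)‖ₑ ^ 2 ≤
      c * ∫⁻ k : UnitAddCircle, ‖F (y, k)‖ₑ ^ 2) :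
    ∫⁻ x, ‖G x‖ₑ ^ 2 ≤ c * ∫⁻ x, ‖F x‖ₑ ^ 2 := by
  have hF' : AEMeasurable (fun x => ‖F x‖ₑ ^ 2) (volume : Measure (ℝ × UnitAddCircle)) := by
    fun_prop
  have hG' : AEMeasurable (fun x => ‖G x‖ₑ ^ 2) (volume : Measure (ℝ × UnitAddCircle)) := by
    fun_prop
  rw [Measure.volume_eq_prod] at hF' hG' ⊢
  rw [lintegral_prod _ hF', lintegral_prod _ hG', ← lintegral_const_mul'' _ hF'.lintegral_prod_right']
  exact lintegral_mono_ae h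

lemma scatter_congr {F G : ℝ × UnitAddCircle → 𝕜} (h : F =ᵐ[volume] G) :
    scatter F =ᵐ[volume] scatter G := by
  have h1 : ∀ᵐ y : ℝ, ∀ᵐ k : UnitAddCircle, F (y, k) = G (y, k) :=
    Measure.ae_ae_of_ae_prod (μ := volume) (ν := volume) h
  have h2 : ∀ᵐ x : ℝ × UnitAddCircle, ∀ᵐ k : UnitAddCircle, F (x.1, k) = G (x.1, k) :=
    Measure.quasiMeasurePreserving_fst.ae h1
  filter_upwards [h2] with x hx
  refine integral_congr_ae ?_
  filter_upwards [hx] with k hk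
  rw [hk]

lemma aestronglyMeasurable_scatter {F : ℝ × UnitAddCircle → 𝕜}
    (hF : AEStronglyMeasurable F volume) : AEStronglyMeasurable (scatter F) volume := by
  refine AEStronglyMeasurable.congr ?_ (scatter_congr hF.ae_eq_mk).symm
  refine StronglyMeasurable.aestronglyMeasurable ?_
  refine StronglyMeasurable.integral_prod_right' (ν := volume)
    (f := fun q : (ℝ × UnitAddCircle) × UnitAddCircle =>
      scatKernel q.1.2 q.2 • hF.mk F (q.1.1, q.2)) ?_
  refine StronglyMeasurable.smul ?_ ?_
  · exact (continuous_scatKernel.comp (by fun_prop :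
      Continuous fun q : (ℝ × UnitAddCircle) × UnitAddCircle => (q.1.2, q.2))).stronglyMeasurable
  · exact hF.stronglyMeasurable_mk.comp_measurable (by fun_prop)

lemma exists_scatterOperator : ∃ A : L2 𝕜 →L[𝕜] L2 𝕜, IsGivenBy A scatter := by
  have hex := exists_isGivenBy (𝕜 := 𝕜) scatter 16
    (fun F hF => aestronglyMeasurable_scatter hF.1) ?_ ?_ ?_
  · obtain ⟨A, hA, -⟩ := hex
    exact ⟨A, hA⟩
  · intro F G hF hG
    have h1 : ∀ᵐ x : ℝ × UnitAddCircle, MemLp (fun k => F (x.1, k)) 2 volume :=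
      Measure.quasiMeasurePreserving_fst.ae (ae_memLp_slice hF)
    have h2 : ∀ᵐ x : ℝ × UnitAddCircle, MemLp (fun k => G (x.1, k)) 2 volume :=
      Measure.quasiMeasurePreserving_fst.ae (ae_memLp_slice hG)
    filter_upwards [h1, h2] with x e1 e2
    simp only [scatter, Pi.add_apply, smul_add]
    exact integral_add (integrable_scatKernel_smul (e1.integrable one_le_two) _)
      (integrable_scatKernel_smul (e2.integrable one_le_two) _)
  · intro c F _
    refine Eventually.of_forall fun x => ?_
    simp only [scatter, Pi.smul_apply]
    rw [← integral_smul]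
    simp only [smul_comm c]
  · intro F hF
    refine lintegral_le_of_slice_le hF.1 (aestronglyMeasurable_scatter hF.1) _ ?_
    filter_upwards [ae_memLp_slice hF] with y hy using lintegral_scatter_slice_le hy

/-- One step of the explicit Euler scheme for the collisions increases the `L²`-norm at second
order only. -/
lemma lintegral_euler_le (hγ : 0 < γ₀) {h : ℝ} (hh : 0 ≤ h) {F : ℝ × UnitAddCircle → 𝕜}
    (hF : MemLp F 2 volume) :
    ∫⁻ x, ‖Real.exp (-(rate γ₀ x.2 * h)) • (F x + (2 * γ₀ * h) • scatter F x)‖ₑ ^ 2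
      ≤ ENNReal.ofReal (1 + (32 * γ₀ * h) ^ 2) * ∫⁻ x, ‖F x‖ₑ ^ 2 := by
  refine lintegral_le_of_slice_le hF.1 ?_ _ ?_
  · have := continuous_rate γ₀
    exact (by fun_prop : Continuous fun x : ℝ × UnitAddCircle =>
      Real.exp (-(rate γ₀ x.2 * h))).aestronglyMeasurable.smul
      (hF.1.add ((aestronglyMeasurable_scatter hF.1).const_smul _))
  · filter_upwards [ae_memLp_slice hF] with y hy using lintegral_euler_slice_le hγ hh hy

end
end KineticInterface

namespace KineticInterface
noncomputable section

set_option linter.unusedSectionVars false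

/-! ### Bounded perturbations of a strongly continuous family of contractions -/

section Dyson

variable {𝕜 X : Type*} [RCLike 𝕜] [NormedAddCommGroup X] [NormedSpace ℝ X] [NormedSpace 𝕜 X]
  [SMulCommClass ℝ 𝕜 X] [CompleteSpace X] {U : ℝ → X →L[𝕜] X} {B : X →L[𝕜] X}

/-- A strongly continuous family of contractions. -/
structure IsContractive (U : ℝ → X →L[𝕜] X) : Prop where
  le : ∀ t f, ‖U t f‖ ≤ ‖f‖
  cont : ∀ f, Continuous fun t => U t f

lemma IsContractive.continuous_apply (h : IsContractive U) {E : Type*} [TopologicalSpace E]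
    {τ : E → ℝ} {g : E → X} (hτ : Continuous τ) (hg : Continuous g) :
    Continuous fun e => U (τ e) (g e) := by
  refine continuous_iff_continuousAt.2 fun e₀ => ?_
  have h1 : Tendsto (fun e => U (τ e) (g e - g e₀)) (𝓝 e₀) (𝓝 0) := by
    refine squeeze_zero_norm (fun e => h.le _ _) ?_
    have := ((hg.sub continuous_const).norm : Continuous fun e => ‖g e - g e₀‖).tendsto e₀
    simpa using this
  have h2 : Tendsto (fun e => U (τ e) (g e₀)) (𝓝 e₀) (𝓝 (U (τ e₀) (g e₀))) :=
    ((h.cont (g e₀)).comp hτ).tendsto e₀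
  have h3 := h1.add h2
  simpa [ContinuousAt] using h3

/-- The terms of the Dyson series. -/
def dyson (U : ℝ → X →L[𝕜] X) (B : X →L[𝕜] X) : ℕ → ℝ → X → X
  | 0, t, f => U t f
  | n + 1, t, f => ∫ s in (0 : ℝ)..t, U (t - s) (B (dyson U B n s f))

lemma IsContractive.continuous_duhamel (h : IsContractive U) {u : ℝ → X} (hu : Continuous u) :
    Continuous fun t => ∫ s in (0 : ℝ)..t, U (t - s) (B (u s)) := by
  refine intervalIntegral.continuous_parametric_intervalIntegral_of_continuous
    (f := fun t s => U (t - s) (B (u s))) ?_ continuous_id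
  exact h.continuous_apply (by fun_prop) (B.continuous.comp (hu.comp continuous_snd))

lemma IsContractive.continuous_integrand (h : IsContractive U) {u : ℝ → X} (hu : Continuous u)
    (t : ℝ) : Continuous fun s => U (t - s) (B (u s)) :=
  h.continuous_apply (by fun_prop) (B.continuous.comp hu)

lemma IsContractive.continuous_dyson (h : IsContractive U) (n : ℕ) (f : X) :
    Continuous fun t => dyson U B n t f := by
  cases n with
  | zero => exact h.cont f
  | succ n => exact h.continuous_duhamel (h.continuous_dyson n f)

lemma IsContractive.dyson_add (h : IsContractive U) (n : ℕ) (t : ℝ) (f g : X) :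
    dyson U B n t (f + g) = dyson U B n t f + dyson U B n t g := by
  induction n generalizing t with
  | zero => simp [dyson]
  | succ n ih =>
    simp only [dyson, ih, map_add]
    exact intervalIntegral.integral_add
      ((h.continuous_integrand (h.continuous_dyson n f) t).intervalIntegrable _ _)
      ((h.continuous_integrand (h.continuous_dyson n g) t).intervalIntegrable _ _)

lemma dyson_smul (n : ℕ) (t : ℝ) (c : 𝕜) (f : X) :
    dyson U B n t (c • f) = c • dyson U B n t f := by
  induction n generalizing t with
  | zero => simp [dyson]
  | succ n ih =>
    simp only [dyson, ih, map_smul]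
    exact intervalIntegral.integral_smul _ _

lemma IsContractive.norm_dyson_le (h : IsContractive U) (n : ℕ) {t : ℝ} (ht : 0 ≤ t) (f : X) :
    ‖dyson U B n t f‖ ≤ (‖B‖ * t) ^ n / n.factorial * ‖f‖ := by
  induction n generalizing t with
  | zero => simpa [dyson] using h.le t f
  | succ n ih =>
    have h1 : ‖dyson U B (n + 1) t f‖ ≤
        ∫ s in (0 : ℝ)..t, (‖B‖ ^ (n + 1) / n.factorial * ‖f‖) * s ^ n := by
      refine intervalIntegral.norm_integral_le_of_norm_le ht ?_
        (Continuous.intervalIntegrable (by fun_prop) _ _)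
      filter_upwards with s hs
      calc ‖U (t - s) (B (dyson U B n s f))‖ ≤ ‖B‖ * ‖dyson U B n s f‖ :=
            (h.le _ _).trans (B.le_opNorm _)
        _ ≤ ‖B‖ * ((‖B‖ * s) ^ n / n.factorial * ‖f‖) := by gcongr; exact ih hs.1.le
        _ = _ := by ring
    refine h1.trans_eq ?_
    rw [intervalIntegral.integral_const_mul, integral_pow, Nat.factorial_succ]
    push_cast
    have : (n.factorial : ℝ) ≠ 0 := by positivity
    field_simp
    ring

lemma summable_dyson_bound (t : ℝ) (f : X) :
    Summable fun n : ℕ => (‖B‖ * t) ^ n / n.factorial * ‖f‖ :=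
  (Real.summable_pow_div_factorial _).mul_right _

lemma IsContractive.summable_dyson (h : IsContractive U) {t : ℝ} (ht : 0 ≤ t) (f : X) :
    Summable fun n => dyson U B n t f :=
  Summable.of_norm_bounded (summable_dyson_bound t f) fun n => h.norm_dyson_le n ht f

/-- Partial sums of the Dyson series obey the Picard recursion, which is how they are matched with
the pointwise iterates. -/
lemma IsContractive.sum_dyson_succ (h : IsContractive U) (n : ℕ) (t : ℝ) (f : X) :
    ∑ m ∈ Finset.range (n + 1), dyson U B m t f = U t f + ∫ s in (0 : ℝ)..t,
      U (t - s) (B (∑ m ∈ Finset.range n, dyson U B m s f)) := by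
  rw [Finset.sum_range_succ']
  simp only [map_sum]
  rw [intervalIntegral.integral_finsetSum fun m _ =>
    (h.continuous_integrand (h.continuous_dyson m f) t).intervalIntegrable _ _, add_comm]
  rfl

/-- The Dyson series. -/
lemma IsContractive.exists_dyson_sum (h : IsContractive U) (B : X →L[𝕜] X) :
    ∃ S : ℝ → X →L[𝕜] X, (∀ f, Continuous fun t => S t f) ∧
      (∀ t f, 0 ≤ t → HasSum (fun n => dyson U B n t f) (S t f)) ∧
      ∀ t f, 0 ≤ t → S t f = U t f + ∫ s in (0 : ℝ)..t, U (t - s) (B (S s f)) := by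
  have hm : ∀ t : ℝ, 0 ≤ max t 0 := fun t => le_max_right _ _
  let L : ℝ → X →ₗ[𝕜] X := fun t =>
    { toFun := fun f => ∑' n, dyson U B n (max t 0) f
      map_add' := fun f g => by
        simp only [h.dyson_add]
        exact (h.summable_dyson (hm t) f).tsum_add (h.summable_dyson (hm t) g)
      map_smul' := fun c f => by
        simp only [dyson_smul]
        exact (h.summable_dyson (hm t) f).tsum_const_smul c }
  have hL : ∀ t f, ‖L t f‖ ≤ Real.exp (‖B‖ * max t 0) * ‖f‖ := by
    intro t f
    refine (tsum_of_norm_bounded (summable_dyson_bound (B := B) (max t 0) f).hasSum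
      fun n => h.norm_dyson_le n (hm t) f).trans_eq ?_
    rw [tsum_mul_right, Real.exp_eq_exp_ℝ, NormedSpace.exp_eq_tsum_div]
  have hcont : ∀ f, Continuous fun t => ∑' n, dyson U B n (max t 0) f := by
    intro f
    refine continuous_iff_continuousAt.2 fun t₀ => ?_
    have h1 : ContinuousOn (fun t => ∑' n, dyson U B n (max t 0) f) (Iio (|t₀| + 1)) := by
      refine continuousOn_tsum (u := fun n : ℕ => (‖B‖ * (|t₀| + 1)) ^ n / n.factorial * ‖f‖)
        (fun n => ((h.continuous_dyson n f).comp (by fun_prop)).continuousOn)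
        (summable_dyson_bound _ f) fun n t ht => (h.norm_dyson_le n (hm t) f).trans ?_
      have : max t 0 ≤ |t₀| + 1 := max_le (le_of_lt ht) (by positivity)
      gcongr
    exact h1.continuousAt (Iio_mem_nhds (by linarith [le_abs_self t₀]))
  have hsum : ∀ t f, 0 ≤ t → HasSum (fun n => dyson U B n t f) ((L t).mkContinuous _ (hL t) f) := by
    intro t f ht
    change HasSum _ (∑' n, dyson U B n (max t 0) f)
    rw [max_eq_left ht]
    exact (h.summable_dyson ht f).hasSum
  refine ⟨fun t => (L t).mkContinuous _ (hL t), hcont, hsum, fun t f ht => ?_⟩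
  have h1 := (hsum t f ht)
  have h2 : HasSum (fun n => dyson U B (n + 1) t f)
      (∫ s in (0 : ℝ)..t, U (t - s) (B ((L s).mkContinuous _ (hL s) f))) := by
    refine intervalIntegral.hasSum_integral_of_dominated_convergence
      (bound := fun n _ => ‖B‖ * ((‖B‖ * t) ^ n / n.factorial * ‖f‖)) (fun n =>
        (h.continuous_integrand (h.continuous_dyson n f) t).aestronglyMeasurable) (fun n => ?_)
      (Eventually.of_forall fun _ _ => (summable_dyson_bound t f).mul_left _)
      (Continuous.intervalIntegrable (by fun_prop) _ _) ?_
    · filter_upwards with s hs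
      rw [uIoc_of_le ht] at hs
      refine ((h.le _ _).trans (B.le_opNorm _)).trans ?_
      gcongr
      refine (h.norm_dyson_le n hs.1.le f).trans ?_
      have := hs.1.le
      have := hs.2
      gcongr
    · filter_upwards with s hs
      rw [uIoc_of_le ht] at hs
      exact ((hsum s f hs.1.le).mapL B).mapL (U (t - s))
  have h3 : dyson U B 0 t f = U t f := rfl
  exact h1.unique ((hasSum_nat_add_iff' 1).1 (by
    rwa [Finset.sum_range_one, h3, add_sub_cancel_left]))

/-- A locally integrable solution of the homogeneous Duhamel equation vanishes. -/
lemma IsContractive.duhamel_unique (h : IsContractive U) {z : ℝ → X}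
    (hz : ∀ t, 0 ≤ t → IntervalIntegrable z volume 0 t)
    (he : ∀ t, 0 ≤ t → z t = ∫ s in (0 : ℝ)..t, U (t - s) (B (z s))) {t : ℝ} (ht : 0 ≤ t) :
    z t = 0 := by
  -- As `z` is merely integrable, Gronwall is applied to the integral of the continuous function
  -- `φ`, which is `C¹`, using `‖z‖ ≤ ‖B‖ φ` once more.
  set φ : ℝ → ℝ := fun t => ∫ s in (0 : ℝ)..t, ‖z s‖ with hφ
  have hφ0 : ∀ t, 0 ≤ t → 0 ≤ φ t := fun t ht =>
    intervalIntegral.integral_nonneg ht fun s _ => norm_nonneg _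
  have h1 : ∀ t, 0 ≤ t → ‖z t‖ ≤ ‖B‖ * φ t := by
    intro t ht
    rw [he t ht, hφ, ← intervalIntegral.integral_const_mul]
    refine intervalIntegral.norm_integral_le_of_norm_le ht ?_ ((hz t ht).norm.const_mul _)
    filter_upwards with s hs using (h.le _ _).trans (B.le_opNorm _)
  set T := t + 1 with hT
  have hT0 : 0 ≤ T := by positivity
  have hφc : ContinuousOn φ (Icc 0 T) := by
    have h2 : IntegrableOn (fun s => ‖z s‖) (uIcc 0 T) := by
      rw [uIcc_of_le hT0]
      exact (intervalIntegrable_iff_integrableOn_Icc_of_le hT0).1 (hz T hT0).norm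
    have h3 := intervalIntegral.continuousOn_primitive_interval h2
    rwa [uIcc_of_le hT0] at h3
  set φ' : ℝ → ℝ := IccExtend hT0 ((Icc 0 T).domRestrict φ) with hφ'
  have hφ'c : Continuous φ' := (continuousOn_iff_continuous_domRestrict.1 hφc).Icc_extend'
  have hφ'e : ∀ s ∈ Icc 0 T, φ' s = φ s := fun s hs => IccExtend_of_mem hT0 _ hs
  have hφψ : ∀ x ∈ Icc 0 T, φ x ≤ ‖B‖ * ∫ s in (0 : ℝ)..x, φ' s := by
    intro x hx
    rw [← intervalIntegral.integral_const_mul]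
    refine intervalIntegral.integral_mono_on hx.1 (hz x hx.1).norm
      ((hφ'c.intervalIntegrable _ _).const_mul _) fun s hs => ?_
    rw [hφ'e s ⟨hs.1, hs.2.trans hx.2⟩]
    exact h1 s hs.1
  have hψ := eq_zero_of_abs_deriv_le_mul_abs_self_of_eq_zero_right
    (f := fun t => ∫ s in (0 : ℝ)..t, φ' s) (f' := φ') (K := ‖B‖) (a := 0) (b := T)
    (intervalIntegral.continuous_primitive (fun a b => hφ'c.intervalIntegrable a b) 0).continuousOn
    (fun x _ => (hφ'c.integral_hasStrictDerivAt 0 x).hasDerivAt.hasDerivWithinAt)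
    (by simp) (fun x hx => ?_) t ⟨ht, by rw [hT]; linarith⟩
  · have h2 := hφψ t ⟨ht, by rw [hT]; linarith⟩
    rw [hψ, mul_zero] at h2
    have h3 := (h1 t ht).trans (mul_le_mul_of_nonneg_left h2 (norm_nonneg B))
    rw [mul_zero] at h3
    exact norm_le_zero_iff.1 h3
  · have hx' : x ∈ Icc 0 T := Ico_subset_Icc_self hx
    rw [hφ'e x hx', Real.norm_of_nonneg (hφ0 x hx.1)]
    exact (hφψ x hx').trans (mul_le_mul_of_nonneg_left (le_abs_self _) (norm_nonneg _))

end Dyson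

end
end KineticInterface

namespace KineticInterface
noncomputable section

set_option linter.unusedSectionVars false

/-! ### Strong continuity of the free evolution -/

variable {𝕜 : Type*} [RCLike 𝕜] {α : ℤ → ℝ} {p : ℝ → ℝ} {γ₀ γ₁ : ℝ}

/-- Dominated convergence for the squared distance, followed by continuity of the square root at
`0`. -/
lemma tendsto_eLpNorm_sub_of_dominated {β ι : Type*} [MeasurableSpace β] {μ : Measure β}
    {l : Filter ι} [l.IsCountablyGenerated] {G : ι → β → 𝕜} {H : β → 𝕜} (b : β → ENNReal)
    (hb : ∫⁻ x, b x ∂μ ≠ ⊤) (hG : ∀ i, AEStronglyMeasurable (G i) μ)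
    (hH : AEStronglyMeasurable H μ) (hbd : ∀ᶠ i in l, ∀ᵐ x ∂μ, ‖G i x - H x‖ₑ ^ 2 ≤ b x)
    (hlim : ∀ᵐ x ∂μ, Tendsto (fun i => G i x) l (𝓝 (H x))) :
    Tendsto (fun i => eLpNorm (G i - H) 2 μ) l (𝓝 0) := by
  have h1 : Tendsto (fun i => ∫⁻ x, ‖G i x - H x‖ₑ ^ 2 ∂μ) l (𝓝 (∫⁻ _, 0 ∂μ)) := by
    refine tendsto_lintegral_filter_of_dominated_convergence' b
      (Eventually.of_forall fun i => ((hG i).sub hH).enorm.pow_const 2) hbd hb ?_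
    filter_upwards [hlim] with x hx
    have h2 : Tendsto (fun i => ‖G i x - H x‖ₑ) l (𝓝 0) := by
      have := (hx.sub_const (H x)).enorm
      simpa using this
    have := ((ENNReal.continuous_pow 2).tendsto 0).comp h2
    simpa [Function.comp_def] using this
  rw [lintegral_zero] at h1
  have h2 : ∀ i, eLpNorm (G i - H) 2 μ = (∫⁻ x, ‖G i x - H x‖ₑ ^ 2 ∂μ) ^ (1 / 2 : ℝ) := by
    intro i
    have h3 := eLpNorm_two_sq μ (G i - H)
    simp only [Pi.sub_apply] at h3
    rw [← h3, ← ENNReal.rpow_natCast, ← ENNReal.rpow_mul]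
    norm_num
  simp only [h2]
  have h4 := ((ENNReal.continuous_rpow_const (y := (1 / 2 : ℝ))).tendsto 0).comp h1
  simpa [Function.comp_def] using h4

/-- Continuous functions supported in a compact subset of `ℝ × 𝕋_*` that vanish at the
interface. -/
structure IsTest (F : ℝ × UnitAddCircle → 𝕜) : Prop where
  cont : Continuous F
  supp : ∃ r, ∀ x : ℝ × UnitAddCircle, r < |x.1| → F x = 0
  away : ∃ δ > 0, ∀ x : ℝ × UnitAddCircle, ‖x.2‖ < δ → F x = 0
  interface : ∀ k, F (0, k) = 0

lemma IsTest.hasCompactSupport {F : ℝ × UnitAddCircle → 𝕜} (hF : IsTest F) :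
    HasCompactSupport F := by
  obtain ⟨r, hr⟩ := hF.supp
  refine HasCompactSupport.intro (K := Icc (-r) r ×ˢ univ) (isCompact_Icc.prod isCompact_univ) ?_
  intro x hx
  refine hr x ?_
  by_contra hcon
  exact hx ⟨abs_le.1 (not_lt.1 hcon), mem_univ _⟩

lemma IsTest.memLp {F : ℝ × UnitAddCircle → 𝕜} (hF : IsTest F) : MemLp F 2 volume :=
  hF.cont.memLp_of_hasCompactSupport hF.hasCompactSupport

lemma IsTest.exists_bound {F : ℝ × UnitAddCircle → 𝕜} (hF : IsTest F) : ∃ M, ∀ x, ‖F x‖ ≤ M :=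
  hF.hasCompactSupport.exists_bound_of_continuous hF.cont

lemma IsTest.isC0 {F : ℝ × UnitAddCircle → 𝕜} (hF : IsTest F) : IsC0 α γ₁ F := by
  obtain ⟨M, hM⟩ := hF.exists_bound
  refine ⟨hF.cont.continuousOn, ⟨M, fun y k _ _ => hM _⟩, F, F, hF.cont.continuousOn,
    fun _ _ => rfl, hF.cont.continuousOn, fun _ _ => rfl, ?_, ?_⟩
  · intro k _
    simp [hF.interface]
  · intro k _
    simp [hF.interface]

/-- The cutoff function of a test function. -/
def cutoff (n : ℕ) (x : ℝ × UnitAddCircle) : ℝ :=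
  min 1 (n * |x.1|) * max 0 (min 1 (n * ‖x.2‖ - 1))

lemma continuous_cutoff (n : ℕ) : Continuous (cutoff n) := by
  unfold cutoff
  fun_prop

lemma cutoff_mem (n : ℕ) (x : ℝ × UnitAddCircle) : cutoff n x ∈ Icc (0 : ℝ) 1 := by
  have h1 : 0 ≤ min 1 (n * |x.1|) := le_min zero_le_one (by positivity)
  have h2 : 0 ≤ max 0 (min 1 (n * ‖x.2‖ - 1)) := le_max_left _ _
  have h3 : max 0 (min 1 (n * ‖x.2‖ - 1)) ≤ 1 := max_le zero_le_one (min_le_left _ _)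
  exact ⟨mul_nonneg h1 h2, mul_le_one₀ (min_le_left _ _) h2 h3⟩

lemma tendsto_cutoff {x : ℝ × UnitAddCircle} (h1 : x.1 ≠ 0) (h2 : x.2 ≠ 0) :
    Tendsto (fun n => cutoff n x) atTop (𝓝 1) := by
  have a1 : Tendsto (fun n : ℕ => (n : ℝ) * |x.1|) atTop atTop :=
    tendsto_natCast_atTop_atTop.atTop_mul_const (abs_pos.2 h1)
  have a2 : Tendsto (fun n : ℕ => (n : ℝ) * ‖x.2‖) atTop atTop :=
    tendsto_natCast_atTop_atTop.atTop_mul_const (norm_pos_iff.2 h2)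
  refine tendsto_const_nhds.congr' ?_
  filter_upwards [a1.eventually_ge_atTop 1, a2.eventually_ge_atTop 2] with n e1 e2
  rw [cutoff, min_eq_left e1, min_eq_left (by linarith), max_eq_right zero_le_one, mul_one]

lemma isTest_cutoff_smul (n : ℕ) {g : ℝ × UnitAddCircle → 𝕜} (hg : Continuous g)
    (hs : HasCompactSupport g) : IsTest fun x => cutoff n x • g x := by
  refine ⟨(continuous_cutoff n).smul hg, ?_, ?_, fun k => ?_⟩
  · obtain ⟨r, hr⟩ := hs.isCompact.isBounded.exists_norm_le
    refine ⟨r, fun x hx => ?_⟩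
    have : g x = 0 := by
      by_contra hcon
      have h1 := hr x (subset_tsupport g hcon)
      have h2 := norm_fst_le x
      rw [Real.norm_eq_abs] at h2
      linarith
    simp [this]
  -- The radius `1/(n + 1)` works also for `n = 0`, and `n‖k‖ < 1` within it.
  · refine ⟨1 / (n + 1), by positivity, fun x hx => ?_⟩
    have h1 : n * ‖x.2‖ - 1 ≤ 0 := by
      rw [lt_div_iff₀ (by positivity)] at hx
      nlinarith [norm_nonneg x.2]
    have h2 : max 0 (min 1 (n * ‖x.2‖ - 1)) = 0 := max_eq_left ((min_le_right _ _).trans h1)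
    simp [cutoff, h2]
  · simp [cutoff]

/-- The sets `y = 0` and `k = 0` are null, so cutting off near them changes a compactly supported
continuous approximation by little. -/
lemma exists_test_near (f : L2 𝕜) {ε : ℝ} (hε : 0 < ε) :
    ∃ (F : ℝ × UnitAddCircle → 𝕜) (hF : IsTest F), ‖f - hF.memLp.toLp F‖ < ε := by
  obtain ⟨g, hgs, hgn, hgc, hgm⟩ := (Lp.memLp f).exists_hasCompactSupport_eLpNorm_sub_le
    (by norm_num) (ε := ENNReal.ofReal (ε / 2)) (by simpa using hε)
  have hlim : Tendsto (fun n : ℕ => eLpNorm ((fun x => cutoff n x • g x) - g) 2 volume) atTop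
      (𝓝 0) := by
    refine tendsto_eLpNorm_sub_of_dominated (fun x => ‖g x‖ₑ ^ 2) ?_
      (fun n => ((continuous_cutoff n).smul hgc).aestronglyMeasurable) hgm.1
      (Eventually.of_forall fun n => Eventually.of_forall fun x => ?_) ?_
    · rw [← eLpNorm_two_sq]
      exact ENNReal.pow_ne_top hgm.2.ne
    · gcongr
      rw [enorm_le_iff_norm_le, show cutoff n x • g x - g x = (cutoff n x - 1) • g x by
        rw [sub_smul, one_smul], norm_smul]
      have := cutoff_mem n x
      refine mul_le_of_le_one_left (norm_nonneg _) ?_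
      rw [Real.norm_eq_abs, abs_le]
      constructor <;> linarith [this.1, this.2]
    · filter_upwards [ae_fst_ne_zero, ae_snd_ne_zero] with x h1 h2
      have := (tendsto_cutoff h1 h2).smul_const (g x)
      rwa [one_smul] at this
  obtain ⟨n, hn⟩ := (hlim.eventually (gt_mem_nhds (show 0 < ENNReal.ofReal (ε / 2) by
    simpa using hε))).exists
  have hF := isTest_cutoff_smul n hgc hgs
  refine ⟨_, hF, ?_⟩
  have h1 : ‖f - hgm.toLp g‖ ≤ ε / 2 := by
    rw [← Lp.toLp_coeFn f (Lp.memLp f), ← MemLp.toLp_sub, Lp.norm_toLp]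
    exact ENNReal.toReal_le_of_le_ofReal (by positivity) hgn
  have h2 : ‖hF.memLp.toLp _ - hgm.toLp g‖ < ε / 2 := by
    rw [← MemLp.toLp_sub, Lp.norm_toLp]
    exact (ENNReal.toReal_lt_of_lt_ofReal hn)
  calc _ = ‖(f - hgm.toLp g) - (hF.memLp.toLp _ - hgm.toLp g)‖ := by congr 1; abel
    _ ≤ _ := norm_sub_le _ _
    _ < ε := by linarith

/-- For fixed `(y, k)` the case distinction switches only when the front `vel α k * t` passes `y`.
-/
lemma continuousAt_unperturbed {F : ℝ × UnitAddCircle → 𝕜} (hF : Continuous F) {t y : ℝ}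
    {k : UnitAddCircle} (hyt : y ≠ vel α k * t) :
    ContinuousAt (fun t => unperturbed α γ₀ γ₁ t F (y, k)) t := by
  have c1 : Continuous fun t => Real.exp (-(2 * γ₀ * totalKernel k * t)) := by fun_prop
  have c2 : Continuous fun t => F (y - vel α k * t, k) := by fun_prop
  have c3 : Continuous fun t => F (-y + vel α k * t, -k) := by fun_prop
  have hvt : ContinuousAt (fun t => vel α k * t) t := by fun_prop
  refine c1.continuousAt.smul ?_
  by_cases hc : y ∈ uIcc 0 (vel α k * t)
  · have hev : ∀ᶠ s in 𝓝 t, y ∈ uIcc 0 (vel α k * s) := by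
      rcases mem_uIcc.1 hc with ⟨h1, h2⟩ | ⟨h1, h2⟩
      · filter_upwards [hvt.eventually (lt_mem_nhds (lt_of_le_of_ne h2 hyt))] with s hs
        exact mem_uIcc.2 (Or.inl ⟨h1, hs.le⟩)
      · filter_upwards [hvt.eventually (gt_mem_nhds (lt_of_le_of_ne h1 hyt.symm))] with s hs
        exact mem_uIcc.2 (Or.inr ⟨hs.le, h2⟩)
    refine ContinuousAt.congr (f := fun t => pPlus α γ₁ k • F (y - vel α k * t, k) +
      pMinus α γ₁ k • F (-y + vel α k * t, -k)) (by fun_prop) ?_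
    filter_upwards [hev] with s hs
    rw [if_pos hs]
  · have hev : ∀ᶠ s in 𝓝 t, y ∉ uIcc 0 (vel α k * s) := by
      have hc' : y < min 0 (vel α k * t) ∨ max 0 (vel α k * t) < y := by
        rw [uIcc, mem_Icc, not_and_or, not_le, not_le] at hc
        exact hc
      rcases hc' with h1 | h1
      · have c4 : ContinuousAt (fun t => min 0 (vel α k * t)) t := by fun_prop
        filter_upwards [c4.eventually (lt_mem_nhds h1)] with s hs h2
        exact absurd h2.1 (not_le.2 hs)
      · have c4 : ContinuousAt (fun t => max 0 (vel α k * t)) t := by fun_prop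
        filter_upwards [c4.eventually (gt_mem_nhds h1)] with s hs h2
        exact absurd h2.2 (not_le.2 hs)
    refine ContinuousAt.congr c2.continuousAt ?_
    filter_upwards [hev] with s hs
    rw [if_neg hs]

lemma IsProfile.ae_ne_vel_mul (hp : IsProfile α p) (t : ℝ) :
    ∀ᵐ x : ℝ × UnitAddCircle, x.1 ≠ vel α x.2 * t := by
  have h := (measurePreserving_shear (hp.measurable_vel.mul_const t)).quasiMeasurePreserving.ae
    ae_fst_ne_zero
  filter_upwards [h] with x hx
  exact sub_ne_zero.1 hx

/-- Finite speed of propagation: a test function vanishes near `k = 0`, and on the remaining compact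
set of `k` the velocity is bounded. Reflection preserves `‖k‖`. -/
lemma IsProfile.unperturbed_test_bound (hp : IsProfile α p) (hγ₀ : 0 < γ₀) (hγ₁ : 0 < γ₁)
    {F : ℝ × UnitAddCircle → 𝕜} (hF : IsTest F) (T : ℝ) : ∃ M r : ℝ, ∀ t, 0 ≤ t → t ≤ T → ∀ x,
      ‖unperturbed α γ₀ γ₁ t F x‖ ≤ (Icc (-r) r ×ˢ univ).indicator (fun _ => M) x := by
  obtain ⟨M, hM⟩ := hF.exists_bound
  obtain ⟨r, hr⟩ := hF.supp
  obtain ⟨δ, hδ, hFδ⟩ := hF.away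
  have hK : IsCompact {k : UnitAddCircle | δ ≤ ‖k‖} :=
    (isClosed_le continuous_const continuous_norm).isCompact
  obtain ⟨C, hC⟩ := hK.exists_bound_of_continuousOn (f := vel α) fun k hk =>
    (hp.continuousAt_vel (norm_pos_iff.1 (hδ.trans_le hk))).continuousWithinAt
  have hM0 : 0 ≤ M := (norm_nonneg _).trans (hM 0)
  have hle : ∀ t, 0 ≤ t → ∀ x, ‖unperturbed α γ₀ γ₁ t F x‖ ≤ M := by
    intro t ht x
    rw [unperturbed, norm_smul, Real.norm_of_nonneg (Real.exp_pos _).le]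
    have h1 : Real.exp (-(2 * γ₀ * totalKernel x.2 * t)) ≤ 1 := Real.exp_le_one_iff.2
      (by have := mul_nonneg (rate_nonneg hγ₀ x.2) ht; rw [rate] at this; linarith)
    refine (mul_le_of_le_one_left (norm_nonneg _) h1).trans ?_
    split_ifs
    · rw [add_comm]
      exact hp.norm_mix_le hγ₁ x.2 (hM _) (hM _)
    · exact hM _
  refine ⟨M, r + |C| * |T|, fun t ht htT x => ?_⟩
  by_cases hx : x ∈ Icc (-(r + |C| * |T|)) (r + |C| * |T|) ×ˢ (univ : Set UnitAddCircle)
  · rw [indicator_of_mem hx]; exact hle t ht x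
  · rw [indicator_of_notMem hx, norm_le_zero_iff]
    have hx' : r + |C| * |T| < |x.1| := by
      by_contra hcon
      exact hx ⟨abs_le.1 (not_lt.1 hcon), mem_univ _⟩
    have key : F (x.1 - vel α x.2 * t, x.2) = 0 ∧ F (-x.1 + vel α x.2 * t, -x.2) = 0 := by
      by_cases hk : ‖x.2‖ < δ
      · exact ⟨hFδ _ hk, hFδ _ (by rwa [norm_neg])⟩
      · have h1 : |vel α x.2 * t| ≤ |C| * |T| := by
          rw [abs_mul, abs_of_nonneg ht]
          exact mul_le_mul ((hC x.2 (not_lt.1 hk)).trans (le_abs_self C))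
            (htT.trans (le_abs_self T)) ht (abs_nonneg C)
        have h2 : r < |x.1 - vel α x.2 * t| := by
          have := abs_sub_abs_le_abs_sub x.1 (vel α x.2 * t)
          linarith
        refine ⟨hr _ h2, hr _ ?_⟩
        rwa [neg_add_eq_sub, abs_sub_comm]
    rw [unperturbed, key.1, key.2]
    simp

/-- By contractivity, strong continuity need be checked only on test functions, where a common
compact support and a common bound justify dominated convergence. Freezing at `t = 0` for negative
times makes the family continuous on all of `ℝ`. -/
lemma IsProfile.exists_freeFamily (hp : IsProfile α p) (hγ₀ : 0 < γ₀) (hγ₁ : 0 < γ₁) :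
    ∃ U : ℝ → L2 𝕜 →L[𝕜] L2 𝕜, IsContractive U ∧
      ∀ t, 0 ≤ t → IsGivenBy (U t) (unperturbed α γ₀ γ₁ t) := by
  have hm : ∀ t : ℝ, 0 ≤ max t 0 := fun t => le_max_right _ _
  choose U hU hUle using fun t : ℝ => hp.exists_free (𝕜 := 𝕜) hγ₀ hγ₁ (hm t)
  refine ⟨U, ⟨hUle, fun f => ?_⟩, fun t ht => by
    have := hU t
    rwa [max_eq_left ht] at this⟩
  refine continuous_of_uniform_approx_of_continuous fun u hu => ?_
  obtain ⟨ε, hε, hεu⟩ := Metric.mem_uniformity_dist.1 hu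
  obtain ⟨F, hF, hFε⟩ := exists_test_near f hε
  refine ⟨fun t => U t (hF.memLp.toLp F), ?_, fun t => hεu ?_⟩
  · refine continuous_iff_continuousAt.2 fun t₀ => ?_
    rw [ContinuousAt, tendsto_iff_edist_tendsto_0]
    obtain ⟨M, r, hMr⟩ := hp.unperturbed_test_bound hγ₀ hγ₁ hF (|t₀| + 1)
    have he : ∀ t, edist (U t (hF.memLp.toLp F)) (U t₀ (hF.memLp.toLp F)) =
        eLpNorm (unperturbed α γ₀ γ₁ (max t 0) F - unperturbed α γ₀ γ₁ (max t₀ 0) F) 2 volume := by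
      intro t
      rw [Lp.edist_def]
      exact eLpNorm_congr_ae ((hU t F hF.memLp).sub (hU t₀ F hF.memLp))
    simp only [he]
    have hmeas : ∀ t, AEStronglyMeasurable (unperturbed α γ₀ γ₁ t F) volume := fun t =>
      hp.aestronglyMeasurable_unperturbed hγ₁ t hF.memLp.1
    refine tendsto_eLpNorm_sub_of_dominated
      ((Icc (-r) r ×ˢ univ).indicator fun _ => ENNReal.ofReal ((M + M) ^ 2)) ?_
      (fun t => hmeas _) (hmeas _) ?_ ?_
    · rw [lintegral_indicator_const (measurableSet_Icc.prod MeasurableSet.univ)]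
      refine ENNReal.mul_ne_top ENNReal.ofReal_ne_top ?_
      exact (isCompact_Icc.prod isCompact_univ).measure_lt_top.ne
    · have hn : ∀ᶠ t in 𝓝 t₀, t < |t₀| + 1 :=
        gt_mem_nhds (by linarith [le_abs_self t₀])
      filter_upwards [hn] with t ht
      refine Eventually.of_forall fun x => ?_
      have b1 := hMr (max t 0) (hm t) (max_le ht.le (by positivity)) x
      have b2 := hMr (max t₀ 0) (hm t₀)
        (max_le (by linarith [le_abs_self t₀]) (by positivity)) x
      have b3 := (norm_sub_le (unperturbed α γ₀ γ₁ (max t 0) F x)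
        (unperturbed α γ₀ γ₁ (max t₀ 0) F x)).trans (add_le_add b1 b2)
      rw [enorm_sq_eq_ofReal]
      by_cases hx : x ∈ Icc (-r) r ×ˢ (univ : Set UnitAddCircle)
      · rw [indicator_of_mem hx] at b3 ⊢
        exact ENNReal.ofReal_le_ofReal (pow_le_pow_left₀ (norm_nonneg _) b3 2)
      · rw [indicator_of_notMem hx, add_zero, norm_le_zero_iff] at b3
        simp [b3]
    · filter_upwards [hp.ae_ne_vel_mul (max t₀ 0)] with x h2
      exact ContinuousAt.comp (x := t₀) (f := fun t => max t 0)
        (g := fun t => unperturbed α γ₀ γ₁ t F x)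
        (continuousAt_unperturbed hF.cont h2) (by fun_prop)
  · rw [dist_eq_norm, ← map_sub]
    exact (hUle t _).trans_lt hFε

end
end KineticInterface

namespace KineticInterface
noncomputable section

set_option linter.unusedSectionVars false

/-! ### The mild equation in `L²` -/

variable {𝕜 : Type*} [RCLike 𝕜] {α : ℤ → ℝ} {p : ℝ → ℝ} {γ₀ γ₁ M : ℝ}

lemma IsGivenBy.apply_ae {A : L2 𝕜 →L[𝕜] L2 𝕜}
    {Φ : (ℝ × UnitAddCircle → 𝕜) → ℝ × UnitAddCircle → 𝕜} (h : IsGivenBy A Φ) {g : L2 𝕜}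
    {F : ℝ × UnitAddCircle → 𝕜} (hg : g =ᵐ[volume] F) : A g =ᵐ[volume] Φ F := by
  have hF : MemLp F 2 volume := (Lp.memLp g).ae_eq hg
  have he : g = hF.toLp F := Lp.ext (hg.trans hF.coeFn_toLp.symm)
  rw [he]
  exact h F hF

/-- The Bochner integral of a curve in `L²` is the pointwise integral. -/
lemma integral_ae_eq_of_ae_eq {u : ℝ → L2 𝕜} {w : ℝ → ℝ × UnitAddCircle → 𝕜} {t : ℝ} (ht : 0 ≤ t)
    (hu : IntervalIntegrable u volume 0 t) (hw : StronglyMeasurable (Function.uncurry w))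
    (hM : ∀ s ∈ Ioc 0 t, ∀ x, ‖w s x‖ ≤ M) (huw : ∀ s ∈ Ioc 0 t, u s =ᵐ[volume] w s) :
    ((∫ s in (0 : ℝ)..t, u s : L2 𝕜) : ℝ × UnitAddCircle → 𝕜) =ᵐ[volume]
      fun x => ∫ s in (0 : ℝ)..t, w s x := by
  have hint : ∀ B : Set (ℝ × UnitAddCircle), volume B < ⊤ →
      Integrable (Function.uncurry w) ((volume.restrict (Ioc 0 t)).prod (volume.restrict B)) := by
    intro B hB
    have : IsFiniteMeasure ((volume : Measure (ℝ × UnitAddCircle)).restrict B) :=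
      ⟨by rwa [Measure.restrict_apply_univ]⟩
    refine (integrable_const M).mono' hw.aestronglyMeasurable ?_
    have h1 := (Measure.quasiMeasurePreserving_fst (μ := (volume : Measure ℝ).restrict (Ioc 0 t))
      (ν := (volume : Measure (ℝ × UnitAddCircle)).restrict B)).ae (ae_restrict_mem measurableSet_Ioc)
    filter_upwards [h1] with q hq using hM _ hq _
  refine ae_eq_of_forall_setIntegral_eq_of_sigmaFinite (fun B _ hB => ?_) (fun B _ hB => ?_)
    fun B hB hB' => ?_
  · have : IsFiniteMeasure ((volume : Measure (ℝ × UnitAddCircle)).restrict B) :=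
      ⟨by rwa [Measure.restrict_apply_univ]⟩
    exact ((Lp.memLp _).restrict B).integrable one_le_two
  · simp only [intervalIntegral.integral_of_le ht]
    exact (hint B hB).integral_prod_right
  -- Integration over a set of finite measure is an inner product, which commutes with the Bochner
  -- integral; on the pointwise side it commutes by Fubini.
  · rw [← L2.inner_indicatorConstLp_one (𝕜 := 𝕜) hB hB'.ne, intervalIntegral.integral_of_le ht,
      ← integral_inner ((intervalIntegrable_iff_integrableOn_Ioc_of_le ht).1 hu)]
    simp only [intervalIntegral.integral_of_le ht]
    rw [← integral_integral_swap (hint B hB')]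
    refine setIntegral_congr_fun measurableSet_Ioc fun s hs => ?_
    rw [L2.inner_indicatorConstLp_one hB hB'.ne]
    exact integral_congr_ae (ae_restrict_of_ae (huw s hs))

/-- Transport by a time `τ` on the half-line. -/
def transport (v : UnitAddCircle → ℝ) (ρ : UnitAddCircle → 𝕜 × 𝕜 →L[ℝ] 𝕜 × 𝕜) (γ₀ τ : ℝ)
    (A : ℝ → UnitAddCircle → 𝕜 × 𝕜) (y : ℝ) (k : UnitAddCircle) : 𝕜 × 𝕜 :=
  Real.exp (-(rate γ₀ k * τ)) • reflectExt ρ A (y - v k * τ) k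

/-- The folded transport and the two-sided formula agree by following one characteristic. Points
with `y = vel α k * τ` start on the interface, where the two conventions may differ, and are
excluded. -/
lemma IsProfile.unperturbed_unfold (hp : IsProfile α p) (hγ : 0 < γ₁) (τ : ℝ)
    (A : ℝ → UnitAddCircle → 𝕜 × 𝕜) {y : ℝ} {k : UnitAddCircle} (hy : y ≠ 0)
    (hyτ : y ≠ vel α k * τ) : unperturbed α γ₀ γ₁ τ (unfold A) (y, k) =
      unfold (transport (vel α) (bdry 𝕜 α γ₁) γ₀ τ A) (y, k) := by
  rcases lt_or_gt_of_ne hy with hy | hy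
  · rw [unfold_of_neg _ hy, transport, unperturbed, rate_neg, Prod.smul_snd, rate]
    congr 1
    rw [hp.vel_neg, show -y - -vel α k * τ = -(y - vel α k * τ) by ring]
    rcases lt_or_gt_of_ne hyτ with h | h
    · have h1 : y ∉ uIcc 0 (vel α k * τ) := fun hc => absurd hc.1 (not_le.2 (lt_min hy h))
      rw [if_neg h1, reflectExt, if_pos (by linarith), unfold_of_neg _ (by linarith)]
    · have h1 : y ∈ uIcc 0 (vel α k * τ) := mem_uIcc.2 (Or.inr ⟨h.le, hy.le⟩)
      rw [if_pos h1, reflectExt, if_neg (by linarith), neg_neg, neg_neg,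
        unfold_of_pos _ (by simpa using h), unfold_of_neg _ (by simpa using h)]
      simp only [neg_neg, neg_add_rev, bdry, hp.pPlus_neg hγ, hp.pMinus_neg hγ]
      simp [add_comm, sub_eq_add_neg]
  · rw [unfold_of_pos _ hy, transport, unperturbed, Prod.smul_fst, rate]
    congr 1
    rcases lt_or_gt_of_ne hyτ with h | h
    · have h1 : y ∈ uIcc 0 (vel α k * τ) := mem_uIcc.2 (Or.inl ⟨hy.le, h.le⟩)
      rw [if_pos h1, reflectExt, if_neg (by linarith),
        unfold_of_neg _ (by simpa using h), unfold_of_pos _ (by simpa using h)]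
      simp [bdry, add_comm, sub_eq_add_neg]
    · have h1 : y ∉ uIcc 0 (vel α k * τ) := fun hc => absurd hc.2 (not_le.2 (max_lt hy h))
      rw [if_neg h1, reflectExt, if_pos (by linarith), unfold_of_pos _ (by linarith)]

lemma scatter_unfold {A : ℝ → ℝ → UnitAddCircle → 𝕜 × 𝕜} (hA : IsAdm M A) (s : ℝ) {y : ℝ}
    (hy : y ≠ 0) (k : UnitAddCircle) :
    (2 * γ₀) • scatter (unfold (A s)) (y, k) = unfold (gain γ₀ A s) (y, k) := by
  have hi : ∀ y k, Integrable fun k' => scatKernel k k' • A s y k' := fun y k =>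
    integrable_kernel_smul (fun k hk => hA.section_continuousAt s y hk)
      (fun k hk => hA.bdd s y k hk) k
  have hfst : ∀ y k, (∫ k', scatKernel k k' • A s y k').1 = ∫ k', scatKernel k k' • (A s y k').1 :=
    fun y k => ((ContinuousLinearMap.fst ℝ 𝕜 𝕜).integral_comp_comm (hi y k)).symm
  have hsnd : ∀ y k, (∫ k', scatKernel k k' • A s y k').2 = ∫ k', scatKernel k k' • (A s y k').2 :=
    fun y k => ((ContinuousLinearMap.snd ℝ 𝕜 𝕜).integral_comp_comm (hi y k)).symm
  rcases lt_or_gt_of_ne hy with hy | hy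
  · rw [unfold_of_neg _ hy, gain, Prod.smul_snd, hsnd, scatter]
    simp only [unfold_of_neg _ hy]
    rw [← integral_neg_eq_self]
    simp only [scatKernel_neg_left, scatKernel_neg_right, neg_neg]
  · rw [unfold_of_pos _ hy, gain, Prod.smul_fst, hfst, scatter]
    simp only [unfold_of_pos _ hy]

lemma IsProfile.stronglyMeasurable_transport (hp : IsProfile α p) (hγ : 0 < γ₁)
    {g : ℝ → ℝ → UnitAddCircle → 𝕜 × 𝕜}
    (hg : Continuous fun q : ℝ × ℝ × UnitAddCircle => g q.1 q.2.1 q.2.2) (t : ℝ) :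
    StronglyMeasurable fun q : ℝ × ℝ × UnitAddCircle =>
      transport (vel α) (bdry 𝕜 α γ₁) γ₀ (t - q.1) (g q.1) q.2.1 q.2.2 := by
  classical
  have hv := hp.measurable_vel
  have hP := hp.measurable_pPlus hγ
  have hQ := hp.measurable_pMinus hγ
  have hr := continuous_rate γ₀
  have hx : Measurable fun q : ℝ × ℝ × UnitAddCircle => q.2.1 - vel α q.2.2 * (t - q.1) := by
    fun_prop
  have m1 : StronglyMeasurable fun q : ℝ × ℝ × UnitAddCircle =>
      g q.1 (q.2.1 - vel α q.2.2 * (t - q.1)) q.2.2 :=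
    hg.stronglyMeasurable.comp_measurable
      (g := fun q : ℝ × ℝ × UnitAddCircle => (q.1, q.2.1 - vel α q.2.2 * (t - q.1), q.2.2))
      (measurable_fst.prodMk (hx.prodMk (by fun_prop)))
  have m2 : StronglyMeasurable fun q : ℝ × ℝ × UnitAddCircle =>
      g q.1 (-(q.2.1 - vel α q.2.2 * (t - q.1))) (-q.2.2) :=
    hg.stronglyMeasurable.comp_measurable
      (g := fun q : ℝ × ℝ × UnitAddCircle => (q.1, -(q.2.1 - vel α q.2.2 * (t - q.1)), -q.2.2))
      (measurable_fst.prodMk (hx.neg.prodMk (by fun_prop)))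
  have m3 : StronglyMeasurable fun q : ℝ × ℝ × UnitAddCircle => bdry 𝕜 α γ₁ q.2.2
      (g q.1 (-(q.2.1 - vel α q.2.2 * (t - q.1))) (-q.2.2)) := by
    have e1 : StronglyMeasurable fun q : ℝ × ℝ × UnitAddCircle => pMinus α γ₁ q.2.2 •
        g q.1 (-(q.2.1 - vel α q.2.2 * (t - q.1))) (-q.2.2) :=
      (hQ.comp (by fun_prop : Measurable fun q : ℝ × ℝ × UnitAddCircle =>
        q.2.2)).stronglyMeasurable.smul m2
    have e2 : StronglyMeasurable fun q : ℝ × ℝ × UnitAddCircle => pPlus α γ₁ q.2.2 •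
        (g q.1 (-(q.2.1 - vel α q.2.2 * (t - q.1))) (-q.2.2)).swap :=
      (hP.comp (by fun_prop : Measurable fun q : ℝ × ℝ × UnitAddCircle =>
        q.2.2)).stronglyMeasurable.smul (continuous_swap.comp_stronglyMeasurable m2)
    exact e1.add e2
  have m4 : StronglyMeasurable fun q : ℝ × ℝ × UnitAddCircle =>
      Real.exp (-(rate γ₀ q.2.2 * (t - q.1))) := Continuous.stronglyMeasurable (by fun_prop)
  refine m4.smul ?_
  exact StronglyMeasurable.ite (measurableSet_le measurable_const hx) m1 m3

lemma IsProfile.stronglyMeasurable_unfold_transport (hp : IsProfile α p) (hγ : 0 < γ₁)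
    {g : ℝ → ℝ → UnitAddCircle → 𝕜 × 𝕜}
    (hg : Continuous fun q : ℝ × ℝ × UnitAddCircle => g q.1 q.2.1 q.2.2) (t : ℝ) :
    StronglyMeasurable (Function.uncurry fun s =>
      unfold (transport (vel α) (bdry 𝕜 α γ₁) γ₀ (t - s) (g s))) := by
  classical
  have m := hp.stronglyMeasurable_transport (γ₀ := γ₀) hγ hg t
  refine StronglyMeasurable.ite (p := fun q : ℝ × ℝ × UnitAddCircle => 0 ≤ q.2.1)
    (measurableSet_le measurable_const (by fun_prop)) ?_ ?_
  · exact continuous_fst.comp_stronglyMeasurable m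
  · exact continuous_snd.comp_stronglyMeasurable (m.comp_measurable
      (g := fun q : ℝ × ℝ × UnitAddCircle => (q.1, -q.2.1, -q.2.2)) (by fun_prop))

lemma norm_unfold_le {A : ℝ → UnitAddCircle → 𝕜 × 𝕜} (hA : ∀ y k, ‖A y k‖ ≤ M)
    (x : ℝ × UnitAddCircle) : ‖unfold A x‖ ≤ M := by
  rw [unfold]
  split_ifs
  · exact (norm_fst_le _).trans (hA _ _)
  · exact (norm_snd_le _).trans (hA _ _)

lemma IsProfile.norm_transport_le (hp : IsProfile α p) (hγ₀ : 0 < γ₀) (hγ : 0 < γ₁) {τ : ℝ}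
    (hτ : 0 ≤ τ) {A : ℝ → UnitAddCircle → 𝕜 × 𝕜} (hA : ∀ y k, ‖A y k‖ ≤ M) (y : ℝ)
    (k : UnitAddCircle) : ‖transport (vel α) (bdry 𝕜 α γ₁) γ₀ τ A y k‖ ≤ M := by
  rw [transport, norm_smul, Real.norm_of_nonneg (Real.exp_pos _).le]
  refine (mul_le_of_le_one_left (norm_nonneg _) (Real.exp_le_one_iff.2 ?_)).trans
    (norm_reflectExt_le (hp.isHalfLine hγ) (fun y => hA y k) (fun y => hA y (-k)) _)
  have := mul_nonneg (rate_nonneg hγ₀ k) hτ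
  linarith

end
end KineticInterface

namespace KineticInterface
noncomputable section

set_option linter.unusedSectionVars false

/-! ### Identification of the classical and the `L²` evolution -/

variable {𝕜 : Type*} [RCLike 𝕜] {α : ℤ → ℝ} {p : ℝ → ℝ} {γ₀ γ₁ M : ℝ}

lemma unfold_congr {A B : ℝ → UnitAddCircle → 𝕜 × 𝕜} (h : ∀ y k, 0 ≤ y → A y k = B y k) :
    unfold A = unfold B := by
  ext x
  rw [unfold, unfold]
  split_ifs with hx
  · rw [h _ _ hx]
  · rw [h _ _ (by linarith)]

lemma unfold_freePart {v : UnitAddCircle → ℝ} {ρ : UnitAddCircle → 𝕜 × 𝕜 →L[ℝ] 𝕜 × 𝕜}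
    (A₀ : ℝ → UnitAddCircle → 𝕜 × 𝕜) {t : ℝ} (ht : 0 ≤ t) :
    unfold (freePart v ρ γ₀ A₀ t) = unfold (transport v ρ γ₀ t A₀) :=
  unfold_congr fun y k hy => by rw [freePart, transport, max_eq_left ht, max_eq_left hy]

lemma unfold_duhamelPart {v : UnitAddCircle → ℝ} {ρ : UnitAddCircle → 𝕜 × 𝕜 →L[ℝ] 𝕜 × 𝕜}
    (h : IsHalfLine v ρ) {g : ℝ → ℝ → UnitAddCircle → 𝕜 × 𝕜}
    (hg : Continuous fun q : ℝ × ℝ × UnitAddCircle => g q.1 q.2.1 q.2.2)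
    (hb : ∀ t y k, ‖g t y k‖ ≤ M) {t : ℝ} (ht : 0 ≤ t) (x : ℝ × UnitAddCircle) :
    unfold (duhamelPart v ρ γ₀ g t) x =
      ∫ s in (0 : ℝ)..t, unfold (transport v ρ γ₀ (t - s) (g s)) x := by
  simp only [unfold, duhamelPart, max_eq_left ht]
  split_ifs with hx
  · rw [max_eq_left hx]
    exact ((ContinuousLinearMap.fst ℝ 𝕜 𝕜).intervalIntegral_comp_comm
      (intervalIntegrable_duhamel h hg hb t x.1 x.2 0 t)).symm
  · rw [max_eq_left (by linarith : 0 ≤ -x.1)]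
    exact ((ContinuousLinearMap.snd ℝ 𝕜 𝕜).intervalIntegral_comp_comm
      (intervalIntegrable_duhamel h hg hb t (-x.1) (-x.2) 0 t)).symm

lemma unfold_add (A B : ℝ → UnitAddCircle → 𝕜 × 𝕜) (x : ℝ × UnitAddCircle) :
    unfold (fun y k => A y k + B y k) x = unfold A x + unfold B x := by
  simp only [unfold]
  split_ifs <;> rfl

lemma IsProfile.unperturbed_unfold_ae (hp : IsProfile α p) (hγ : 0 < γ₁) (τ : ℝ)
    (A : ℝ → UnitAddCircle → 𝕜 × 𝕜) : unperturbed α γ₀ γ₁ τ (unfold A) =ᵐ[volume]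
      unfold (transport (vel α) (bdry 𝕜 α γ₁) γ₀ τ A) := by
  filter_upwards [ae_fst_ne_zero, hp.ae_ne_vel_mul τ] with x h1 h2
  exact hp.unperturbed_unfold hγ τ A h1 h2

section Identification

variable {U : ℝ → L2 𝕜 →L[𝕜] L2 𝕜} {Rop : L2 𝕜 →L[𝕜] L2 𝕜}

/-- Both sequences start from `0` and obey the same recursion, with the Bochner integral replaced by
the pointwise one. Admissibility of the iterates supplies the bound and the measurability for this
exchange. -/
lemma IsProfile.sum_dyson_ae_eq (hp : IsProfile α p) (hγ₀ : 0 < γ₀) (hγ₁ : 0 < γ₁)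
    (hU : IsContractive U) (hUg : ∀ t, 0 ≤ t → IsGivenBy (U t) (unperturbed α γ₀ γ₁ t))
    (hR : IsGivenBy Rop scatter) {A₀ : ℝ → UnitAddCircle → 𝕜 × 𝕜}
    (hA₀ : IsAdmData M (vel α) (bdry 𝕜 α γ₁) A₀) {f : L2 𝕜} (hf : f =ᵐ[volume] unfold A₀) (n : ℕ)
    {t : ℝ} (ht : 0 ≤ t) :
    ((∑ m ∈ Finset.range n, dyson U (((2 * γ₀ : ℝ) : 𝕜) • Rop) m t f : L2 𝕜) :
      ℝ × UnitAddCircle → 𝕜) =ᵐ[volume]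
      unfold (picard (vel α) (bdry 𝕜 α γ₁) γ₀ A₀ n t) := by
  have h : IsHalfLine (vel α) (bdry 𝕜 α γ₁) := hp.isHalfLine hγ₁
  induction n generalizing t with
  | zero =>
    rw [Finset.sum_range_zero]
    filter_upwards [Lp.coeFn_zero 𝕜 2 (volume : Measure (ℝ × UnitAddCircle))] with x hx
    rw [hx]
    simp [unfold, picard]
  | succ n ih =>
    have hA := isAdm_picard hγ₀ h hA₀ n
    set A := picard (vel α) (bdry 𝕜 α γ₁) γ₀ A₀ n with hAdef
    have hg : Continuous fun q : ℝ × ℝ × UnitAddCircle => gain γ₀ A q.1 q.2.1 q.2.2 :=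
      continuous_gain hA
    have hgb := norm_gain_le_const hγ₀ hA
    rw [hU.sum_dyson_succ]
    have e1 : U t f =ᵐ[volume] unfold (transport (vel α) (bdry 𝕜 α γ₁) γ₀ t A₀) :=
      ((hUg t ht).apply_ae hf).trans (hp.unperturbed_unfold_ae hγ₁ t A₀)
    have hc : Continuous fun s => ∑ m ∈ Finset.range n, dyson U (((2 * γ₀ : ℝ) : 𝕜) • Rop) m s f :=
      continuous_finsetSum _ fun m _ => hU.continuous_dyson m f
    have e2 := integral_ae_eq_of_ae_eq (M := 32 * γ₀ * M) ht
      ((hU.continuous_integrand (B := ((2 * γ₀ : ℝ) : 𝕜) • Rop) hc t).intervalIntegrable 0 t)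
      (hp.stronglyMeasurable_unfold_transport (γ₀ := γ₀) hγ₁ hg t)
      (fun s hs x => norm_unfold_le (fun y k =>
        hp.norm_transport_le hγ₀ hγ₁ (sub_nonneg.2 hs.2) (fun y k => hgb s y k) y k) x)
      (fun s hs => by
        have i1 := ih hs.1.le
        have i2 := hR.apply_ae i1
        refine (((hUg (t - s) (sub_nonneg.2 hs.2)).apply_ae (F := unfold (gain γ₀ A s)) ?_)).trans
          (hp.unperturbed_unfold_ae hγ₁ (t - s) (gain γ₀ A s))
        rw [smul_apply]
        refine (Lp.coeFn_smul _ _).trans ?_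
        filter_upwards [i2, ae_fst_ne_zero] with x hx hx1
        rw [Pi.smul_apply, hx, ← scatter_unfold hA s hx1 x.2, RCLike.real_smul_eq_coe_smul (K := 𝕜)])
    refine (Lp.coeFn_add _ _).trans ?_
    filter_upwards [e1, e2] with x h1 h2
    rw [Pi.add_apply, h1, h2, ← unfold_duhamelPart h hg hgb ht, ← unfold_freePart A₀ ht]
    exact (unfold_add _ _ x).symm

/-- The partial sums converge in `L²`, hence almost everywhere along a subsequence; the Picard
iterates converge pointwise to the mild solution, which by uniqueness is `W`. Square-integrability
of `W t` comes as a by-product. -/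
lemma IsProfile.flow_ae_eq (hp : IsProfile α p) (hγ₀ : 0 < γ₀) (hγ₁ : 0 < γ₁)
    (hU : IsContractive U) (hUg : ∀ t, 0 ≤ t → IsGivenBy (U t) (unperturbed α γ₀ γ₁ t))
    (hR : IsGivenBy Rop scatter) {S : ℝ → L2 𝕜 →L[𝕜] L2 𝕜}
    (hS : ∀ t f, 0 ≤ t → HasSum (fun n => dyson U (((2 * γ₀ : ℝ) : 𝕜) • Rop) n t f) (S t f))
    {W₀ : ℝ × UnitAddCircle → 𝕜} (h₀ : MemLp W₀ 2 volume) (hC : IsC0 α γ₁ W₀)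
    {W : ℝ → ℝ × UnitAddCircle → 𝕜} (hW : IsClassicalSolution α γ₀ γ₁ W₀ W) {t : ℝ} (ht : 0 ≤ t) :
    S t (h₀.toLp W₀) =ᵐ[volume] W t := by
  have h : IsHalfLine (vel α) (bdry 𝕜 α γ₁) := hp.isHalfLine hγ₁
  obtain ⟨-, ⟨C, hCb⟩, Gp, Gm, c1, e1, c2, e2, hI⟩ := hC
  have hA₀ := hp.isAdmData hγ₁ hCb c1 e1 c2 e2 hI
  have hf : h₀.toLp W₀ =ᵐ[volume] unfold (foldPair Gp Gm) := by
    filter_upwards [h₀.coeFn_toLp, ae_fst_ne_zero, ae_snd_ne_zero] with x hx h1 h2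
    rw [hx]
    obtain ⟨y, k⟩ := x
    rcases lt_or_gt_of_ne h1 with hy | hy
    · rw [unfold_of_neg _ hy, foldPair, max_eq_left (by simp only at hy; linarith), neg_neg, neg_neg,
        e2 ⟨hy, h2⟩]
    · rw [unfold_of_pos _ hy, foldPair, max_eq_left (le_of_lt hy), e1 ⟨hy, h2⟩]
  have hlim := (hS t (h₀.toLp W₀) ht).tendsto_sum_nat
  obtain ⟨ns, hns, hae⟩ := (tendstoInMeasure_of_tendsto_Lp hlim).exists_seq_tendsto_ae
  have hall : ∀ᵐ x : ℝ × UnitAddCircle, ∀ n,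
      (∑ m ∈ Finset.range n, dyson U (((2 * γ₀ : ℝ) : 𝕜) • Rop) m t (h₀.toLp W₀) : L2 𝕜) x =
      unfold (picard (vel α) (bdry 𝕜 α γ₁) γ₀ (foldPair Gp Gm) n t) x :=
    ae_all_iff.2 fun n => hp.sum_dyson_ae_eq hγ₀ hγ₁ hU hUg hR hA₀ hf n ht
  have hW' := hp.isClassicalSolution hγ₀ hγ₁ hA₀ e1 e2
  filter_upwards [hae, hall, ae_fst_ne_zero, ae_snd_ne_zero] with x hx hall h1 h2
  obtain ⟨y, k⟩ := x
  rw [hp.unique hγ₀ hγ₁ hW hW' ht h1 h2]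
  refine tendsto_nhds_unique hx ?_
  simp only [hall]
  refine Tendsto.comp (g := fun n => unfold (picard (vel α) (bdry 𝕜 α γ₁) γ₀ (foldPair Gp Gm) n t)
    (y, k)) ?_ hns.tendsto_atTop
  have h1' : y ≠ 0 := h1
  rcases lt_or_gt_of_ne h1' with hy | hy
  · simp only [unfold_of_neg _ hy]
    exact (tendsto_picard hγ₀ h hA₀ t (-y) (neg_ne_zero.2 h2)).snd_nhds
  · simp only [unfold_of_pos _ hy]
    exact (tendsto_picard hγ₀ h hA₀ t y h2).fst_nhds

end Identification

/-! ### Invariance of `𝒞₀` and restarting of solutions -/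

section Restart

variable {W₀ : ℝ × UnitAddCircle → 𝕜} {W : ℝ → ℝ × UnitAddCircle → 𝕜}

lemma IsC0.congr {F G : ℝ × UnitAddCircle → 𝕜} (hF : IsC0 α γ₁ F)
    (h : ∀ y k, y ≠ 0 → k ≠ 0 → G (y, k) = F (y, k)) : IsC0 α γ₁ G := by
  obtain ⟨c, ⟨C, hC⟩, Gp, Gm, c1, e1, c2, e2, hI⟩ := hF
  refine ⟨c.congr fun x hx => h x.1 x.2 hx.1 hx.2, ⟨C, fun y k hy hk => ?_⟩, Gp, Gm, c1,
    fun x hx => ?_, c2, fun x hx => ?_, hI⟩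
  · rw [h y k hy hk]; exact hC y k hy hk
  · rw [e1 hx]; exact (h x.1 x.2 (ne_of_gt hx.1) hx.2).symm
  · rw [e2 hx]; exact (h x.1 x.2 (ne_of_lt hx.1) hx.2).symm

lemma IsClassicalSolution.isC0 (hW : IsClassicalSolution α γ₀ γ₁ W₀ W) (h₀ : IsC0 α γ₁ W₀) {t : ℝ}
    (ht : 0 ≤ t) : IsC0 α γ₁ (W t) := by
  rcases ht.eq_or_lt with rfl | ht'
  · exact h₀.congr hW.initial
  · obtain ⟨C, hC⟩ := hW.bounded
    obtain ⟨Gp, Gm, c1, e1, c2, e2, hI⟩ := hW.extension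
    refine ⟨?_, ⟨C, hC t ht'⟩, fun x => Gp (t, x), fun x => Gm (t, x), ?_, fun x hx => ?_, ?_,
      fun x hx => ?_, hI t ht⟩
    · exact hW.continuousOn.comp (f := fun x => (t, x)) (by fun_prop) fun x hx => ⟨ht', hx⟩
    · exact c1.comp (f := fun x => (t, x)) (by fun_prop) fun x hx => ⟨ht, hx⟩
    · exact e1 (x := (t, x)) ⟨ht', hx⟩
    · exact c2.comp (f := fun x => (t, x)) (by fun_prop) fun x hx => ⟨ht, hx⟩
    · exact e2 (x := (t, x)) ⟨ht', hx⟩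

lemma IsClassicalSolution.restart (hW : IsClassicalSolution α γ₀ γ₁ W₀ W) {t : ℝ} (ht : 0 ≤ t) :
    IsClassicalSolution α γ₀ γ₁ (W t) (fun s => W (t + s)) := by
  have hpos : ∀ {s : ℝ}, 0 < s → 0 < t + s := fun hs => by linarith
  obtain ⟨C, hC⟩ := hW.bounded
  obtain ⟨C', hC'⟩ := hW.bounded_deriv
  obtain ⟨Gp, Gm, c1, e1, c2, e2, hI⟩ := hW.extension
  refine ⟨?_, ⟨C, fun s hs y k hy hk => hC _ (hpos hs) y k hy hk⟩,
    ⟨fun q => Gp (t + q.1, q.2), fun q => Gm (t + q.1, q.2), ?_, fun q hq => ?_, ?_,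
      fun q hq => ?_, fun s hs => hI (t + s) (add_nonneg ht hs)⟩, fun s hs y k hy hk => ?_,
    ⟨C', fun s hs y k hy hk => ?_⟩, fun s hs y k hy hk => ?_, fun y k _ _ => ?_,
    fun y k hy hk => ?_⟩
  · exact hW.continuousOn.comp (f := fun q : ℝ × (ℝ × UnitAddCircle) => (t + q.1, q.2))
      (by fun_prop) fun q hq => ⟨hpos hq.1, hq.2⟩
  · exact c1.comp (f := fun q : ℝ × (ℝ × UnitAddCircle) => (t + q.1, q.2)) (by fun_prop)
      fun q hq => ⟨add_nonneg ht hq.1, hq.2⟩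
  · exact e1 (x := (t + q.1, q.2)) ⟨hpos hq.1, hq.2⟩
  · exact c2.comp (f := fun q : ℝ × (ℝ × UnitAddCircle) => (t + q.1, q.2)) (by fun_prop)
      fun q hq => ⟨add_nonneg ht hq.1, hq.2⟩
  · exact e2 (x := (t + q.1, q.2)) ⟨hpos hq.1, hq.2⟩
  · simp only [← add_assoc]
    exact hW.contDiffAt (t + s) (hpos hs) y k hy hk
  · simp only [← add_assoc]
    exact hC' (t + s) (hpos hs) y k hy hk
  · simp only [← add_assoc]
    exact hW.equation (t + s) (hpos hs) y k hy hk
  · rw [add_zero]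
  -- At `t = 0` the convergence is part of the definition of a solution; for `t > 0` it is interior
  -- continuity.
  · rcases ht.eq_or_lt with rfl | ht'
    · simp only [zero_add]
      rw [hW.initial y k hy hk]
      exact hW.tendsto_initial y k hy hk
    · have h1 : ContinuousAt (fun s => W (t + s) (y, k)) 0 :=
        ContinuousAt.comp (x := (0 : ℝ)) (f := fun s : ℝ => (t + s, (y, k)))
          (g := fun q : ℝ × (ℝ × UnitAddCircle) => W q.1 q.2)
          (by rw [add_zero]; exact hW.continuousAt_section ht' hy hk) (by fun_prop)
      have h2 := h1.tendsto
      rw [add_zero] at h2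
      exact h2.mono_left nhdsWithin_le_nhds

end Restart

end
end KineticInterface

namespace KineticInterface
noncomputable section

set_option linter.unusedSectionVars false

/-! ### Contractivity -/

section Contraction

variable {𝕜 X : Type*} [RCLike 𝕜] [NormedAddCommGroup X] [NormedSpace ℝ X] [NormedSpace 𝕜 X]
  [CompleteSpace X] {U S : ℝ → X →L[𝕜] X} {B : X →L[𝕜] X}

/-- A semigroup given by a Duhamel formula is contractive if the Euler steps of the Duhamel formula
are contractive up to second order. -/
lemma IsContractive.norm_le_of_euler (hU : IsContractive U) (hS : ∀ f, Continuous fun t => S t f)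
    (hS0 : ∀ f, S 0 f = f) (hadd : ∀ s t f, 0 ≤ s → 0 ≤ t → S (s + t) f = S s (S t f))
    (hD : ∀ t f, 0 ≤ t → S t f = U t f + ∫ s in (0 : ℝ)..t, U (t - s) (B (S s f))) {c : ℝ}
    (hE : ∀ h f, 0 ≤ h → ‖U h f + h • U h (B f)‖ ^ 2 ≤ (1 + (c * h) ^ 2) * ‖f‖ ^ 2) {T : ℝ}
    (hT : 0 ≤ T) (f : X) : ‖S T f‖ ≤ ‖f‖ := by
  -- The upper right derivative of the norm is nonpositive: over a short time `h` the Duhamel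
  -- formula is an Euler step from `g`, up to an error `o(h)` by strong continuity.
  have hslope : ∀ t, 0 ≤ t → ∀ r > 0, ∀ᶠ z in 𝓝[>] t, slope (fun t => ‖S t f‖) t z < r := by
    intro t ht r hr
    set g := S t f with hg
    have hψc : Continuous fun q : ℝ × ℝ => U (q.2 - q.1) (B (S q.1 g)) - U q.2 (B g) :=
      (hU.continuous_apply (by fun_prop) (B.continuous.comp ((hS g).comp continuous_fst))).sub
        ((hU.cont (B g)).comp continuous_snd)
    have hψ := (hψc.norm.tendsto (0, 0)).eventually (gt_mem_nhds
      (show ‖U ((0 : ℝ) - 0) (B (S 0 g)) - U 0 (B g)‖ < r / 2 by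
        rw [hS0, sub_zero, sub_self, norm_zero]; linarith))
    obtain ⟨δ, hδ, hball⟩ := Metric.eventually_nhds_iff.1 hψ
    -- The slope budget `r` is shared: the integral remainder takes `r/2`, and `h < η` makes the
    -- second-order term `c²h‖g‖` smaller than `r/2`.
    set η := min δ (r / (2 * (c ^ 2 * ‖g‖ + 1))) with hη
    have hη0 : 0 < η := lt_min hδ (by positivity)
    filter_upwards [Ioo_mem_nhdsGT (show t < t + η by linarith)] with z hz
    obtain ⟨h, rfl⟩ : ∃ h, z = t + h := ⟨z - t, by ring⟩
    have h0 : 0 < h := by linarith [hz.1]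
    have hh : h < η := by linarith [hz.2]
    have hhδ : h < δ := hh.trans_le (min_le_left _ _)
    have e1 : S (t + h) f = S h g := by rw [add_comm, hadd h t f h0.le ht]
    have hcont1 : Continuous fun s => U (h - s) (B (S s g)) := hU.continuous_integrand (hS g) h
    have e2 : S h g = (U h g + h • U h (B g)) +
        ∫ s in (0 : ℝ)..h, (U (h - s) (B (S s g)) - U h (B g)) := by
      rw [hD h g h0.le, intervalIntegral.integral_sub (hcont1.intervalIntegrable _ _)
        (continuous_const.intervalIntegrable _ _), intervalIntegral.integral_const, sub_zero]
      abel
    have e3 : ‖∫ s in (0 : ℝ)..h, (U (h - s) (B (S s g)) - U h (B g))‖ ≤ r / 2 * |h - 0| := by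
      refine intervalIntegral.norm_integral_le_of_norm_le_const fun s hs => ?_
      rw [uIoc_of_le h0.le] at hs
      refine (hball (y := (s, h)) ?_).le
      rw [Prod.dist_eq, max_lt_iff, Real.dist_0_eq_abs, Real.dist_0_eq_abs, abs_of_pos hs.1,
        abs_of_pos h0]
      exact ⟨hs.2.trans_lt hhδ, hhδ⟩
    rw [sub_zero, abs_of_pos h0] at e3
    have e4 : ‖U h g + h • U h (B g)‖ ≤ (1 + (c * h) ^ 2) * ‖g‖ := by
      have hn : 0 ≤ (1 + (c * h) ^ 2) * ‖g‖ := by positivity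
      refine (sq_le_sq₀ (norm_nonneg _) hn).1 ((hE h g h0.le).trans ?_)
      have h1 : 1 + (c * h) ^ 2 ≤ (1 + (c * h) ^ 2) ^ 2 :=
        le_self_pow₀ (by linarith [sq_nonneg (c * h)]) two_ne_zero
      rw [mul_pow (1 + (c * h) ^ 2)]
      exact mul_le_mul_of_nonneg_right h1 (sq_nonneg ‖g‖)
    have e5 : ‖S (t + h) f‖ ≤ (1 + (c * h) ^ 2) * ‖g‖ + r / 2 * h := by
      rw [e1, e2]
      exact (norm_add_le _ _).trans (add_le_add e4 e3)
    rw [slope_def_field, add_sub_cancel_left, div_lt_iff₀ h0]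
    have e6 : h * (2 * (c ^ 2 * ‖g‖ + 1)) < r := by
      rw [← lt_div_iff₀ (by positivity)]
      exact hh.trans_le (min_le_right _ _)
    nlinarith
  -- The comparison principle needs a majorant with strictly larger slope, so a slope `ε` is added
  -- and then removed.
  have key : ∀ ε > 0, ‖S T f‖ ≤ ‖f‖ + ε * T := by
    intro ε hε
    refine image_le_of_liminf_slope_right_lt_deriv_boundary (f := fun t => ‖S t f‖)
      (f' := fun _ => 0) (B := fun t => ‖f‖ + ε * t) (B' := fun _ => ε) (a := 0) (b := T)
      (hS f).norm.continuousOn (fun x hx r hr => (hslope x hx.1 r hr).frequently)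
      (by simp [hS0]) (fun x => ?_) (fun x _ _ => hε) (right_mem_Icc.2 hT)
    exact (((hasDerivAt_id x).const_mul ε).const_add _).congr_deriv (by simp)
  refine le_of_forall_pos_le_add fun ε hε => ?_
  have := key (ε / (T + 1)) (by positivity)
  refine this.trans (add_le_add le_rfl ?_)
  rw [div_mul_eq_mul_div, div_le_iff₀ (by positivity)]
  nlinarith

end Contraction

/-! ### The Euler estimate on `L²` and density of test functions -/

variable {𝕜 : Type*} [RCLike 𝕜] {α : ℤ → ℝ} {p : ℝ → ℝ} {γ₀ γ₁ : ℝ}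

lemma norm_sq_le_of_lintegral_le {f g : L2 𝕜} {C : ℝ} (hC : 0 ≤ C)
    (h : ∫⁻ x, ‖f x‖ₑ ^ 2 ≤ ENNReal.ofReal C * ∫⁻ x, ‖g x‖ₑ ^ 2) : ‖f‖ ^ 2 ≤ C * ‖g‖ ^ 2 := by
  rw [← eLpNorm_two_sq, ← eLpNorm_two_sq] at h
  rw [Lp.norm_def, Lp.norm_def, ← ENNReal.toReal_pow, ← ENNReal.toReal_pow,
    ← ENNReal.toReal_ofReal hC, ← ENNReal.toReal_mul]
  exact ENNReal.toReal_mono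
    (ENNReal.mul_ne_top ENNReal.ofReal_ne_top (ENNReal.pow_ne_top (Lp.memLp g).2.ne)) h

/-- The free evolution is bounded by its damping factor alone, and the damped Euler step satisfies
the second-order estimate of `lintegral_euler_le`. -/
lemma IsProfile.norm_euler_le (hp : IsProfile α p) (hγ₀ : 0 < γ₀) (hγ₁ : 0 < γ₁)
    {A Rop : L2 𝕜 →L[𝕜] L2 𝕜} {h : ℝ} (hh : 0 ≤ h) (hA : IsGivenBy A (unperturbed α γ₀ γ₁ h))
    (hR : IsGivenBy Rop scatter) (f : L2 𝕜) :
    ‖A f + h • A ((((2 * γ₀ : ℝ) : 𝕜) • Rop) f)‖ ^ 2 ≤ (1 + (32 * γ₀ * h) ^ 2) * ‖f‖ ^ 2 := by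
  set F := (f : ℝ × UnitAddCircle → 𝕜) with hF
  have hFm : MemLp F 2 volume := Lp.memLp f
  have e0 : A f + h • A ((((2 * γ₀ : ℝ) : 𝕜) • Rop) f) = A (f + (2 * γ₀ * h) • Rop f) := by
    rw [map_add, smul_apply, RCLike.real_smul_eq_coe_smul (K := 𝕜) h,
      RCLike.real_smul_eq_coe_smul (K := 𝕜) (2 * γ₀ * h), map_smul, map_smul, smul_smul,
      ← RCLike.ofReal_mul, mul_comm h]
  have e1 : ((f + (2 * γ₀ * h) • Rop f : L2 𝕜) : ℝ × UnitAddCircle → 𝕜) =ᵐ[volume]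
      fun x => F x + (2 * γ₀ * h) • scatter F x := by
    refine (Lp.coeFn_add _ _).trans ?_
    filter_upwards [Lp.coeFn_smul (2 * γ₀ * h) (Rop f), hR.apply_ae (ae_eq_refl (f : _ → 𝕜))]
      with x h1 h2
    rw [Pi.add_apply, h1, Pi.smul_apply, h2]
  have e2 := hA.apply_ae e1
  rw [e0]
  refine norm_sq_le_of_lintegral_le (by positivity) ?_
  calc ∫⁻ x, ‖A (f + (2 * γ₀ * h) • Rop f) x‖ₑ ^ 2
      = ∫⁻ x, ‖unperturbed α γ₀ γ₁ h (fun x => F x + (2 * γ₀ * h) • scatter F x) x‖ₑ ^ 2 :=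
        lintegral_congr_ae (by filter_upwards [e2] with x hx; rw [hx])
    _ ≤ _ := hp.lintegral_unperturbed_le hγ₁ h
        (hFm.1.add ((aestronglyMeasurable_scatter hFm.1).const_smul _))
    _ ≤ _ := lintegral_euler_le hγ₀ hh hFm

/-- Bounded operators that agree on the test functions are equal. -/
lemma eq_of_eq_on_test {A A' : L2 𝕜 →L[𝕜] L2 𝕜}
    (h : ∀ (F : ℝ × UnitAddCircle → 𝕜) (hF : IsTest F),
      A (hF.memLp.toLp F) = A' (hF.memLp.toLp F)) : A = A' := by
  have hd : Dense {g : L2 𝕜 | A g = A' g} := by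
    refine Metric.dense_iff.2 fun f ε hε => ?_
    obtain ⟨F, hF, hFε⟩ := exists_test_near f hε
    refine ⟨hF.memLp.toLp F, ?_, h F hF⟩
    rwa [Metric.mem_ball, dist_comm, dist_eq_norm]
  have hc : IsClosed {g : L2 𝕜 | A g = A' g} := isClosed_eq A.continuous A'.continuous
  ext1 g
  have : g ∈ closure {g : L2 𝕜 | A g = A' g} := hd g
  rwa [hc.closure_eq] at this

lemma IsProfile.exists_classical (hp : IsProfile α p) (hγ₀ : 0 < γ₀) (hγ₁ : 0 < γ₁)
    {W₀ : ℝ × UnitAddCircle → 𝕜} (hC : IsC0 α γ₁ W₀) : ∃ W, IsClassicalSolution α γ₀ γ₁ W₀ W := by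
  obtain ⟨-, ⟨C, hCb⟩, Gp, Gm, c1, e1, c2, e2, hI⟩ := hC
  exact ⟨_, hp.isClassicalSolution hγ₀ hγ₁ (hp.isAdmData hγ₁ hCb c1 e1 c2 e2 hI) e1 e2⟩

end
end KineticInterface

/-! ### Assembly of the proposition -/

theorem proposition2p4 {𝕜 : Type*} [RCLike 𝕜] (α : ℤ → ℝ) (hα : IsAdmissible α)
    (γ₀ γ₁ : ℝ) (hγ₀ : 0 < γ₀) (hγ₁ : 0 < γ₁) :
    -- the kinetic maps `𝔚_t : W₀ ↦ W(t)` are well defined on `𝒞₀`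
    (∀ W₀ : ℝ × UnitAddCircle → 𝕜, IsC0 α γ₁ W₀ →
      (∃ W, IsClassicalSolution α γ₀ γ₁ W₀ W) ∧
      ∀ W W', IsClassicalSolution α γ₀ γ₁ W₀ W → IsClassicalSolution α γ₀ γ₁ W₀ W' →
        ∀ t : ℝ, 0 ≤ t → ∀ (y : ℝ) (k : UnitAddCircle), y ≠ 0 → k ≠ 0 →
          W t (y, k) = W' t (y, k)) ∧
    -- they leave `𝒞₀ ∩ L²` invariant
    (∀ W₀ : ℝ × UnitAddCircle → 𝕜, IsC0 α γ₁ W₀ → MemLp W₀ 2 volume →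
      ∀ W, IsClassicalSolution α γ₀ γ₁ W₀ W →
        ∀ t : ℝ, 0 ≤ t → IsC0 α γ₁ (W t) ∧ MemLp (W t) 2 volume) ∧
    -- they extend uniquely to a `C₀`-semigroup of contractions on `L²`, which is the unique
    -- solution of the Duhamel equation
    ∃ S U : ℝ → L2 𝕜 →L[𝕜] L2 𝕜, ∃ Rop : L2 𝕜 →L[𝕜] L2 𝕜,
      IsC0ContractionSemigroup S ∧
      (∀ t : ℝ, 0 ≤ t → ExtendsFlow α γ₀ γ₁ t (S t) ∧
        ∀ A : L2 𝕜 →L[𝕜] L2 𝕜, ExtendsFlow α γ₀ γ₁ t A → A = S t) ∧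
      (∀ t : ℝ, 0 ≤ t → IsGivenBy (U t) (unperturbed α γ₀ γ₁ t)) ∧
      IsGivenBy Rop scatter ∧
      ∀ f : L2 𝕜, IsDuhamelSolution γ₀ U Rop f (fun t => S t f) ∧
        ∀ u : ℝ → L2 𝕜, IsDuhamelSolution γ₀ U Rop f u → ∀ t : ℝ, 0 ≤ t → u t = S t f := by
  obtain ⟨p, hp⟩ := hα.exists_isProfile
  obtain ⟨U, hU, hUg⟩ := hp.exists_freeFamily (𝕜 := 𝕜) hγ₀ hγ₁
  obtain ⟨Rop, hR⟩ := exists_scatterOperator (𝕜 := 𝕜)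
  obtain ⟨S, hSc, hSs, hSd⟩ := hU.exists_dyson_sum (((2 * γ₀ : ℝ) : 𝕜) • Rop)
  have hflow : ∀ t : ℝ, 0 ≤ t → ExtendsFlow α γ₀ γ₁ t (S t) := fun t ht W₀ h₀ hC W hW =>
    hp.flow_ae_eq hγ₀ hγ₁ hU hUg hR hSs h₀ hC hW ht
  have hmem : ∀ W₀ : ℝ × UnitAddCircle → 𝕜, IsC0 α γ₁ W₀ → MemLp W₀ 2 volume →
      ∀ W, IsClassicalSolution α γ₀ γ₁ W₀ W →
        ∀ t : ℝ, 0 ≤ t → IsC0 α γ₁ (W t) ∧ MemLp (W t) 2 volume := fun W₀ hC h₀ W hW t ht =>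
    ⟨hW.isC0 hC ht, (Lp.memLp _).ae_eq (hflow t ht W₀ h₀ hC W hW)⟩
  have hS0 : S 0 = ContinuousLinearMap.id 𝕜 (L2 𝕜) := by
    refine eq_of_eq_on_test fun F hF => Lp.ext ?_
    obtain ⟨W, hW⟩ := hp.exists_classical hγ₀ hγ₁ (hF.isC0 (α := α) (γ₁ := γ₁))
    filter_upwards [hflow 0 le_rfl F hF.memLp hF.isC0 W hW, hF.memLp.coeFn_toLp, ae_fst_ne_zero,
      ae_snd_ne_zero] with x h1 h2 h3 h4
    rw [h1, ContinuousLinearMap.id_apply, h2]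
    exact hW.initial x.1 x.2 h3 h4
  -- On test functions the semigroup law expresses that a solution restarted at time `t` is again a
  -- solution; `W t` qualifies as a datum because it stays in `𝒞₀ ∩ L²`.
  have hadd : ∀ s t : ℝ, 0 ≤ s → 0 ≤ t → S (s + t) = (S s).comp (S t) := by
    intro s t hs ht
    refine eq_of_eq_on_test fun F hF => Lp.ext ?_
    obtain ⟨W, hW⟩ := hp.exists_classical hγ₀ hγ₁ (hF.isC0 (α := α) (γ₁ := γ₁))
    have h1 := hflow (s + t) (add_nonneg hs ht) F hF.memLp hF.isC0 W hW
    obtain ⟨hC, hm⟩ := hmem F hF.isC0 hF.memLp W hW t ht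
    have h2 := hflow s hs (W t) hm hC _ (hW.restart ht)
    have h3 : S t (hF.memLp.toLp F) = hm.toLp (W t) :=
      Lp.ext ((hflow t ht F hF.memLp hF.isC0 W hW).trans hm.coeFn_toLp.symm)
    rw [ContinuousLinearMap.comp_apply, h3]
    rw [add_comm s t] at h1 ⊢
    exact h1.trans h2.symm
  have hcoe : ∀ t (u : ℝ → L2 𝕜), ∫ s in (0 : ℝ)..t, U (t - s) ((((2 * γ₀ : ℝ) : 𝕜) • Rop) (u s)) =
      (2 * γ₀) • ∫ s in (0 : ℝ)..t, U (t - s) (Rop (u s)) := by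
    intro t u
    rw [← intervalIntegral.integral_smul]
    simp only [smul_apply, map_smul, RCLike.real_smul_eq_coe_smul (K := 𝕜)]
  have hsol : ∀ f : L2 𝕜, IsDuhamelSolution γ₀ U Rop f (fun t => S t f) := fun f t ht =>
    ⟨(hSc f).intervalIntegrable _ _, (hU.continuous_integrand (hSc f) t).intervalIntegrable _ _, by
      rw [← hcoe t fun s => S s f]; exact hSd t f ht⟩
  refine ⟨fun W₀ hC => ⟨hp.exists_classical hγ₀ hγ₁ hC, fun W W' hW hW' t ht y k hy hk =>
    hp.unique hγ₀ hγ₁ hW hW' ht hy hk⟩, hmem, S, U, Rop, ⟨hS0, hadd, fun t ht f => ?_,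
    fun f => (hSc f).continuousOn⟩, fun t ht => ⟨hflow t ht, fun A hA => ?_⟩, hUg, hR,
    fun f => ⟨hsol f, fun u hu t ht => ?_⟩⟩
  · refine hU.norm_le_of_euler (B := ((2 * γ₀ : ℝ) : 𝕜) • Rop) (c := 32 * γ₀) hSc
      (fun f => by rw [hS0]; rfl) (fun s t f hs ht => by rw [hadd s t hs ht]; rfl) hSd
      (fun h f hh => hp.norm_euler_le hγ₀ hγ₁ hh (hUg h hh) hR f) ht f
  -- Test functions have zero trace at the interface, hence belong to `𝒞₀`, and they are dense; an
  -- extension of the flow is thereby determined.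
  · refine eq_of_eq_on_test fun F hF => Lp.ext ?_
    obtain ⟨W, hW⟩ := hp.exists_classical hγ₀ hγ₁ (hF.isC0 (α := α) (γ₁ := γ₁))
    exact (hA F hF.memLp hF.isC0 W hW).trans (hflow t ht F hF.memLp hF.isC0 W hW).symm
  · refine sub_eq_zero.1 (hU.duhamel_unique (B := ((2 * γ₀ : ℝ) : 𝕜) • Rop)
      (z := fun t => u t - S t f) (fun t ht => (hu t ht).1.sub (hsol f t ht).1) (fun t ht => ?_) ht)
    rw [hcoe t fun s => u s - S s f]
    simp only [map_sub]
    rw [intervalIntegral.integral_sub (hu t ht).2.1 (hsol f t ht).2.1, smul_sub, (hu t ht).2.2]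
    have e : S t f = U t f + (2 * γ₀) • ∫ s in (0 : ℝ)..t, U (t - s) (Rop (S s f)) :=
      (hsol f t ht).2.2
    nth_rewrite 1 [e]
    abel
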